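/- Let $N\ge 1$, $n,j\ge 0$ be integers and $\vec\beta=(\beta_1,\dots,\beta_{N-1})\in\mathbb N^{N-1}$, with $|\vec\beta|:=\sum_m\beta_m$ and, if $\beta_m>0$, $\vec\beta(\hat m):=(\beta_1,\dots,\beta_m-1,\dots,\beta_{N-1})$. **Banners.** Letters are the unbarred $u^c$ ($u\ge 1$ an integer, $0\le c\le N-1$ the color) and the barred $\bar u^0$ ($u\geq 1$, color $0$); $|u^c|=|\bar u^0|=u$. A *banner* is a finite word $B$ in these letters such that (1) a barred letter is followed by a letter of absolute value at most its own, (2) a $0$-colored unbarred letter is the last letter or is followed by a letter of absolute value at least its own, (3) the last letter (if any) is unbarred. Its color vector is the vector in $\mathbb N^{N-1}$ whose $m$-th coordinate is the number of letters of color $m$, and its weight is $\mathrm{wt}(B)=\prod_i x_{|B(i)|}$. Order the letters by $<_B$: first the letters of positive color, by absolute value and then by color; then the $0$-colored letters $1^0<_B\bar 1^0<_B2^0<_B\bar 2^0<_B\cdots$. A *Lyndon word* is a nonempty word strictly lexicographically larger than all its nontrivial rotations; every word is uniquely a concatenation of a weakly increasing sequence of Lyndon words, its *Lyndon factors* (here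 $v$ precedes $w$ if at the first difference $v$ has the smaller letter, or if $w$ is a proper prefix of $v$). Let $K_0(n,j,\vec\beta)$ be the set of banners of length $n$, with color vector $\vec\beta$ and exactly $j$ barred letters, none of whose Lyndon factors has length $1$. **Marked sequences.** For $0\le m\le N-1$ let $M(q,b,m)$ be the set of triples $(\omega,b,m)$ with $\omega=(\omega_1\le\dots\le\omega_q)$ positive integers and $0\le b<q$, where moreover $b\ge1$ if $m=0$. Put $\mathrm{wt}(\omega)=\prod_i x_{\omega_i}$. Define $$X_0=\biguplus_{\substack{0\le i\le n-2\\ j-n+i<k<j}}K_0(i,k,\vec\beta)\times M(n-i,j-k,0),$$ and for $1\le m\le N-1$ $$X_m=\biguplus_{\substack{0\le i\le n-1\\ j-n+i<k\le j}}K_0(i,k,\vec\beta(\hat m))\times M(n-i,j-k,m)\ \text{ if }\beta_m>0,\qquad X_m=\emptyset\ \text{ if }\beta_m=0$$ ($i,k$ range over nonnegative integers). **Colored Eulerian quasisymmetric functions.** A colored permutation $\pi\in C_N\wr S_n$ is a word $\pi_1\cdots\pi_n$, $\pi_i=|\pi_i|^{\epsilon_i}$, with $|\pi_1|\cdots|\pi_n|$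 a permutation of $1,\dots,n$ and $0\le\epsilon_i\le N-1$. Order $u^c<v^d$ iff $c>d$, or $c=d$ and $u<v$. Let $\mathrm{Exc}(\pi)=\{i:\pi_i>i^0\}$, $\mathrm{exc}(\pi)=|\mathrm{Exc}(\pi)|$, and let $\vec{\mathrm{col}}(\pi)\in\mathbb N^{N-1}$ count the letters of each positive color. Let $\tilde\pi$ be obtained by putting a tilde on $\pi_i$ for each $i\in\mathrm{Exc}(\pi)$, letters with tilde being ordered as before among themselves and smaller than all letters without, and let $\mathrm{DEX}(\pi)=\{i\in[n-1]:\tilde\pi_i>\tilde\pi_{i+1}\}$. For $T\subseteq[n-1]$ let $F_{T,n}=\sum x_{s_1}\cdots x_{s_n}$ over all $s_1\ge\dots\ge s_n\ge1$ with $s_i>s_{i+1}$ for $i\in T$. Let $Q_{n,j,\vec 0,\vec\beta}=\sum_\pi F_{\mathrm{DEX}(\pi),n}$ over all $\pi\in C_N\wr S_n$ with $\mathrm{exc}(\pi)=j$, $\vec{\mathrm{col}}(\pi)=\vec\beta$, and $|\pi_i|\ne i$ for all $i$. Let $h_r$ be the complete homogeneous symmetric function of degree $r$ in $x_1,x_2,\dots$.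 **Theorem.** Suppose $|\vec\beta|<n$. Then there is a bijection $$\gamma:K_0(n,j,\vec\beta)\to\biguplus_{m=0}^{N-1}X_m$$ such that $\mathrm{wt}(B)=\mathrm{wt}(B')\,\mathrm{wt}(\omega)$ whenever $\gamma(B)=(B',(\omega,b,m))$. Moreover, $$Q_{n,j,\vec 0,\vec\beta}=\sum_{\substack{0\le i\le n-2\\ j-n+i<k<j}}Q_{i,k,\vec 0,\vec\beta}\,h_{n-i}+\sum_{\substack{1\le m\le N-1\\ \beta_m>0}}\ \sum_{\substack{0\le i\le n-1\\ j-n+i<k\le j}}Q_{i,k,\vec 0,\vec\beta(\hat m)}\,h_{n-i}.$$ -/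

import Mathlib

namespace ColoredBanner

/-! ### Colors and color vectors -/

/-- The positive colors `1, …, N - 1`. -/
abbrev PosColor (N : ℕ) [NeZero N] : Type := {m : Fin N // m ≠ 0}

/-- Vectors in `ℕ ^ (N - 1)`, with coordinates indexed by the positive colors. -/
abbrev ColorVector (N : ℕ) [NeZero N] : Type := PosColor N → ℕ

/-- The absolute value `|β|`, the sum of the coordinates. -/
def size {N : ℕ} [NeZero N] (β : ColorVector N) : ℕ := ∑ m, β m

/-- The vector obtained from `β` by lowering the coordinate `m` by one
(only used when `0 < β m`). -/
def hat {N : ℕ} [NeZero N] (β : ColorVector N) (m : PosColor N) : ColorVector N :=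
  Function.update β m (β m - 1)

/-! ### The alphabet of colored and barred positive integers -/

/-- Letters: `plain u c` is the unbarred letter `u` of color `c`, and `bar u` is the barred letter
`u`, which is `0`-colored. -/
inductive Letter (N : ℕ) : Type
  | plain (u : ℕ+) (c : Fin N)
  | bar (u : ℕ+)

namespace Letter

variable {N : ℕ}

/-- The absolute value of a letter. -/
def abs : Letter N → ℕ+
  | plain u _ => u
  | bar u => u

/-- The color of a letter. -/
def color [NeZero N] : Letter N → Fin N
  | plain _ c => c
  | bar _ => 0

/-- Whether a letter is barred. -/
def isBarred : Letter N → Bool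
  | plain _ _ => false
  | bar _ => true

/-- Position of a letter in the order `<_B`. Letters of positive color come first, ordered by
absolute value and then by color; they are followed by the `0`-colored letters, ordered by
absolute value, where the unbarred `u` comes just before the barred `u`. -/
def key [NeZero N] : Letter N → (ℕ+ ×ₗ Fin N) ⊕ₗ (ℕ+ ×ₗ Bool)
  | plain u c => if c = 0 then toLex (Sum.inr (toLex (u, false)))
      else toLex (Sum.inl (toLex (u, c)))
  | bar u => toLex (Sum.inr (toLex (u, true)))

theorem key_injective [NeZero N] : Function.Injective (key (N := N)) := by
  intro a b h
  cases a <;> cases b <;> simp only [key] at h <;> (try split_ifs at h) <;> simp_all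

/-- The order `<_B` on letters. -/
noncomputable instance [NeZero N] : LinearOrder (Letter N) :=
  LinearOrder.lift' key key_injective

end Letter

/-! ### Lyndon words -/

section Lyndon

variable {A : Type*} [LinearOrder A]

/-- A Lyndon word is a nonempty word which is strictly lexicographically larger than all its
nontrivial circular rearrangements. -/
def IsLyndon (w : List A) : Prop :=
  w ≠ [] ∧ ∀ i, 0 < i → i < w.length → List.Lex (· < ·) (w.rotate i) w

/-- The lexicographic order in which Lyndon factors are compared: `u` is at most `v` when `u = v`,
or `u` has the smaller letter at the first place where they differ, or `v` is a proper prefix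
of `u`. (As Lyndon words are maximal and not minimal among their rotations, this is the usual
dictionary order for the reversed alphabet, read backwards; with prefixes placed
first, factorizations would neither exist nor be unique.) -/
def LexLE (u v : List A) : Prop :=
  u = v ∨ List.Lex (· > ·) v u

/-- A factorization of `w` into a weakly increasing sequence of Lyndon words. -/
def IsLyndonFactorization (L : List (List A)) (w : List A) : Prop :=
  L.flatten = w ∧ (∀ f ∈ L, IsLyndon f) ∧ L.Pairwise LexLE

/-- The word `w` has Lyndon type `lam`: the parts of `lam` are the lengths of the words in the
Lyndon factorization. -/
def HasLyndonType (w : List A) (lam : Multiset ℕ) : Prop :=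
  ∃ L : List (List A), IsLyndonFactorization L w ∧ lam = (L.map List.length : List ℕ)

end Lyndon

/-! ### Banners -/

section Banner

variable {N : ℕ} [NeZero N]

/-- Colored banners: a barred letter is followed by a letter of smaller or equal absolute value,
a `0`-colored unbarred letter is last or is followed by a letter of greater or equal absolute
value, and the last letter is unbarred. -/
def IsBanner (w : List (Letter N)) : Prop :=
  w.IsChain (fun a b =>
      (a.isBarred = true → b.abs ≤ a.abs) ∧
      (a.color = 0 ∧ a.isBarred = false → a.abs ≤ b.abs)) ∧
    ∀ h : w ≠ [], (w.getLast h).isBarred = false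

/-- The color vector of a word: the number of letters of each positive color. -/
def colorVector (w : List (Letter N)) : ColorVector N :=
  fun m => w.countP (fun l => decide (l.color = m.1))

/-- The number of barred letters of a word. -/
def bars (w : List (Letter N)) : ℕ := w.countP Letter.isBarred

/-- `K₀ n j β`: banners of length `n` whose Lyndon type has no part of size `1`, with color
vector `β` and exactly `j` bars. -/
def K₀ (n j : ℕ) (β : ColorVector N) : Set (List (Letter N)) :=
  {w | IsBanner w ∧ w.length = n ∧ (∃ lam, HasLyndonType w lam ∧ 1 ∉ lam) ∧
    colorVector w = β ∧ bars w = j}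

end Banner

/-! ### Marked sequences -/

/-- Colored marked sequences `(ω, b, m)`. -/
@[ext] structure MarkedSeq (N : ℕ) [NeZero N] where
  /-- the sequence -/
  seq : List ℕ+
  /-- the mark -/
  mark : ℕ
  /-- the color -/
  color : Fin N
  weaklyIncreasing : seq.Pairwise (· ≤ ·)
  mark_lt : mark < seq.length
  mark_pos : color = 0 → 1 ≤ mark

/-- `M n b m`: the `m`-colored marked sequences of length `n` and with mark `b`. -/
def M {N : ℕ} [NeZero N] (n b : ℕ) (m : Fin N) : Set (MarkedSeq N) :=
  {s | s.seq.length = n ∧ s.mark = b ∧ s.color = m}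

/-- The weight of a sequence of positive integers. -/
noncomputable def wtSeq (ω : List ℕ+) : MvPolynomial ℕ+ ℤ :=
  (ω.map (fun u => (MvPolynomial.X u : MvPolynomial ℕ+ ℤ))).prod

/-- The weight of a banner. -/
noncomputable def wt {N : ℕ} (w : List (Letter N)) : MvPolynomial ℕ+ ℤ :=
  (w.map (fun l => (MvPolynomial.X l.abs : MvPolynomial ℕ+ ℤ))).prod

/-! ### The sets `X m` -/

/-- Pairs `(i, k)` with `0 ≤ i ≤ n - 2` and `j - n + i < k < j`. -/
def index₀ (n j : ℕ) : Finset (ℕ × ℕ) :=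
  (Finset.range n ×ˢ Finset.range (j + 1)).filter
    (fun p => p.1 + 2 ≤ n ∧ j + p.1 < n + p.2 ∧ p.2 < j)

/-- Pairs `(i, k)` with `0 ≤ i ≤ n - 1` and `j - n + i < k ≤ j`. -/
def indexPos (n j : ℕ) : Finset (ℕ × ℕ) :=
  (Finset.range n ×ˢ Finset.range (j + 1)).filter
    (fun p => p.1 + 1 ≤ n ∧ j + p.1 < n + p.2 ∧ p.2 ≤ j)

section X

variable {N : ℕ} [NeZero N]

/-- The set `X m` of pairs of a shorter banner and an `m`-colored marked sequence. -/
noncomputable def X (n j : ℕ) (β : ColorVector N) (m : Fin N) :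
    Set (List (Letter N) × MarkedSeq N) :=
  if h : m = 0 then
    ⋃ p ∈ index₀ n j, K₀ p.1 p.2 β ×ˢ M (n - p.1) (j - p.2) m
  else if 0 < β ⟨m, h⟩ then
    ⋃ p ∈ indexPos n j, K₀ p.1 p.2 (hat β ⟨m, h⟩) ×ˢ M (n - p.1) (j - p.2) m
  else ∅

/-- The unions which define `X m` are disjoint. -/
theorem disjoint_pieces (n j : ℕ) (β : ColorVector N) (m : Fin N) {p q : ℕ × ℕ} (hpq : p ≠ q) :
    Disjoint (K₀ p.1 p.2 β ×ˢ M (n - p.1) (j - p.2) m)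
      (K₀ q.1 q.2 β ×ˢ M (n - q.1) (j - q.2) m) := by
  rw [Set.disjoint_left]
  rintro ⟨w, s⟩ ⟨⟨_, h1, _, _, h2⟩, _⟩ ⟨⟨_, h3, _, _, h4⟩, _⟩
  exact hpq (Prod.ext (h1.symm.trans h3) (h2.symm.trans h4))

end X

/-! ### Colored permutations and colored Eulerian quasisymmetric functions -/

/-- Colored permutations `π` in the wreath product of the cyclic group of order `N` with the
symmetric group, as words: the letter `π i` has absolute value `π.perm i` and color `π.col i`.
Values and positions are numbered from `0`. -/
@[ext] structure ColoredPerm (N n : ℕ) where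
  /-- the underlying permutation -/
  perm : Equiv.Perm (Fin n)
  /-- the colors of the letters -/
  col : Fin n → Fin N

/-- Colored permutations are pairs of a permutation and a word of colors. -/
def ColoredPerm.equivProd (N n : ℕ) :
    ColoredPerm N n ≃ Equiv.Perm (Fin n) × (Fin n → Fin N) where
  toFun π := (π.perm, π.col)
  invFun p := ⟨p.1, p.2⟩
  left_inv _ := rfl
  right_inv _ := rfl

instance (N n : ℕ) : Fintype (ColoredPerm N n) :=
  Fintype.ofEquiv _ (ColoredPerm.equivProd N n).symm

/-- The ordered alphabet of colored integers: letters of larger color come first, and letters of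
the same color are ordered by absolute value. -/
abbrev CLetter (N n : ℕ) : Type := (Fin N)ᵒᵈ ×ₗ Fin n

/-- The letter with absolute value `u` and color `c`. -/
def cletter {N n : ℕ} (u : Fin n) (c : Fin N) : CLetter N n := toLex (OrderDual.toDual c, u)

namespace ColoredPerm

variable {N n : ℕ} [NeZero N]

/-- The word of the colored permutation. -/
def letter (π : ColoredPerm N n) (i : Fin n) : CLetter N n := cletter (π.perm i) (π.col i)

/-- The excedance set. -/
def Exc (π : ColoredPerm N n) : Finset (Fin n) :=
  Finset.univ.filter (fun i => cletter i 0 < π.letter i)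

/-- The excedance number. -/
def exc (π : ColoredPerm N n) : ℕ := π.Exc.card

/-- The fixed point vector. -/
def fixVec (π : ColoredPerm N n) : Fin N → ℕ :=
  fun k => (Finset.univ.filter (fun i => π.letter i = cletter i k)).card

/-- The color vector. -/
def colVec (π : ColoredPerm N n) : ColorVector N :=
  fun m => (Finset.univ.filter (fun i => π.col i = m.1)).card

/-- The word with a tilde on the letters at excedances. A letter with a tilde
(left summand, remembering its absolute value) is smaller than every letter without. -/
def tilde (π : ColoredPerm N n) (i : Fin n) : Fin n ⊕ₗ CLetter N n :=
  if i ∈ π.Exc then toLex (Sum.inl (π.perm i)) else toLex (Sum.inr (π.letter i))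

/-- The set `DEX`: the descents of the word with tildes. -/
def DEX (π : ColoredPerm N n) : Set (Fin n) :=
  {i | ∃ h : i.1 + 1 < n, π.tilde ⟨i.1 + 1, h⟩ < π.tilde i}

end ColoredPerm

/-- The fundamental quasisymmetric function `F_{T,n}`: the sum of the monomials
`x_{s 1} ⋯ x_{s n}` over all weakly decreasing sequences `s` of positive integers that decrease
strictly at the positions in `T`. The coefficient of a monomial is the number of such sequences
that give this monomial (there is at most one). -/
noncomputable def fundamentalQS {n : ℕ} (T : Set (Fin n)) : MvPowerSeries ℕ+ ℤ :=
  fun d => (Nat.card {s : Fin n → ℕ+ // Antitone s ∧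
    (∀ i ∈ T, ∀ h : i.1 + 1 < n, s ⟨i.1 + 1, h⟩ < s i) ∧
    ∑ i, Finsupp.single (s i) 1 = d} : ℤ)

/-- The complete homogeneous symmetric function of degree `n` in `x_1, x_2, …`: the sum of all
monomials of degree `n`. -/
noncomputable def homogeneous (n : ℕ) : MvPowerSeries ℕ+ ℤ :=
  fun d => if d.degree = n then 1 else 0

open Classical in
/-- The colored Eulerian quasisymmetric function `Q_{n,j,α,β}`: the sum of `F_{DEX(π),n}` over the
colored permutations `π` with `j` excedances, fixed point vector `α` and color vector `β`. -/
noncomputable def Q {N : ℕ} [NeZero N] (n j : ℕ) (α : Fin N → ℕ) (β : ColorVector N) :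
    MvPowerSeries ℕ+ ℤ :=
  ∑ π : ColoredPerm N n with π.exc = j ∧ π.fixVec = α ∧ π.colVec = β, fundamentalQS π.DEX

end ColoredBanner

namespace ColoredBanner

/-! ### Insertion of marked letters -/

section Insertion

variable {L : Type*}

/-! Both claims rest on generating functions. Attach to a word the multiset of absolute values of
its letters. If two sets have finite fibers over this content and equal generating functions,
`exists_equiv_of_card_fiber_eq` gives a content-preserving bijection, which preserves weights. So it
suffices to prove that `Q n j 0 β` is the generating function of `K₀ n j β` (`Q_eq_genSeries`), and
that these generating functions satisfy the recurrence (`genSeries_K₀_eq`).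

The common tool is `IsInsertion`: each word has exactly one place where a given letter can be
inserted as a marked letter, and insertions of different letters do not interfere. Then the words
without marked letters are counted by successive subtraction: forbidding marked copies of `a`
multiplies the length series by `1 - ω a * z` (`IsInsertion.wordSeries_free`). Without weights,
equal counts of all words by content imply equal counts of words without marks
(`IsInsertion.cnt_free_eq`).

A banner has no Lyndon factor of length one exactly when it has no marked unbarred letter, the marks
being certain weak left-to-right maxima (`exists_hasLyndonType_iff`, `mem_free_isBanner_iff`).
Banners are in turn the weak banners without marked barred letters. On the other side, a colored
permutation with an admissible sequence is encoded by the word in which the letter of position `i`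
stands at the place `π i`; stable sorting recovers `π`. Having no fixed point means that sorting
fixes no letter, again a condition of having no marks. Before marks are removed, the words below
their sorted rows and the weak banners agree in number for each content: a weak banner read
backwards is a walk on rows, and the number of words below a sequence of rows does not depend on the
order of the rows (`cnt_below_eq_cnt_isWeakBanner`).

For the recurrence, let `T` be the length series of all banners over the letters up to `K`, `t` the
variable of a bar, `s m` that of the color `m`, and `σ` the sum of the `s m`. Splitting off the
first letter leads to a telescoping relation and to a closed formula for `T`
(`bannerSeries_formula`). After multiplication by the factors for the unbarred letters it becomes
`freeSeries_mul`: the series of the banners without short factors, times `1 - ∑ h r * markWeight r *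
z ^ r`, is the product of the factors `1 - x u * s m * z`. Every term of the coefficient of `z ^ n`
in that product has degree at least `n` in the colors, so it contributes nothing when `|β| < n`.
What remains is the recurrence, since `markWeight r` enumerates the admissible marks and colors of
sequences of length `r`. -/

theorem append_eq_append_cons {g r g' r' : List L} {b : L} (h : g ++ r = g' ++ b :: r') :
    (∃ s, g' = g ++ s ∧ r = s ++ b :: r') ∨ ∃ s, g = g' ++ b :: s ∧ r' = s ++ r := by
  rcases List.append_eq_append_iff.1 h with ⟨s, rfl, hs⟩ | ⟨s, rfl, hs⟩
  · exact Or.inl ⟨s, rfl, hs⟩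
  · cases s with
    | nil => exact Or.inl ⟨[], by simp, by simpa using hs.symm⟩
    | cons c s =>
      rw [List.cons_append, List.cons.injEq] at hs
      obtain ⟨rfl, rfl⟩ := hs
      exact Or.inr ⟨s, rfl, rfl⟩

theorem append_cons_eq_append_cons {g r g' r' : List L} {a b : L} (hab : b ≠ a)
    (h : g ++ a :: r = g' ++ b :: r') :
    (∃ s, g' = g ++ a :: s ∧ r = s ++ b :: r') ∨ ∃ s, g = g' ++ b :: s ∧ r' = s ++ a :: r := by
  rcases append_eq_append_cons h with ⟨s, rfl, hs⟩ | hs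
  · cases s with
    | nil => exact absurd (List.cons.inj hs).1.symm hab
    | cons c s =>
      rw [List.cons_append, List.cons.injEq] at hs
      obtain ⟨rfl, rfl⟩ := hs
      exact Or.inl ⟨s, rfl, rfl⟩
  · exact Or.inr hs

/-- The word has the letter `a` at a place that is marked by the relation `Sp`. -/
def Has (Sp : L → List L → List L → Prop) (a : L) (w : List L) : Prop :=
  ∃ g r, w = g ++ a :: r ∧ Sp a g r

/-- The words of `Ω` without marked letter in `F`. -/
def Free (Ω : Set (List L)) (Sp : L → List L → List L → Prop) (F : Set L) : Set (List L) :=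
  {w | w ∈ Ω ∧ ∀ b ∈ F, ¬ Has Sp b w}

/-- Every word of `Ω` has exactly one place at which the letter `a ∈ F` can be inserted as a marked
letter, and such insertions do not interfere with each other. -/
structure IsInsertion (Ω : Set (List L)) (Sp : L → List L → List L → Prop) (F : Set L) :
    Prop where
  exists_split : ∀ a ∈ F, ∀ w, ∃ g r, w = g ++ r ∧ Sp a g r
  split_unique : ∀ a ∈ F, ∀ g r g' r', g ++ r = g' ++ r' → Sp a g r → Sp a g' r' → g = g'
  insert_unique : ∀ a ∈ F, ∀ g r g' r', g ++ a :: r = g' ++ a :: r' → Sp a g r → Sp a g' r' →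
    g = g'
  mem_iff : ∀ a ∈ F, ∀ g r, Sp a g r → (g ++ a :: r ∈ Ω ↔ g ++ r ∈ Ω)
  has_iff : ∀ a ∈ F, ∀ b ∈ F, b ≠ a → ∀ g r, Sp a g r →
    (Has Sp b (g ++ a :: r) ↔ Has Sp b (g ++ r))

variable {Ω : Set (List L)} {Sp : L → List L → List L → Prop} {F : Set L}

/-- Since insertions do not interfere, inserting a marked `a` neither creates nor destroys marks of
the letters in `F'`. -/
theorem IsInsertion.mem_free_iff (h : IsInsertion Ω Sp F) {F' : Set L} (hF : F' ⊆ F) {a : L}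
    (ha : a ∈ F) (ha' : a ∉ F') {g r : List L} (hs : Sp a g r) :
    g ++ a :: r ∈ Free Ω Sp F' ↔ g ++ r ∈ Free Ω Sp F' := by
  unfold Free
  simp only [Set.mem_ofPred_eq, h.mem_iff a ha g r hs]
  refine and_congr_right fun _ => forall₂_congr fun b hb => ?_
  rw [h.has_iff a ha b (hF hb) (by rintro rfl; exact ha' hb) g r hs]

/-- Insertion of a marked letter. -/
theorem IsInsertion.exists_equiv (h : IsInsertion Ω Sp F) {F' : Set L} (hF : F' ⊆ F) {a : L}
    (ha : a ∈ F) (ha' : a ∉ F') :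
    ∃ e : Free Ω Sp F' ≃ {w // w ∈ Free Ω Sp F' ∧ Has Sp a w},
      ∀ w, ((e w).1 : Multiset L) = a ::ₘ (w.1 : Multiset L) := by
  choose g r hw hs using h.exists_split a ha
  let f : Free Ω Sp F' → {w // w ∈ Free Ω Sp F' ∧ Has Sp a w} := fun w =>
    ⟨g w.1 ++ a :: r w.1, (h.mem_free_iff hF ha ha' (hs w.1)).2 (hw w.1 ▸ w.2),
      g w.1, r w.1, rfl, hs w.1⟩
  have hf : Function.Bijective f := by
    constructor
    · rintro ⟨v, hv⟩ ⟨w, hw'⟩ hvw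
      simp only [f, Subtype.mk.injEq] at hvw ⊢
      have hg := h.insert_unique a ha _ _ _ _ hvw (hs v) (hs w)
      rw [hw v, hw w]
      rw [hg] at hvw ⊢
      simpa using hvw
    · rintro ⟨w, hwF, g', r', rfl, hs'⟩
      refine ⟨⟨g' ++ r', (h.mem_free_iff hF ha ha' hs').1 hwF⟩, ?_⟩
      simp only [f, Subtype.mk.injEq]
      have hg := h.split_unique a ha _ _ _ _ (hw (g' ++ r')).symm (hs _) hs'
      have hr := hw (g' ++ r')
      rw [hg] at hr ⊢
      rw [← List.append_cancel_left hr]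
  refine ⟨Equiv.ofBijective f hf, fun w => ?_⟩
  have h1 : ((Equiv.ofBijective f hf w).1) = g w.1 ++ a :: r w.1 := rfl
  rw [h1]
  conv_rhs => rw [hw w.1]
  exact Multiset.coe_eq_coe.2 List.perm_middle

theorem IsInsertion.mono {F' : Set L} (h : IsInsertion Ω Sp F) (hF : F' ⊆ F) :
    IsInsertion Ω Sp F' where
  exists_split a ha := h.exists_split a (hF ha)
  split_unique a ha := h.split_unique a (hF ha)
  insert_unique a ha := h.insert_unique a (hF ha)
  mem_iff a ha := h.mem_iff a (hF ha)
  has_iff a ha b hb := h.has_iff a (hF ha) b (hF hb)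

/-- Lets the forbidden letters be treated in two stages, with the words free of the first kind as
the new ambient set. -/
theorem IsInsertion.free {F₁ F₂ : Set L} (h : IsInsertion Ω Sp F) (h₁ : F₁ ⊆ F) (h₂ : F₂ ⊆ F)
    (hd : Disjoint F₁ F₂) : IsInsertion (Free Ω Sp F₁) Sp F₂ :=
  { h.mono h₂ with
    mem_iff := fun _ ha _ _ hs =>
      h.mem_free_iff h₁ (h₂ ha) (Set.disjoint_right.1 hd ha) hs }

theorem free_free (F₁ F₂ : Set L) : Free (Free Ω Sp F₁) Sp F₂ = Free Ω Sp (F₁ ∪ F₂) := by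
  ext w
  simp only [Free, Set.mem_ofPred_eq, Set.mem_union, or_imp, forall_and, and_assoc]

theorem free_empty : Free Ω Sp ∅ = Ω := by
  ext w; simp [Free]

theorem mem_free_insert {a : L} {w : List L} :
    w ∈ Free Ω Sp (insert a F) ↔ w ∈ Free Ω Sp F ∧ ¬ Has Sp a w := by
  simp only [Free, Set.mem_ofPred_eq, Set.mem_insert_iff, forall_eq_or_imp]
  tauto

theorem Has.mem {a : L} {w : List L} (h : Has Sp a w) : a ∈ w := by
  obtain ⟨g, r, rfl, -⟩ := h
  simp

/-- The number of words in `Ω` with given content. -/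
noncomputable def cnt (Ω : Set (List L)) (m : Multiset L) : ℕ :=
  Nat.card {w // w ∈ Ω ∧ (w : Multiset L) = m}

theorem finite_content (Ω : Set (List L)) (m : Multiset L) :
    Finite {w : List L // w ∈ Ω ∧ (w : Multiset L) = m} := by
  induction m using Quotient.inductionOn with
  | _ l =>
    classical
    refine Set.Finite.subset (l.permutations.toFinset.finite_toSet) ?_ |>.to_subtype
    rintro w ⟨-, hw⟩
    simpa using Multiset.coe_eq_coe.1 hw

theorem cnt_split (p : List L → Prop) (m : Multiset L) :
    cnt Ω m = cnt {w | w ∈ Ω ∧ p w} m + cnt {w | w ∈ Ω ∧ ¬ p w} m := by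
  classical
  have h1 := finite_content {w | w ∈ Ω ∧ p w} m
  have h2 := finite_content {w | w ∈ Ω ∧ ¬ p w} m
  unfold cnt
  rw [← Nat.card_sum]
  refine Nat.card_congr ⟨fun w => if h : p w.1 then Sum.inl ⟨w.1, ⟨w.2.1, h⟩, w.2.2⟩ else
    Sum.inr ⟨w.1, ⟨w.2.1, h⟩, w.2.2⟩,
    Sum.elim (fun w => ⟨w.1, w.2.1.1, w.2.2⟩) (fun w => ⟨w.1, w.2.1.1, w.2.2⟩), ?_, ?_⟩
  · intro w
    by_cases h : p w.1 <;> simp [h]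
  · rintro (w | w)
    · have := w.2.1.2
      simp [this]
    · have := w.2.1.2
      simp [this]

/-- Words with a marked `a` correspond to words with one `a` less, by deleting the marked copy. This
recursion determines the counts of free words from the counts of all words. -/
theorem IsInsertion.cnt_cons (h : IsInsertion Ω Sp F) {F' : Set L} (hF : F' ⊆ F) {a : L}
    (ha : a ∈ F) (ha' : a ∉ F') (m : Multiset L) :
    cnt (Free Ω Sp F') (a ::ₘ m) =
      cnt (Free Ω Sp F') m + cnt (Free Ω Sp (insert a F')) (a ::ₘ m) := by
  rw [cnt_split (Has Sp a)]
  congr 1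
  · obtain ⟨e, he⟩ := h.exists_equiv hF ha ha'
    unfold cnt
    symm
    let P : {w // w ∈ Free Ω Sp F' ∧ Has Sp a w} → Prop := fun w => (w.1 : Multiset L) = a ::ₘ m
    let P' : Free Ω Sp F' → Prop := fun w => (w.1 : Multiset L) = m
    have e1 : Subtype P' ≃ Subtype P := e.subtypeEquiv fun w => by
      simp only [he, Multiset.cons_inj_right]
    refine Nat.card_congr (((Equiv.subtypeSubtypeEquivSubtypeInter _ _).symm.trans e1).trans
      (Equiv.subtypeSubtypeEquivSubtypeInter (fun w => w ∈ Free Ω Sp F' ∧ Has Sp a w)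
        (fun w => (w : Multiset L) = a ::ₘ m)))
  · congr 1
    ext w
    exact mem_free_insert.symm

theorem cnt_free_insert_of_notMem {F' : Set L} {a : L} {m : Multiset L} (ha : a ∉ m) :
    cnt (Free Ω Sp (insert a F')) m = cnt (Free Ω Sp F') m := by
  unfold cnt
  refine Nat.card_congr (Equiv.subtypeEquivRight fun w => ?_)
  rw [mem_free_insert]
  refine ⟨fun h => ⟨h.1.1, h.2⟩, fun h => ⟨⟨h.1, fun hh => ha ?_⟩, h.2⟩⟩
  rw [← h.2]
  exact hh.mem

/-- Words with given content and without marked letters are equinumerous in two families,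
if all words with given content are. -/
theorem IsInsertion.cnt_free_eq {Ω' : Set (List L)} {Sp' : L → List L → List L → Prop}
    (h : IsInsertion Ω Sp F) (h' : IsInsertion Ω' Sp' F) (hc : ∀ m, cnt Ω m = cnt Ω' m)
    (m : Multiset L) : cnt (Free Ω Sp F) m = cnt (Free Ω' Sp' F) m := by
  classical
  have key : ∀ s : Finset L, ↑s ⊆ F → ∀ m, cnt (Free Ω Sp s) m = cnt (Free Ω' Sp' s) m := by
    intro s
    induction s using Finset.induction_on with
    | empty => intro _ m; simpa [free_empty] using hc m
    | insert a s ha ih =>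
      intro hs m
      rw [Finset.coe_insert] at hs ⊢
      rw [Set.insert_subset_iff] at hs
      by_cases ham : a ∈ m
      · obtain ⟨m, rfl⟩ := Multiset.exists_cons_of_mem ham
        -- In both families the count for `insert a s` is the difference of the same two counts for
        -- `s`, at the contents `a ::ₘ m` and `m`.
        have h1 := h.cnt_cons hs.2 hs.1 (by simpa using ha) m
        have h2 := h'.cnt_cons hs.2 hs.1 (by simpa using ha) m
        have h3 := ih hs.2 (a ::ₘ m)
        have h4 := ih hs.2 m
        omega
      · rw [cnt_free_insert_of_notMem ham, cnt_free_insert_of_notMem ham, ih hs.2]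
  -- Only letters that occur in `m` can be marked, so an infinite `F` may be replaced by a finite
  -- set.
  have red : ∀ (Ω : Set (List L)) (Sp : L → List L → List L → Prop), cnt (Free Ω Sp F) m =
      cnt (Free Ω Sp ↑(m.toFinset.filter (· ∈ F))) m := by
    intro Ω Sp
    unfold cnt
    refine Nat.card_congr (Equiv.subtypeEquivRight fun w => ?_)
    simp only [Free, Set.mem_ofPred_eq, Finset.coe_filter, Multiset.mem_toFinset]
    refine ⟨fun h => ⟨⟨h.1.1, fun b hb => h.1.2 b hb.2⟩, h.2⟩, fun h => ⟨⟨h.1.1, fun b hb hh =>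
      h.1.2 b ⟨?_, hb⟩ hh⟩, h.2⟩⟩
    rw [← h.2]
    exact hh.mem
  rw [red, red Ω']
  refine key _ ?_ m
  intro a ha
  simpa using (Finset.mem_filter.1 (Finset.mem_coe.1 ha)).2

end Insertion

end ColoredBanner

namespace ColoredBanner

/-- The letter `a` can be inserted between `g` and `r` so as to become a Lyndon factor. -/
def RecordSplit {A K : Type*} [LinearOrder K] (κ : A → K) (a : A) (g r : List A) : Prop :=
  (∀ x ∈ g, κ x ≤ κ a) ∧ ∀ b ∈ r.head?, κ a < κ b

/-! ### Existence of Lyndon factorizations -/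

section LyndonFactorization

variable {A : Type*} [LinearOrder A]

/-- The first letter at which the words differ is larger in `u`. -/
def StrictDiff (u v : List A) : Prop :=
  ∃ p a b s t, u = p ++ a :: s ∧ v = p ++ b :: t ∧ b < a

theorem StrictDiff.append {u v : List A} (h : StrictDiff u v) (x y : List A) :
    StrictDiff (u ++ x) (v ++ y) := by
  obtain ⟨p, a, b, s, t, rfl, rfl, hab⟩ := h
  exact ⟨p, a, b, s ++ x, t ++ y, by simp, by simp, hab⟩

theorem StrictDiff.append_left {u v : List A} (h : StrictDiff u v) (x : List A) :
    StrictDiff (x ++ u) (x ++ v) := by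
  obtain ⟨p, a, b, s, t, rfl, rfl, hab⟩ := h
  exact ⟨x ++ p, a, b, s, t, by simp, by simp, hab⟩

/-- Separates the two ways in which `u` can precede `v` for the reversed alphabet. A strict
difference survives appending arbitrary words; a proper prefix does not. -/
theorem lex_gt_iff {u v : List A} :
    List.Lex (· > ·) u v ↔ StrictDiff u v ∨ ∃ c t, v = u ++ c :: t := by
  constructor
  · intro h
    induction h with
    | nil => exact Or.inr ⟨_, _, rfl⟩
    | rel h => exact Or.inl ⟨[], _, _, _, _, rfl, rfl, h⟩
    | cons h ih =>
      rcases ih with h | ⟨c, t, rfl⟩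
      · exact Or.inl (h.append_left [_])
      · exact Or.inr ⟨c, t, rfl⟩
  · rintro (⟨p, a, b, s, t, rfl, rfl, hab⟩ | ⟨c, t, rfl⟩)
    · induction p with
      | nil => exact List.Lex.rel hab
      | cons x p ih => exact List.Lex.cons ih
    · induction u with
      | nil => exact List.Lex.nil
      | cons x p ih => exact List.Lex.cons ih

theorem lex_gt_trichotomy (u v : List A) :
    List.Lex (· > ·) u v ∨ u = v ∨ List.Lex (· > ·) v u := by
  induction u generalizing v with
  | nil =>
    cases v with
    | nil => simp
    | cons b v => exact Or.inl List.Lex.nil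
  | cons a u ih =>
    cases v with
    | nil => exact Or.inr (Or.inr List.Lex.nil)
    | cons b v =>
      rcases lt_trichotomy a b with h | rfl | h
      · exact Or.inr (Or.inr (List.Lex.rel h))
      · rcases ih v with h | rfl | h
        · exact Or.inl (List.Lex.cons h)
        · simp
        · exact Or.inr (Or.inr (List.Lex.cons h))
      · exact Or.inl (List.Lex.rel h)

theorem lex_gt_trans {u v w : List A} (h₁ : List.Lex (· > ·) u v) (h₂ : List.Lex (· > ·) v w) :
    List.Lex (· > ·) u w := by
  induction h₁ generalizing w with
  | nil => cases h₂ <;> exact List.Lex.nil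
  | rel h =>
    cases h₂ with
    | rel h' => exact List.Lex.rel (lt_trans h' h)
    | cons h' => exact List.Lex.rel h
  | cons h ih =>
    cases h₂ with
    | rel h' => exact List.Lex.rel h'
    | cons h' => exact List.Lex.cons (ih h')

theorem lex_gt_irrefl (u : List A) : ¬ List.Lex (· > ·) u u := by
  induction u with
  | nil => rintro ⟨⟩
  | cons a u ih =>
    rintro (_ | h | h)
    · exact lt_irrefl _ h
    · exact ih h

theorem LexLE.trans {u v w : List A} (h₁ : LexLE u v) (h₂ : LexLE v w) : LexLE u w := by
  rcases h₁ with rfl | h₁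
  · exact h₂
  · rcases h₂ with rfl | h₂
    · exact Or.inr h₁
    · exact Or.inr (lex_gt_trans h₂ h₁)

/-- Rotations have equal lengths, so the prefix convention plays no role and reversing the alphabet
just reverses the order. -/
theorem lex_lt_iff_of_length_eq {u v : List A} (h : u.length = v.length) :
    List.Lex (· < ·) u v ↔ List.Lex (· > ·) v u := by
  induction u generalizing v with
  | nil => cases v with
    | nil => constructor <;> rintro ⟨⟩
    | cons => simp at h
  | cons a u ih => cases v with
    | nil => simp at h
    | cons b v =>
      have hl : u.length = v.length := by simpa using h
      constructor
      · rintro (_ | h | h)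
        · exact List.Lex.rel h
        · exact List.Lex.cons ((ih hl).1 h)
      · rintro (_ | h | h)
        · exact List.Lex.rel h
        · exact List.Lex.cons ((ih hl).2 h)

theorem isLyndon_iff_rotate {w : List A} : IsLyndon w ↔
    w ≠ [] ∧ ∀ u v, u ≠ [] → v ≠ [] → w = u ++ v → List.Lex (· > ·) (u ++ v) (v ++ u) := by
  refine and_congr_right fun _ => ⟨?_, ?_⟩
  · rintro h u v hu hv rfl
    have h1 := h u.length (List.length_pos_iff.2 hu)
      (by simpa using List.length_pos_iff.2 hv)
    rw [List.rotate_append_length_eq] at h1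
    exact (lex_lt_iff_of_length_eq (by simp [add_comm])).1 h1
  · intro h i h0 hi
    rw [List.rotate_eq_drop_append_take hi.le]
    rw [lex_lt_iff_of_length_eq (by simp; omega)]
    have := h (w.take i) (w.drop i) (by simp; exact ⟨by omega, by rintro rfl; simp at hi⟩)
      (by simpa using hi) (by simp)
    simpa using this

/-- A word is Lyndon iff it precedes its proper suffixes, in the dictionary order of the reversed
alphabet. -/
theorem isLyndon_iff_suffix {w : List A} : IsLyndon w ↔
    w ≠ [] ∧ ∀ u v, u ≠ [] → v ≠ [] → w = u ++ v → List.Lex (· > ·) w v := by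
  rw [isLyndon_iff_rotate]
  refine and_congr_right fun _ => ⟨?_, ?_⟩
  · rintro h u v hu hv rfl
    rcases lex_gt_trichotomy (u ++ v) v with h1 | h1 | h1
    · exact h1
    · exact absurd (by simpa using h1) hu
    · exfalso
      have h2 := h u v hu hv rfl
      rcases lex_gt_iff.1 h1 with h3 | ⟨c, t, h3⟩
      · have h4 := h3.append u []
        rw [List.append_nil] at h4
        exact lex_gt_irrefl _ (lex_gt_trans h2 (lex_gt_iff.2 (Or.inl h4)))
      -- Here `v` is both a prefix and a suffix, `u ++ v = v ++ c :: t`. Comparison with the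
      -- rotation `v ++ u` puts `c :: t` before `u`; the lengths agree, so this is a strict
      -- difference, and the rotation `c :: t ++ v` would come before the word itself.
      · have hlen : (c :: t).length = u.length := by
          have := congrArg List.length h3
          simp at this ⊢
          omega
        rw [h3] at h2
        have h5 := h v (c :: t) hv (by simp) h3
        have h6 : List.Lex (· > ·) (c :: t) u := by
          rcases lex_gt_trichotomy (c :: t) u with h | h | h
          · exact h
          · exact absurd (h ▸ h2) (lex_gt_irrefl _)
          · have h7 : List.Lex (· > ·) (v ++ u) (v ++ c :: t) := by
              rcases lex_gt_iff.1 h with h | ⟨c', t', h⟩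
              · exact lex_gt_iff.2 (Or.inl (h.append_left v))
              · exact lex_gt_iff.2 (Or.inr ⟨c', t', by simp [h]⟩)
            exact absurd (lex_gt_trans h2 h7) (lex_gt_irrefl _)
        rcases lex_gt_iff.1 h6 with h | ⟨c', t', h⟩
        · have h7 := h.append v v
          rw [← h3] at h5
          exact lex_gt_irrefl _ (lex_gt_trans h5 (lex_gt_iff.2 (Or.inl h7)))
        · have := congrArg List.length h
          simp at this hlen
          omega
  · rintro h u v hu hv rfl
    rcases lex_gt_iff.1 (h u v hu hv rfl) with h1 | ⟨c, t, h1⟩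
    · have := h1.append [] u
      rw [List.append_nil] at this
      exact lex_gt_iff.2 (Or.inl this)
    · have := congrArg List.length h1
      simp at this
      have := List.length_pos_iff.2 hu
      omega

theorem isLyndon_singleton (a : A) : IsLyndon [a] := by
  refine ⟨by simp, fun i h0 hi => ?_⟩
  simp at hi
  omega

/-- The point is that `f ++ g` precedes `g`. If `f` is a proper prefix of `g`, this follows from
comparing `g` with its suffix after `f`. All other suffixes are then compared through `g` or through
a suffix of `f`. -/
theorem IsLyndon.append {f g : List A} (hf : IsLyndon f) (hg : IsLyndon g)
    (h : List.Lex (· > ·) f g) : IsLyndon (f ++ g) := by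
  rw [isLyndon_iff_suffix] at *
  have main : List.Lex (· > ·) (f ++ g) g := by
    rcases lex_gt_iff.1 h with h1 | ⟨c, t, rfl⟩
    · have := h1.append g []
      rw [List.append_nil] at this
      exact lex_gt_iff.2 (Or.inl this)
    · rcases lex_gt_iff.1 (hg.2 f (c :: t) hf.1 (by simp) rfl) with h2 | ⟨c', t', h2⟩
      · exact lex_gt_iff.2 (Or.inl (h2.append_left f))
      · have := congrArg List.length h2
        simp at this
        omega
  refine ⟨by simp [hf.1], fun u v hu hv huv => ?_⟩
  rcases List.append_eq_append_iff.1 huv with ⟨s, rfl, hs⟩ | ⟨s, hs, rfl⟩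
  · rcases eq_or_ne s [] with rfl | hs'
    · simp only [List.nil_append] at hs
      subst hs
      exact main
    · exact lex_gt_trans main (hg.2 s v hs' hv hs)
  · rcases eq_or_ne s [] with rfl | hs'
    · exact main
    · rcases lex_gt_iff.1 (hf.2 u s hu hs' hs) with h1 | ⟨c, t, h1⟩
      · exact lex_gt_iff.2 (Or.inl (h1.append g g))
      · have := congrArg List.length (hs.symm.trans (by rfl : f = f))
        have h2 := congrArg List.length h1
        simp at this h2
        omega

/-- A Lyndon word put in front of a factorization either is in order with the first factor or can be
concatenated with it to a longer Lyndon word; in the latter case the merging continues. -/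
theorem exists_lyndon_merge (L : List (List A)) : ∀ f, IsLyndon f → (∀ g ∈ L, IsLyndon g) →
    L.Pairwise LexLE → ∃ L', IsLyndonFactorization L' (f ++ L.flatten) := by
  induction L with
  | nil => intro f hf _ _; exact ⟨[f], by simp [IsLyndonFactorization, hf]⟩
  | cons g L ih =>
    intro f hf hL hp
    by_cases hfg : LexLE f g
    · refine ⟨f :: g :: L, rfl, by simpa [hf] using hL, ?_⟩
      refine List.pairwise_cons.2 ⟨fun x hx => ?_, hp⟩
      rcases List.mem_cons.1 hx with rfl | hx
      · exact hfg
      · exact hfg.trans ((List.pairwise_cons.1 hp).1 x hx)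
    · unfold LexLE at hfg
      push Not at hfg
      rcases lex_gt_trichotomy f g with h | h | h
      · obtain ⟨L', h1, h2⟩ := ih (f ++ g) (hf.append (hL g (by simp)) h)
          (fun x hx => hL x (by simp [hx])) (List.pairwise_cons.1 hp).2
        exact ⟨L', by rw [h1]; simp, h2⟩
      · exact absurd h hfg.1
      · exact absurd h hfg.2

/-- Every word has a Lyndon factorization. -/
theorem exists_isLyndonFactorization (w : List A) : ∃ L, IsLyndonFactorization L w := by
  induction w with
  | nil => exact ⟨[], by simp [IsLyndonFactorization]⟩
  | cons a w ih =>
    obtain ⟨L, rfl, h2, h3⟩ := ih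
    exact exists_lyndon_merge L [a] (isLyndon_singleton a) h2 h3

/-- The word precedes each of its suffixes, in particular the suffix that starts with `b`, so `b`
cannot exceed the first letter. -/
theorem IsLyndon.le_head {a : A} {w : List A} (h : IsLyndon (a :: w)) {b : A} (hb : b ∈ a :: w) :
    b ≤ a := by
  obtain ⟨u, v, huv⟩ := List.append_of_mem hb
  rcases eq_or_ne u [] with rfl | hu
  · simp at huv; exact huv.1.ge
  · rcases (isLyndon_iff_suffix.1 h).2 u (b :: v) hu (by simp) huv with _ | h | h
    · exact le_of_lt h
    · exact le_rfl

theorem IsLyndon.last_lt_head {a b : A} {w : List A} (h : IsLyndon (a :: (w ++ [b]))) : b < a := by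
  rcases (isLyndon_iff_suffix.1 h).2 (a :: w) [b] (by simp) (by simp) (by simp) with _ | h | h
  · exact h
  · exact absurd h List.not_lex_nil

/-- A word has a Lyndon factorization without factors of length `1` iff every letter that is at
least as large as all its predecessors is followed by a letter that is not larger. -/
theorem exists_hasLyndonType_iff {w : List A} :
    (∃ lam, HasLyndonType w lam ∧ 1 ∉ lam) ↔ ∀ a, ¬ Has (RecordSplit id) a w := by
  constructor
  · rintro ⟨lam, ⟨L, ⟨h1, h2, -⟩, rfl⟩, hlam⟩ a ⟨g, r, rfl, hg, hr⟩
    simp only [id] at hg hr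
    have hlen : ∀ f ∈ L, f.length ≠ 1 := fun f hf hf1 => hlam (by
      simp only [Multiset.mem_coe, List.mem_map]
      exact ⟨f, hf, hf1⟩)
    -- Locates the factor `u ++ a :: v` that contains the marked letter. Its first letter is its
    -- maximum and `a` is at least as large as everything before it. So `a` equals the first letter,
    -- and the letter after `a` in this factor cannot be larger; a last letter of a longer factor
    -- would be smaller than the first.
    obtain ⟨L₁, u, v, L₂, hL, hu, hv⟩ : ∃ L₁ u v L₂, L = L₁ ++ (u ++ a :: v) :: L₂ ∧
        g = L₁.flatten ++ u ∧ r = v ++ L₂.flatten := by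
      rcases List.flatten_eq_append_iff.1 h1 with ⟨as, bs, h3, h4, h5⟩ | ⟨as, bs, c, cs, ds, h3, h4, h5⟩
      · obtain ⟨as', cs, ds, h6, h7, h8⟩ := List.flatten_eq_cons_iff.1 h5.symm
        refine ⟨as ++ as', [], cs, ds, by simp [h3, h6], ?_, h8⟩
        have : as'.flatten = [] := by simpa using h7
        simp [h4, this]
      · rw [List.cons_append, List.cons.injEq] at h5
        obtain ⟨rfl, rfl⟩ := h5
        exact ⟨as, bs, cs, ds, h3, h4, rfl⟩
    have hf := h2 (u ++ a :: v) (by simp [hL])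
    have hl := hlen (u ++ a :: v) (by simp [hL])
    cases u with
    | nil =>
      cases v with
      | nil => simp at hl
      | cons c v => exact absurd (hf.le_head (b := c) (by simp)) (not_le.2 (hr c (by simp [hv])))
    | cons c u =>
      have hac : a = c := le_antisymm (hf.le_head (by simp)) (hg c (by simp [hu]))
      subst hac
      rcases List.eq_nil_or_concat v with rfl | ⟨v', b, rfl⟩
      · exact lt_irrefl _ hf.last_lt_head
      · cases v' with
        | nil => exact absurd (hf.le_head (b := b) (by simp)) (not_le.2 (hr b (by simp [hv])))
        | cons c v' => exact absurd (hf.le_head (b := c) (by simp)) (not_le.2 (hr c (by simp [hv])))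
  · intro h
    obtain ⟨L, hL⟩ := exists_isLyndonFactorization w
    refine ⟨_, ⟨L, hL, rfl⟩, fun h1 => ?_⟩
    obtain ⟨rfl, h2, h3⟩ := hL
    simp only [Multiset.mem_coe, List.mem_map] at h1
    obtain ⟨f, hf, hf1⟩ := h1
    obtain ⟨a, rfl⟩ := List.length_eq_one_iff.1 hf1
    -- Splitting the reversed list selects the last factor equal to `[a]`, so that the next factor
    -- differs from `[a]` and hence starts with a larger letter.
    obtain ⟨L₂, L₁, hL, hn⟩ := List.eq_append_cons_of_mem (List.mem_reverse.2 hf)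
    have hL' : L = L₁.reverse ++ [a] :: L₂.reverse := by
      rw [← List.reverse_reverse L, hL]
      simp
    rw [hL'] at h2 h3 h
    rw [List.pairwise_append] at h3
    refine h a ⟨L₁.reverse.flatten, L₂.reverse.flatten, by simp, fun x hx => ?_, fun b hb => ?_⟩
    · simp only [id]
      obtain ⟨f, hf, hx⟩ := List.mem_flatten.1 hx
      have hfl := h2 f (by simp only [List.mem_append]; exact Or.inl hf)
      have hfa := h3.2.2 f hf [a] (by simp)
      cases f with
      | nil => simp at hx
      | cons c f =>
        refine (hfl.le_head hx).trans ?_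
        rcases hfa with h | _ | h | h
        · simp at h; exact h.1.le
        · exact le_of_lt h
        · exact le_rfl
    · simp only [id]
      cases hL2 : L₂.reverse with
      | nil => simp [hL2] at hb
      | cons f L₂' =>
        have hfm : f ∈ L₂.reverse := by simp [hL2]
        have hfl := h2 f (by simp only [List.mem_append, List.mem_cons]; exact Or.inr (Or.inr hfm))
        have hfa := (List.pairwise_cons.1 h3.2.1).1 f hfm
        cases f with
        | nil => exact absurd rfl hfl.1
        | cons c f =>
          simp [hL2] at hb
          subst hb
          rcases hfa with h | h
          · exact absurd (h ▸ List.mem_reverse.1 hfm) hn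
          · cases h with
            | cons h => cases h
            | rel h => exact h

end LyndonFactorization

/-! ### Insertion at records -/

section Record

variable {A : Type*}

/-- The insertion place is forced: it comes after the longest prefix whose keys are at most `κ a`.
-/
theorem RecordSplit.eq_takeWhile {K : Type*} [LinearOrder K] {κ : A → K} {a : A} {g r : List A}
    (h : RecordSplit κ a g r) : g = (g ++ r).takeWhile (fun x => decide (κ x ≤ κ a)) := by
  rw [List.takeWhile_append_of_pos (by simpa using h.1)]
  cases r with
  | nil => simp
  | cons b r =>
    have := h.2 b (by simp)
    rw [List.takeWhile_cons_of_neg (by simpa using this)]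
    simp

theorem recordSplit_takeWhile {K : Type*} [LinearOrder K] (κ : A → K) (a : A) (w : List A) :
    RecordSplit κ a (w.takeWhile (fun x => decide (κ x ≤ κ a)))
      (w.dropWhile (fun x => decide (κ x ≤ κ a))) := by
  refine ⟨fun x hx => by simpa using List.mem_takeWhile_imp hx, fun b hb => ?_⟩
  have := List.head?_dropWhile_not (fun x => decide (κ x ≤ κ a)) w
  rw [Option.mem_def] at hb
  rw [hb] at this
  simpa using this

/-- Existence and uniqueness of the place come from `takeWhile`; after the insertion `g ++ [a]` is
the prefix in question. Injectivity on `F` makes the keys of two letters distinct, so marked letters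
have increasing keys along the word, and putting `a` next to a marked `b`, or deleting it, leaves a
larger letter or the end after `b`. -/
theorem isInsertion_recordSplit {K : Type*} [LinearOrder K] (κ : A → K) {Ω : Set (List A)}
    {F : Set A} (hκ : Set.InjOn κ F)
    (hΩ : ∀ a ∈ F, ∀ g r, RecordSplit κ a g r → (g ++ a :: r ∈ Ω ↔ g ++ r ∈ Ω)) :
    IsInsertion Ω (RecordSplit κ) F where
  exists_split a _ w := ⟨_, _, List.takeWhile_append_dropWhile.symm, recordSplit_takeWhile κ a w⟩
  split_unique a _ g r g' r' he h h' := by rw [h.eq_takeWhile, h'.eq_takeWhile, he]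
  insert_unique a _ g r g' r' he h h' := by
    have h1 : RecordSplit κ a (g ++ [a]) r := ⟨by simpa [or_imp, forall_and] using h.1, h.2⟩
    have h2 : RecordSplit κ a (g' ++ [a]) r' := ⟨by simpa [or_imp, forall_and] using h'.1, h'.2⟩
    have h3 := h1.eq_takeWhile
    have h4 := h2.eq_takeWhile
    rw [List.append_assoc, List.singleton_append] at h3 h4
    rw [he, ← h4] at h3
    simpa using h3
  mem_iff := hΩ
  has_iff a ha b hb hab g r h := by
    have hne : κ a ≠ κ b := fun h => hab (hκ ha hb h).symm
    constructor
    · rintro ⟨g', r', he, h'⟩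
      rcases append_cons_eq_append_cons hab he with ⟨s, rfl, rfl⟩ | ⟨s, rfl, rfl⟩
      · refine ⟨g ++ s, r', by simp, fun x hx => h'.1 x ?_, h'.2⟩
        simp at hx ⊢
        tauto
      · refine ⟨g', s ++ r, by simp, h'.1, fun c hc => ?_⟩
        cases s with
        | nil =>
          exact (lt_of_le_of_ne (h.1 b (by simp)) hne.symm).trans (h.2 c (by simpa using hc))
        | cons d s => exact h'.2 c (by simpa using hc)
    · rintro ⟨g', r', he, h'⟩
      rcases append_eq_append_cons he with ⟨s, rfl, rfl⟩ | ⟨s, rfl, rfl⟩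
      · have hlt : κ a < κ b := by
          cases s with
          | nil => exact h.2 b (by simp)
          | cons d s => exact (h.2 d (by simp)).trans_le (h'.1 d (by simp))
        refine ⟨g ++ a :: s, r', by simp, fun x hx => ?_, h'.2⟩
        simp only [List.mem_append, List.mem_cons] at hx
        rcases hx with hx | rfl | hx
        · exact h'.1 x (by simp [hx])
        · exact hlt.le
        · exact h'.1 x (by simp [hx])
      · refine ⟨g', s ++ a :: r, by simp, h'.1, fun c hc => ?_⟩
        cases s with
        | nil =>
          simp only [List.nil_append, List.head?_cons, Option.mem_def, Option.some.injEq] at hc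
          exact hc ▸ lt_of_le_of_ne (h.1 b (by simp)) hne.symm
        | cons d s => exact h'.2 c (by simpa using hc)

end Record

end ColoredBanner

namespace ColoredBanner

/-! ### Insertion of letters into banners -/

section BannerInsertion

variable {N : ℕ} [NeZero N]

namespace Letter

theorem le_iff_key {a b : Letter N} : a ≤ b ↔ a.key ≤ b.key := Iff.rfl

theorem lt_iff_key {a b : Letter N} : a < b ↔ a.key < b.key := Iff.rfl

/-- From a `0`-colored letter upwards, the order `<_B` contains only `0`-colored letters and is
weakly monotone in absolute value. This links the maxima for `<_B` with the banner conditions. -/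
theorem color_and_abs_of_le {a b : Letter N} (ha : a.color = 0) (h : a ≤ b) :
    b.color = 0 ∧ a.abs ≤ b.abs := by
  rw [le_iff_key] at h
  cases a with
  | plain u c =>
    simp only [color] at ha
    subst ha
    cases b with
    | plain v d =>
      by_cases hd : d = 0
      · simp [key, hd, Prod.Lex.toLex_le_toLex] at h
        simp only [color, abs]
        exact ⟨hd, h.elim le_of_lt le_of_eq⟩
      · simp [key, hd] at h
    | bar v =>
      simp [key, Prod.Lex.toLex_le_toLex] at h
      simp only [color, abs]
      exact ⟨trivial, h.elim le_of_lt le_of_eq⟩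
  | bar u =>
    cases b with
    | plain v d =>
      by_cases hd : d = 0
      · simp [key, hd, Prod.Lex.toLex_le_toLex] at h
        simp only [color, abs]
        exact ⟨hd, h.elim le_of_lt (fun h => h.1.le)⟩
      · simp [key, hd] at h
    | bar v =>
      simp [key, Prod.Lex.toLex_le_toLex] at h
      simp only [color, abs]
      exact ⟨trivial, h.elim le_of_lt le_of_eq⟩

theorem abs_lt_of_isBarred {a b : Letter N} (ha : a.isBarred = true) (h : a < b) :
    a.abs < b.abs := by
  rw [lt_iff_key] at h
  cases a with
  | plain u c => simp [isBarred] at ha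
  | bar u =>
    cases b with
    | plain v d =>
      by_cases hd : d = 0
      · subst hd
        simp [key, Prod.Lex.toLex_lt_toLex] at h
        exact h.elim id fun h => absurd h.2 (by decide)
      · simp [key, hd] at h
    | bar v =>
      simp [key, Prod.Lex.toLex_lt_toLex] at h
      exact h

end Letter

/-- In a banner, the letter `a` may be followed by the word `w`. -/
def MayPrecede (a : Letter N) (w : List (Letter N)) : Prop :=
  (a.isBarred = true → ∃ b ∈ w.head?, b.abs ≤ a.abs) ∧
    (a.color = 0 ∧ a.isBarred = false → ∀ b ∈ w.head?, a.abs ≤ b.abs)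

theorem isBanner_cons {a : Letter N} {w : List (Letter N)} :
    IsBanner (a :: w) ↔ MayPrecede a w ∧ IsBanner w := by
  cases w with
  | nil => simp [IsBanner, MayPrecede]
  | cons b w =>
    simp only [IsBanner, MayPrecede, List.isChain_cons_cons, List.getLast_cons_cons,
      List.head?_cons, Option.mem_def, Option.some.injEq]
    simp
    tauto

theorem isBanner_nil : IsBanner ([] : List (Letter N)) := by simp [IsBanner]

/-- A form local to each letter, suited to comparing a word before and after an insertion. -/
theorem isBanner_iff {w : List (Letter N)} :
    IsBanner w ↔ ∀ g a r, w = g ++ a :: r → MayPrecede a r := by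
  induction w with
  | nil => simp [isBanner_nil]
  | cons c w ih =>
    rw [isBanner_cons, ih]
    constructor
    · rintro ⟨h1, h2⟩ g a r h
      cases g with
      | nil =>
        simp only [List.nil_append, List.cons.injEq] at h
        obtain ⟨rfl, rfl⟩ := h
        exact h1
      | cons d g =>
        simp only [List.cons_append, List.cons.injEq] at h
        exact h2 g a r h.2
    · intro h
      exact ⟨h [] c w rfl, fun g a r hw => h (c :: g) a r (by simp [hw])⟩

/-- The conditions on a banner, except that a barred letter may also be followed by a larger letter
or be the last one, if no earlier letter is larger. -/
def IsWeakBanner (w : List (Letter N)) : Prop :=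
  ∀ g a r, w = g ++ a :: r →
    (a.isBarred = true → (∃ b ∈ r.head?, b.abs ≤ a.abs) ∨ ∀ x ∈ g, x.abs ≤ a.abs) ∧
    (a.color = 0 ∧ a.isBarred = false → ∀ b ∈ r.head?, a.abs ≤ b.abs)

/-- The barred letters. -/
def barredLetters (N : ℕ) : Set (Letter N) := {a | a.isBarred = true}

/-- The unbarred letters. -/
def plainLetters (N : ℕ) : Set (Letter N) := {a | a.isBarred = false}

omit [NeZero N] in
theorem mem_barredLetters {a : Letter N} : a ∈ barredLetters N ↔ a.isBarred = true := Iff.rfl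

omit [NeZero N] in
theorem mem_plainLetters {a : Letter N} : a ∈ plainLetters N ↔ a.isBarred = false := Iff.rfl

/-- The inserted `a` is admissible because no earlier letter is larger. A barred `b` just before `a`
must dominate all its predecessors in either word: before the insertion a larger letter or the end
follows, and after it `b` may only be followed by `a` if it dominates or has the absolute value of
`a`, which again makes it dominate. -/
theorem isWeakBanner_insert_iff {a : Letter N} (ha : a.isBarred = true) {g r : List (Letter N)}
    (h : RecordSplit Letter.abs a g r) : IsWeakBanner (g ++ a :: r) ↔ IsWeakBanner (g ++ r) := by
  constructor
  · intro hw g' b r' he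
    rcases append_eq_append_cons he with ⟨s, rfl, rfl⟩ | ⟨s, rfl, rfl⟩
    · obtain ⟨h1, h2⟩ := hw (g ++ a :: s) b r' (by simp)
      refine ⟨fun hb => (h1 hb).imp_right fun h x hx => h x ?_, h2⟩
      simp at hx ⊢
      tauto
    · obtain ⟨h1, h2⟩ := hw g' b (s ++ a :: r) (by simp)
      have hba := h.1 b (by simp)
      cases s with
      | nil =>
        refine ⟨fun hb => Or.inr ?_, fun hb c hc => hba.trans (h.2 c (by simpa using hc)).le⟩
        rcases h1 hb with ⟨c, hc, hcb⟩ | h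
        · simp only [List.nil_append, List.head?_cons, Option.mem_def, Option.some.injEq] at hc
          exact fun x hx => (h.1 x (by simp [hx])).trans (hc ▸ hcb)
        · exact h
      | cons d s => exact ⟨h1, h2⟩
  · intro hw g' b r' he
    rcases append_eq_append_cons he with ⟨s, rfl, hs⟩ | ⟨s, rfl, rfl⟩
    · cases s with
      | nil =>
        simp only [List.nil_append, List.cons.injEq] at hs
        obtain ⟨rfl, rfl⟩ := hs
        exact ⟨fun _ => Or.inr (by simpa using h.1), fun hb => by simp [ha] at hb⟩
      | cons c s =>
        simp only [List.cons_append, List.cons.injEq] at hs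
        obtain ⟨rfl, rfl⟩ := hs
        obtain ⟨h1, h2⟩ := hw (g ++ s) b r' (by simp)
        refine ⟨fun hb => (h1 hb).imp_right fun hh x hx => ?_, h2⟩
        have hab : a.abs ≤ b.abs := by
          cases s with
          | nil => exact (h.2 b (by simp)).le
          | cons d s => exact (h.2 d (by simp)).le.trans (hh d (by simp))
        simp only [List.mem_append, List.mem_cons] at hx
        rcases hx with hx | rfl | hx
        · exact hh x (by simp [hx])
        · exact hab
        · exact hh x (by simp [hx])
    · obtain ⟨h1, h2⟩ := hw g' b (s ++ r) (by simp)
      have hba := h.1 b (by simp)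
      cases s with
      | nil =>
        refine ⟨fun hb => Or.inr ?_, fun hb c hc => ?_⟩
        · rcases h1 hb with ⟨c, hc, hcb⟩ | hh
          · exact absurd (hcb.trans hba) (not_le.2 (h.2 c (by simpa using hc)))
          · exact hh
        · simp only [List.nil_append, List.head?_cons, Option.mem_def, Option.some.injEq] at hc
          exact hc ▸ hba
      | cons d s => exact ⟨h1, h2⟩

theorem isInsertion_isWeakBanner :
    IsInsertion {w : List (Letter N) | IsWeakBanner w} (RecordSplit Letter.abs)
      (barredLetters N) := by
  refine isInsertion_recordSplit _ ?_ fun a ha g r h => isWeakBanner_insert_iff ha h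
  rintro (⟨u, c⟩ | u) ha (⟨v, d⟩ | v) hb h
  · simp [mem_barredLetters, Letter.isBarred] at ha
  · simp [mem_barredLetters, Letter.isBarred] at ha
  · simp [mem_barredLetters, Letter.isBarred] at hb
  · simpa [Letter.abs] using h

/-- A barred letter of a weak banner violates the banner condition exactly when it is marked:
nothing earlier is larger, and a larger letter or the end follows. -/
theorem free_isWeakBanner :
    Free {w : List (Letter N) | IsWeakBanner w} (RecordSplit Letter.abs) (barredLetters N) =
      {w | IsBanner w} := by
  ext w
  simp only [Free, Set.mem_ofPred_eq, isBanner_iff]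
  constructor
  · rintro ⟨hw, hf⟩ g a r rfl
    obtain ⟨h1, h2⟩ := hw g a r rfl
    refine ⟨fun ha => ?_, h2⟩
    by_contra hcon
    refine hf a ha ⟨g, r, rfl, (h1 ha).resolve_left hcon, fun b hb => ?_⟩
    push Not at hcon
    exact hcon b hb
  · intro hw
    refine ⟨fun g a r h => ⟨fun ha => Or.inl ((hw g a r h).1 ha), (hw g a r h).2⟩, ?_⟩
    rintro a ha ⟨g, r, rfl, h1, h2⟩
    obtain ⟨b, hb, hba⟩ := (hw g a r rfl).1 ha
    exact absurd hba (not_le.2 (h2 b hb))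

/-- The letter `b` before the insertion place satisfies `b ≤ a`, and `a` is smaller than the next
letter. If `b` is barred, it has smaller absolute value than both, so neither word is a banner; if
it is unbarred of color `0`, its condition holds in both words. -/
theorem isBanner_insert_iff {a : Letter N} (ha : a.isBarred = false) {g r : List (Letter N)}
    (h : RecordSplit id a g r) : IsBanner (g ++ a :: r) ↔ IsBanner (g ++ r) := by
  rw [isBanner_iff, isBanner_iff]
  have hbar : ∀ b : Letter N, b.isBarred = true → b ≤ a → b.abs < a.abs := fun b hb hba =>
    Letter.abs_lt_of_isBarred hb (lt_of_le_of_ne hba (by rintro rfl; simp [ha] at hb))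
  constructor
  · intro hw g' b r' he
    rcases append_eq_append_cons he with ⟨s, rfl, rfl⟩ | ⟨s, rfl, rfl⟩
    · exact hw (g ++ a :: s) b r' (by simp)
    · have h12 := hw g' b (s ++ a :: r) (by simp)
      have hba : b ≤ a := h.1 b (by simp)
      cases s with
      | nil =>
        refine ⟨fun hb => ?_, fun hb c hc => ?_⟩
        · obtain ⟨c, hc, hcb⟩ := h12.1 hb
          simp only [List.nil_append, List.head?_cons, Option.mem_def, Option.some.injEq] at hc
          exact absurd (hc ▸ hcb) (not_le.2 (hbar b hb hba))
        · have hac : a < c := h.2 c (by simpa using hc)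
          exact (Letter.color_and_abs_of_le hb.1 (hba.trans hac.le)).2
      | cons d s => exact h12
  · intro hw g' b r' he
    rcases append_eq_append_cons he with ⟨s, rfl, hs⟩ | ⟨s, rfl, rfl⟩
    · cases s with
      | nil =>
        simp only [List.nil_append, List.cons.injEq] at hs
        obtain ⟨rfl, rfl⟩ := hs
        refine ⟨fun hb => by simp [ha] at hb, fun hb c hc => ?_⟩
        have hac : a < c := h.2 c hc
        exact (Letter.color_and_abs_of_le hb.1 hac.le).2
      | cons c s =>
        simp only [List.cons_append, List.cons.injEq] at hs
        obtain ⟨rfl, rfl⟩ := hs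
        exact hw (g ++ s) b r' (by simp)
    · have h12 := hw g' b (s ++ r) (by simp)
      have hba : b ≤ a := h.1 b (by simp)
      cases s with
      | nil =>
        refine ⟨fun hb => ?_, fun hb c hc => ?_⟩
        · obtain ⟨c, hc, hcb⟩ := h12.1 hb
          have hac : a < c := h.2 c (by simpa using hc)
          exact absurd hcb (not_le.2 (Letter.abs_lt_of_isBarred hb (hba.trans_lt hac)))
        · simp only [List.nil_append, List.head?_cons, Option.mem_def, Option.some.injEq] at hc
          exact hc ▸ (Letter.color_and_abs_of_le hb.1 hba).2
      | cons d s => exact h12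

theorem isInsertion_isBanner :
    IsInsertion {w : List (Letter N) | IsBanner w} (RecordSplit id) (plainLetters N) :=
  isInsertion_recordSplit _ Function.injective_id.injOn fun _ ha _ _ h => isBanner_insert_iff ha h

/-- In a banner a barred letter is followed by a letter of at most its absolute value, hence not by
a larger one for `<_B`. So only unbarred letters can form Lyndon factors of length one. -/
theorem mem_free_isBanner_iff {w : List (Letter N)} :
    w ∈ Free {w : List (Letter N) | IsBanner w} (RecordSplit id) (plainLetters N) ↔
      IsBanner w ∧ ∃ lam, HasLyndonType w lam ∧ 1 ∉ lam := by
  rw [exists_hasLyndonType_iff]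
  simp only [Free, Set.mem_ofPred_eq]
  refine and_congr_right fun hw => ⟨fun h a => ?_, fun h a _ => h a⟩
  cases ha : a.isBarred with
  | false => exact h a ha
  | true =>
    rintro ⟨g, r, rfl, h1, h2⟩
    obtain ⟨b, hb, hba⟩ := (isBanner_iff.1 hw g a r rfl).1 ha
    exact absurd hba (not_le.2 (Letter.abs_lt_of_isBarred ha (h2 b hb)))

end BannerInsertion

end ColoredBanner

namespace ColoredBanner

/-! ### Words below sequences of rows and weak banners -/

section Walk

theorem cnt_congr {L : Type*} {Ω Ω' : Set (List L)} {m : Multiset L}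
    (h : ∀ w : List L, (w : Multiset L) = m → (w ∈ Ω ↔ w ∈ Ω')) : cnt Ω m = cnt Ω' m :=
  Nat.card_congr (Equiv.subtypeEquivRight fun w => and_congr_left fun hw => h w hw)

theorem cnt_eq_sum {L : Type*} [DecidableEq L] (Ω : Set (List L)) {m : Multiset L} (hm : m ≠ 0) :
    cnt Ω m = ∑ a ∈ m.toFinset, cnt {w | a :: w ∈ Ω} (m.erase a) := by
  have h1 : ∀ a, Finite {w : List L // w ∈ {w | a :: w ∈ Ω} ∧ (w : Multiset L) = m.erase a} :=
    fun a => finite_content _ _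
  unfold cnt
  rw [← Finset.sum_coe_sort, ← Nat.card_sigma]
  refine Nat.card_congr (Equiv.ofBijective
    (β := Σ a : m.toFinset, {w // w ∈ {w | a.1 :: w ∈ Ω} ∧ (w : Multiset L) = m.erase a.1})
    (fun w => match w with
    | ⟨[], hw⟩ => absurd hw.2.symm hm
    | ⟨a :: w, hw⟩ => ⟨⟨a, by simp [← hw.2]⟩, w, hw.1, by simp [← hw.2]⟩) ⟨?_, ?_⟩)
  · rintro ⟨_ | ⟨a, v⟩, hv⟩ ⟨_ | ⟨b, w⟩, hw⟩ h
    · exact absurd hv.2.symm hm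
    · exact absurd hv.2.symm hm
    · exact absurd hw.2.symm hm
    · simp only [Sigma.mk.injEq, Subtype.mk.injEq] at h
      obtain ⟨rfl, h⟩ := h
      simpa using h
  · rintro ⟨⟨a, ha⟩, w, hw, hwm⟩
    refine ⟨⟨a :: w, hw, ?_⟩, rfl⟩
    rw [← Multiset.cons_coe, hwm]
    exact Multiset.cons_erase (Multiset.mem_toFinset.1 ha)

variable {N : ℕ} [NeZero N]

/-- The letter `a` may be placed below the row `v`. -/
def Compat (v : ℕ+) (a : Letter N) : Prop :=
  (a.isBarred = true → v ≤ a.abs) ∧ (a.color = 0 ∧ a.isBarred = false → a.abs ≤ v)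

/-- The words that may be placed below the sequence `s` of rows. -/
def Below (s : List ℕ+) : Set (List (Letter N)) := {y | List.Forall₂ Compat s y}

theorem cons_mem_below {v : ℕ+} {s : List ℕ+} {a : Letter N} {y : List (Letter N)} :
    a :: y ∈ Below (v :: s) ↔ Compat v a ∧ y ∈ Below s := List.forall₂_cons

open Classical in
theorem cnt_below_cons (v : ℕ+) (s : List ℕ+) {m : Multiset (Letter N)} (hm : m ≠ 0) :
    cnt (Below (v :: s)) m =
      ∑ a ∈ m.toFinset, if Compat v a then cnt (Below s) (m.erase a) else 0 := by
  rw [cnt_eq_sum _ hm]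
  refine Finset.sum_congr rfl fun a _ => ?_
  split_ifs with h
  · exact cnt_congr fun w _ => by simp [cons_mem_below, h]
  · simp [cnt, cons_mem_below, h]

theorem cnt_below_zero (v : ℕ+) (s : List ℕ+) : cnt (Below (N := N) (v :: s)) 0 = 0 := by
  refine Nat.card_eq_zero.2 (Or.inl ⟨?_⟩)
  rintro ⟨w, hw, hw'⟩
  rw [Multiset.coe_eq_zero] at hw'
  subst hw'
  cases hw

/-- Exchanging the first two rows is matched by exchanging the first two letters. This freedom to
reorder rows drives the comparison with walks. -/
theorem cnt_below_perm {s s' : List ℕ+} (h : s.Perm s') :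
    ∀ m : Multiset (Letter N), cnt (Below s) m = cnt (Below s') m := by
  induction h with
  | nil => intro m; rfl
  | cons v _ ih =>
    intro m
    by_cases hm : m = 0
    · rw [hm, cnt_below_zero, cnt_below_zero]
    · rw [cnt_below_cons _ _ hm, cnt_below_cons _ _ hm]
      simp only [ih]
  | swap u v s =>
    intro m
    let f : List (Letter N) → List (Letter N) := fun y => match y with
      | a :: b :: y => b :: a :: y
      | y => y
    have hf : Function.Involutive f := by
      rintro (_ | ⟨a, _ | ⟨b, y⟩⟩) <;> rfl
    unfold cnt
    refine Nat.card_congr (hf.toPerm.subtypeEquiv ?_)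
    rintro (_ | ⟨a, _ | ⟨b, y⟩⟩)
    · simp [Below, f]
    · simp [Below, f]
    · simp only [Function.Involutive.coe_toPerm, f, Below, Set.mem_ofPred_eq, List.forall₂_cons]
      rw [Multiset.coe_eq_coe.2 (List.Perm.swap a b y)]
      tauto
  | trans _ _ ih1 ih2 => intro m; rw [ih1, ih2]

/-- The largest absolute value of a letter. -/
def top (m : Multiset (Letter N)) : ℕ+ := (m.map Letter.abs).sup

omit [NeZero N] in
theorem top_cons (a : Letter N) (m : Multiset (Letter N)) : top (a ::ₘ m) = a.abs ⊔ top m := by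
  simp [top]

omit [NeZero N] in
theorem abs_le_top {a : Letter N} {m : Multiset (Letter N)} (h : a ∈ m) : a.abs ≤ top m :=
  Multiset.le_sup (Multiset.mem_map_of_mem _ h)

omit [NeZero N] in
theorem top_le_iff {m : Multiset (Letter N)} {v : ℕ+} : top m ≤ v ↔ ∀ a ∈ m, a.abs ≤ v := by
  simp [top, Multiset.sup_le]

omit [NeZero N] in
theorem top_mem {m : Multiset (Letter N)} (hm : m ≠ 0) : top m ∈ m.map Letter.abs := by
  induction m using Multiset.induction_on with
  | empty => exact absurd rfl hm
  | cons a m ih =>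
    rw [top_cons, Multiset.map_cons]
    by_cases h : m = 0
    · subst h
      simp [top]
    · rcases le_total a.abs (top m) with h' | h'
      · rw [sup_eq_right.2 h']
        exact Multiset.mem_cons_of_mem (ih h)
      · rw [sup_eq_left.2 h']
        exact Multiset.mem_cons_self _ _

/-- Reading a weak banner backwards as a walk on the rows, from the row `v`. -/
def IsWalk : ℕ+ → List (Letter N) → Prop
  | _, [] => True
  | v, a :: w => Compat (v ⊓ top ((a :: w : List (Letter N)) : Multiset (Letter N))) a ∧ IsWalk a.abs w

open Classical in
theorem cnt_isWalk_eq_sum (v : ℕ+) {m : Multiset (Letter N)} (hm : m ≠ 0) :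
    cnt {w | IsWalk v w} m = ∑ a ∈ m.toFinset,
      if Compat (v ⊓ top m) a then cnt {w | IsWalk a.abs w} (m.erase a) else 0 := by
  rw [cnt_eq_sum _ hm]
  refine Finset.sum_congr rfl fun a ha => ?_
  have key : ∀ w : List (Letter N), (w : Multiset (Letter N)) = m.erase a →
      (w ∈ {w | a :: w ∈ {w | IsWalk v w}} ↔ Compat (v ⊓ top m) a ∧ IsWalk a.abs w) := by
    intro w hw
    have : ((a :: w : List (Letter N)) : Multiset (Letter N)) = m := by
      rw [← Multiset.cons_coe, hw, Multiset.cons_erase (Multiset.mem_toFinset.1 ha)]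
    simp only [Set.mem_ofPred_eq, IsWalk, this]
  split_ifs with h
  · exact cnt_congr fun w hw => by rw [key w hw]; simp [h]
  · rw [cnt_congr (Ω' := ∅) fun w hw => by rw [key w hw]; simp [h]]
    simp [cnt]

/-- The rows on which a walk with given content and given start is based. -/
noncomputable def walkRows (v : ℕ+) (m : Multiset (Letter N)) : Multiset ℕ+ :=
  open Classical in if m = 0 then 0 else (v ⊓ top m) ::ₘ (m.map Letter.abs).erase (top m)

/-- The rows left after the first step do not depend on which letter is used; for each choice of `a`
they are the rows of a walk that starts at `a.abs` with the remaining letters. -/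
theorem walkRows_cons (a : Letter N) (m : Multiset (Letter N)) :
    ((a ::ₘ m).map Letter.abs).erase (top (a ::ₘ m)) = walkRows a.abs m := by
  by_cases hm : m = 0
  · subst hm
    simp [walkRows, top]
  · obtain ⟨X, hX⟩ := Multiset.exists_cons_of_mem (top_mem hm)
    rw [walkRows, if_neg hm, top_cons, Multiset.map_cons, hX, Multiset.erase_cons_head]
    rcases le_total a.abs (top m) with h | h
    · rw [sup_eq_right.2 h, inf_eq_left.2 h, Multiset.cons_swap, Multiset.erase_cons_head]
    · rw [sup_eq_left.2 h, inf_eq_right.2 h, Multiset.erase_cons_head]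

/-- Both counts satisfy the same recursion on the first letter. The rows may be permuted so that `v
⊓ top m` comes first, and `walkRows_cons` identifies the remaining rows. -/
theorem cnt_below_eq_cnt_isWalk (m : Multiset (Letter N)) : ∀ (v : ℕ+) (s : List ℕ+),
    (s : Multiset ℕ+) = walkRows v m → cnt (Below s) m = cnt {w | IsWalk v w} m := by
  classical
  induction h : m.card using Nat.strong_induction_on generalizing m with
  | _ n ih =>
    subst h
    intro v s hs
    by_cases hm : m = 0
    · subst hm
      rw [walkRows, if_pos rfl, Multiset.coe_eq_zero] at hs
      subst hs
      exact cnt_congr fun w hw => by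
        rw [Multiset.coe_eq_zero] at hw
        subst hw
        simp [Below, IsWalk]
    · rw [walkRows, if_neg hm] at hs
      obtain ⟨s', hs'⟩ : ∃ s' : List ℕ+, (s' : Multiset ℕ+) = (m.map Letter.abs).erase (top m) :=
        Quotient.exists_rep _
      rw [← hs', Multiset.cons_coe, Multiset.coe_eq_coe] at hs
      rw [cnt_below_perm hs, cnt_below_cons _ _ hm, cnt_isWalk_eq_sum _ hm]
      refine Finset.sum_congr rfl fun a ha => ?_
      have ha := Multiset.mem_toFinset.1 ha
      split_ifs with hc
      · refine ih _ (Multiset.card_erase_lt_of_mem ha) _ rfl _ _ ?_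
        rw [hs', ← walkRows_cons, Multiset.cons_erase ha]
      · rfl

theorem isWalk_reverse_iff (w : List (Letter N)) : ∀ v : ℕ+, IsWalk v w.reverse ↔
    ∀ g a r, w = g ++ a :: r →
      Compat (((r.head?.map Letter.abs).getD v) ⊓ top ((g ++ [a] : List (Letter N)) : Multiset (Letter N))) a := by
  induction w using List.reverseRecOn with
  | nil => simp [IsWalk]
  | append_singleton w b ih =>
    intro v
    rw [List.reverse_append, List.reverse_singleton, List.singleton_append, IsWalk, ih]
    have h1 : ((b :: w.reverse : List (Letter N)) : Multiset (Letter N)) =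
        (w ++ [b] : List (Letter N)) := by
      rw [Multiset.coe_eq_coe]
      exact ((List.reverse_perm w).cons b).trans (List.perm_append_singleton b w).symm
    rw [h1]
    constructor
    · rintro ⟨h2, h3⟩ g a r hw
      rcases List.eq_nil_or_concat r with rfl | ⟨r, c, rfl⟩
      · obtain ⟨rfl, h⟩ := List.append_inj' hw rfl
        simp only [List.cons.injEq, and_true] at h
        subst h
        simpa using h2
      · rw [List.concat_eq_append, ← List.cons_append, ← List.append_assoc] at hw
        obtain ⟨rfl, h⟩ := List.append_inj' hw rfl
        simp only [List.cons.injEq, and_true] at h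
        subst h
        have := h3 g a r rfl
        cases r <;> simpa using this
    · intro h
      refine ⟨by simpa using h w b [] rfl, fun g a r hw => ?_⟩
      have := h g a (r ++ [b]) (by simp [hw])
      cases r <;> simpa using this

/-- The row at a letter `a` is the minimum of the absolute value of the next letter and the maximum
up to `a`. It is at most `a.abs` iff the next letter is not larger or no earlier letter is larger,
which is the weak condition. Starting at the overall maximum makes the condition at the last letter
come out right. -/
theorem isWalk_reverse_iff_isWeakBanner (w : List (Letter N)) :
    IsWalk (top (w : Multiset (Letter N))) w.reverse ↔ IsWeakBanner w := by
  rw [isWalk_reverse_iff]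
  unfold IsWeakBanner
  refine forall₂_congr fun g a => forall₂_congr fun r hw => ?_
  have hga : a.abs ≤ top ((g ++ [a] : List (Letter N)) : Multiset (Letter N)) := abs_le_top (by simp)
  have hgle : top ((g ++ [a] : List (Letter N)) : Multiset (Letter N)) ≤ a.abs ↔ ∀ x ∈ g, x.abs ≤ a.abs := by
    rw [top_le_iff]
    simp [or_imp, forall_and]
  have htop : top ((g ++ [a] : List (Letter N)) : Multiset (Letter N)) ≤ top (w : Multiset (Letter N)) := by
    rw [top_le_iff]
    intro b hb
    refine abs_le_top ?_
    simp only [Multiset.mem_coe, List.mem_append, List.mem_singleton] at hb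
    simp only [hw, Multiset.mem_coe, List.mem_append, List.mem_cons]
    tauto
  unfold Compat
  cases r with
  | nil =>
    simp only [List.head?_nil, Option.map_none, Option.getD_none, inf_eq_right.2 htop, hgle, hga]
    simp
  | cons b r =>
    simp only [List.head?_cons, Option.map_some, Option.getD_some, inf_le_iff, hgle, le_inf_iff, hga,
      and_true]
    simp

/-- Words below the sorted sequence of their absolute values are equinumerous with weak banners. -/
theorem cnt_below_eq_cnt_isWeakBanner (m : Multiset (Letter N)) (s : List ℕ+)
    (hs : (s : Multiset ℕ+) = m.map Letter.abs) :
    cnt (Below s) m = cnt {w | IsWeakBanner w} m := by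
  classical
  rw [cnt_below_eq_cnt_isWalk m (top m) s]
  · unfold cnt
    refine Nat.card_congr ((Function.Involutive.toPerm _ List.reverse_involutive).subtypeEquiv
      fun w => ?_)
    simp only [Function.Involutive.coe_toPerm, Set.mem_ofPred_eq, Multiset.coe_reverse]
    refine and_congr_left fun hw => ?_
    rw [← isWalk_reverse_iff_isWeakBanner, List.reverse_reverse, Multiset.coe_reverse, hw]
  · by_cases hm : m = 0
    · subst hm
      simpa [walkRows] using hs
    · rw [walkRows, if_neg hm, inf_idem, Multiset.cons_erase (top_mem hm), hs]

end Walk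

end ColoredBanner

namespace ColoredBanner

/-! ### Insertion of fixed letters of sorting permutations -/

section SortInsertion

variable {A K : Type*} [DecidableEq A] [LinearOrder K]

/-- The letter `a`, inserted between `g` and `r`, is not moved when the word is sorted with
respect to `κ`, and it is the last such letter. -/
def SortSplit (κ : A → K) (a : A) (g r : List A) : Prop :=
  g.countP (fun x => decide (x ≠ a)) = (g ++ r).countP (fun x => decide (κ x < κ a)) ∧
    r.head? ≠ some a

variable {κ : A → K}

omit [DecidableEq A] in
theorem countP_lt_add_count_le [DecidableEq A] {a b : A} (h : κ a < κ b) (w : List A) :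
    w.countP (fun x => decide (κ x < κ a)) + w.count a ≤
      w.countP (fun x => decide (κ x < κ b)) := by
  induction w with
  | nil => simp
  | cons c w ih =>
    simp only [List.countP_cons, List.count_cons, decide_eq_true_eq, beq_iff_eq]
    by_cases hc : c = a
    · subst hc
      simp [h]
      omega
    · by_cases h' : κ c < κ a
      · simp [hc, h', h'.trans h]
        omega
      · simp only [hc, h', if_false]
        omega

theorem countP_ne_add_count (a : A) (w : List A) :
    w.countP (fun x => decide (x ≠ a)) + w.count a = w.length := by
  induction w with
  | nil => simp
  | cons c w ih =>
    by_cases hc : c = a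
    · subst hc
      simp at ih ⊢
      omega
    · simp [hc] at ih ⊢
      omega

/-- If one copy of `a` is fixed by the sorting, so are the copies adjacent to it on the right. The
requirement that `a` not follow only chooses the last copy of such a run, so it can be dropped in
the existence statement. -/
theorem has_sortSplit_iff {a : A} {w : List A} : Has (SortSplit κ) a w ↔
    ∃ g r, w = g ++ a :: r ∧
      g.countP (fun x => decide (x ≠ a)) = w.countP (fun x => decide (κ x < κ a)) := by
  constructor
  · rintro ⟨g, r, rfl, h, -⟩
    exact ⟨g, r, rfl, by simpa using h⟩
  · rintro ⟨g, r, rfl, h⟩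
    induction r generalizing g with
    | nil => exact ⟨g, [], rfl, by simpa using h, by simp⟩
    | cons c r ih =>
      by_cases hc : c = a
      · subst hc
        have := ih (g ++ [c])
        simp only [List.append_assoc, List.singleton_append] at this
        refine this ?_
        rw [← h]
        simp
      · exact ⟨g, c :: r, rfl, by simpa using h, by simpa using hc⟩

theorem exists_countP_ne_split (a : A) (w : List A) :
    ∀ c ≤ w.countP (fun x => decide (x ≠ a)),
      ∃ g r, w = g ++ r ∧ g.countP (fun x => decide (x ≠ a)) = c ∧ r.head? ≠ some a := by
  induction w with
  | nil => intro c hc; exact ⟨[], [], rfl, by simpa [eq_comm] using hc, by simp⟩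
  | cons x w ih =>
    intro c hc
    by_cases hx : x = a
    · subst hx
      obtain ⟨g, r, rfl, h1, h2⟩ := ih c (by simpa using hc)
      exact ⟨x :: g, r, rfl, by simpa using h1, h2⟩
    · cases c with
      | zero => exact ⟨[], x :: w, rfl, rfl, by simpa using hx⟩
      | succ c =>
        obtain ⟨g, r, rfl, h1, h2⟩ := ih c (by simpa [hx] using hc)
        exact ⟨x :: g, r, rfl, by simpa [hx] using h1, h2⟩

theorem countP_ne_split_unique {a : A} {g r g' r' : List A} (h : g ++ r = g' ++ r')
    (hc : g.countP (fun x => decide (x ≠ a)) = g'.countP (fun x => decide (x ≠ a)))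
    (hr : r.head? ≠ some a) (hr' : r'.head? ≠ some a) : g = g' := by
  rcases List.append_eq_append_iff.1 h with ⟨s, rfl, rfl⟩ | ⟨s, rfl, rfl⟩
  all_goals
    cases s with
    | nil => simp
    | cons b s =>
      simp only [List.cons_append, List.head?_cons, ne_eq, Option.some.injEq] at hr hr'
      simp [hr, hr'] at hc

/-- Fixed letters of a stable sorting occur in the order of their keys. If `κ b < κ a`, all copies
of `b` would be counted among the letters below `a`, more than the prefix before `a` can
accommodate. -/
theorem SortSplit.lt_of_before {a b : A} (hne : κ a ≠ κ b) {g s r : List A}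
    (ha : g.countP (fun x => decide (x ≠ a)) ≤
      (g ++ s ++ b :: r).countP (fun x => decide (κ x < κ a)))
    (ha' : (g ++ s ++ b :: r).countP (fun x => decide (κ x < κ a)) ≤
      g.countP (fun x => decide (x ≠ a)))
    (hb : (g ++ s).countP (fun x => decide (x ≠ b)) ≤
      (g ++ s ++ b :: r).countP (fun x => decide (κ x < κ b))) : κ a < κ b := by
  by_contra hcon
  have hba := lt_of_le_of_ne (not_lt.1 hcon) hne.symm
  have h1 := countP_lt_add_count_le hba (g ++ s ++ b :: r)
  have h2 := countP_ne_add_count b (g ++ s)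
  have h3 := countP_ne_add_count a g
  have h4 : (g ++ s ++ b :: r).count b = (g ++ s).count b + (r.count b + 1) := by simp [add_assoc]
  have h5 : (g ++ s).length = g.length + s.length := by simp
  omega

/-- The place of `a` is reached when the number of other letters in the prefix equals the number of
letters with smaller key; inserting `a` changes neither count. For another letter `b`, the order of
places agrees with the order of keys, so the two counts that define a mark of `b` change by the same
amount. -/
theorem isInsertion_sortSplit (hκ : Function.Injective κ) {Ω : Set (List A)} {F : Set A}
    (hΩ : ∀ a ∈ F, ∀ g r, SortSplit κ a g r → (g ++ a :: r ∈ Ω ↔ g ++ r ∈ Ω)) :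
    IsInsertion Ω (SortSplit κ) F where
  exists_split a _ w := by
    obtain ⟨g, r, rfl, h1, h2⟩ := exists_countP_ne_split a w
      (w.countP (fun x => decide (κ x < κ a))) (List.countP_mono_left fun x _ hx => by
        simp only [decide_eq_true_eq] at hx ⊢
        rintro rfl
        exact lt_irrefl _ hx)
    exact ⟨g, r, rfl, h1, h2⟩
  split_unique a _ g r g' r' he h h' :=
    countP_ne_split_unique he (by rw [h.1, h'.1, he]) h.2 h'.2
  insert_unique a _ g r g' r' he h h' := by
    have key : ∀ g r : List A, (g ++ a :: r).countP (fun x => decide (κ x < κ a)) =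
        (g ++ r).countP (fun x => decide (κ x < κ a)) := by simp
    have := countP_ne_split_unique (a := a) (g := g ++ [a]) (r := r) (g' := g' ++ [a]) (r' := r')
      (by simpa using he)
      (by
        have h1 := h.1
        rw [← key, he, key, ← h'.1] at h1
        simpa using h1) h.2 h'.2
    simpa using this
  mem_iff := hΩ
  has_iff a _ b _ hab g r h := by
    have hne : κ a ≠ κ b := fun h => hab (hκ h).symm
    have h1 : g.countP (fun x => decide (x ≠ a)) =
        (g ++ a :: r).countP (fun x => decide (κ x < κ a)) := by simpa using h.1
    have h2 := h.1
    rw [has_sortSplit_iff, has_sortSplit_iff]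
    constructor
    · rintro ⟨g', r', he, hb⟩
      have hb' := hb
      rw [he] at h1
      rcases append_cons_eq_append_cons hab he with ⟨s, rfl, rfl⟩ | ⟨s, rfl, rfl⟩
      · have hlt : κ a < κ b := SortSplit.lt_of_before (g := g) (s := a :: s) (r := r') hne h1.le
          h1.ge (by rw [hb, he])
        refine ⟨g ++ s, r', by simp, ?_⟩
        simp [hlt, hab.symm] at hb ⊢
        omega
      · have hlt : κ b < κ a := SortSplit.lt_of_before (g := g') (s := b :: s) (r := r) hne.symm
          hb.le hb.ge (by rw [← he] at h1; simpa using h1.le)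
        refine ⟨g', s ++ r, by simp, ?_⟩
        simp [not_lt.2 hlt.le] at hb ⊢
        omega
    · rintro ⟨g', r', he, hb⟩
      rcases append_eq_append_cons he with ⟨s, rfl, rfl⟩ | ⟨s, rfl, rfl⟩
      · have hlt : κ a < κ b := SortSplit.lt_of_before (g := g) (s := s) (r := r') hne
          (by simpa using h2.le) (by simpa using h2.ge) (by rw [hb, he])
        refine ⟨g ++ a :: s, r', by simp, ?_⟩
        simp [hlt, hab.symm] at hb ⊢
        omega
      · have hlt : κ b < κ a := by
          by_contra hcon
          have hlt := lt_of_le_of_ne (not_lt.1 hcon) hne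
          have h3 := countP_lt_add_count_le hlt (g' ++ b :: s ++ r)
          have h4 := countP_ne_add_count b g'
          have h5 := countP_ne_add_count a (g' ++ b :: s)
          have h6 : (g' ++ b :: s ++ r).count a = (g' ++ b :: s).count a + r.count a :=
            List.count_append
          have h7 : (g' ++ b :: s).length = g'.length + (s.length + 1) := by simp
          omega
        refine ⟨g', s ++ a :: r, by simp, ?_⟩
        simp [not_lt.2 hlt.le] at hb ⊢
        omega

end SortInsertion

/-! ### Words below their own sorted rows -/

section BelowInsertion

variable {N : ℕ} [NeZero N]

/-- The order in which the letters of a colored permutation appear: larger rows first, and in each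
row the excedances first, followed by the letters with decreasing colors. -/
def Letter.block : Letter N → ℕ+ᵒᵈ ×ₗ WithBot (Fin N)ᵒᵈ
  | plain u c => toLex (OrderDual.toDual u, ((OrderDual.toDual c : (Fin N)ᵒᵈ) : WithBot (Fin N)ᵒᵈ))
  | bar u => toLex (OrderDual.toDual u, ⊥)

omit [NeZero N] in
theorem Letter.block_injective : Function.Injective (Letter.block (N := N)) := by
  rintro (⟨u, c⟩ | u) (⟨v, d⟩ | v) h <;> simp_all [Letter.block]

omit [NeZero N] in
theorem Letter.abs_le_of_block_le {a b : Letter N} (h : a.block ≤ b.block) : b.abs ≤ a.abs := by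
  have h' : OrderDual.toDual a.abs ≤ OrderDual.toDual b.abs := by
    have := Prod.Lex.monotone_fst _ _ h
    cases a <;> cases b <;> exact this
  exact h'

omit [NeZero N] in
theorem Letter.block_lt_of_abs_lt {a b : Letter N} (h : b.abs < a.abs) : a.block < b.block := by
  by_contra hcon
  exact absurd (Letter.abs_le_of_block_le (not_lt.1 hcon)) (not_le.2 h)

/-- The absolute values of a word in decreasing order. -/
def rows (y : List (Letter N)) : List ℕ+ := ((y : Multiset (Letter N)).map Letter.abs).sort (· ≥ ·)

/-- The words below the decreasing sequence of their absolute values. -/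
def BelowRows (N : ℕ) [NeZero N] : Set (List (Letter N)) := {y | y ∈ Below (rows y)}

theorem forall₂_append_iff {α β : Type*} {R : α → β → Prop} {l₁ l₂ : List α} {m₁ m₂ : List β}
    (h : l₁.length = m₁.length) :
    List.Forall₂ R (l₁ ++ l₂) (m₁ ++ m₂) ↔ List.Forall₂ R l₁ m₁ ∧ List.Forall₂ R l₂ m₂ := by
  induction l₁ generalizing m₁ with
  | nil =>
    cases m₁ with
    | nil => simp
    | cons => simp at h
  | cons a l ih =>
    cases m₁ with
    | nil => simp at h
    | cons b m => simp [ih (m₁ := m) (by simpa using h), and_assoc]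

theorem compat_abs_self (a : Letter N) : Compat a.abs a := ⟨fun _ => le_rfl, fun _ => le_rfl⟩

omit [NeZero N] in
theorem countP_rows (p : ℕ+ → Bool) (y : List (Letter N)) :
    (rows y).countP p = y.countP (fun a => p a.abs) := by
  have : (rows y).Perm (y.map Letter.abs) := by
    rw [← Multiset.coe_eq_coe, rows, Multiset.sort_eq, Multiset.map_coe]
  rw [this.countP_eq, List.countP_map]
  rfl

omit [NeZero N] in
theorem length_rows (y : List (Letter N)) : (rows y).length = y.length := by
  simp [rows]

omit [NeZero N] in
theorem pairwise_rows (y : List (Letter N)) : (rows y).Pairwise (· ≥ ·) :=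
  Multiset.pairwise_sort _ _

omit [NeZero N] in
-- A letter fixed by sorting stands below its own row: counting letters shows that the first
-- `g.length` rows are at least `a.abs` and the others at most.
theorem rows_insert {a : Letter N} {g r : List (Letter N)} [DecidableEq (Letter N)]
    (h : SortSplit Letter.block a g r) :
    rows (g ++ a :: r) =
      (rows (g ++ r)).take g.length ++ a.abs :: (rows (g ++ r)).drop g.length := by
  have hlen : ((rows (g ++ r)).take g.length).length = g.length := by
    simp [length_rows]
  have hsort := pairwise_rows (g ++ r)
  have hcount := countP_rows (N := N) (y := g ++ r)
  rw [← List.take_append_drop g.length (rows (g ++ r))] at hsort hcount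
  set S₁ := (rows (g ++ r)).take g.length with hS₁
  set S₂ := (rows (g ++ r)).drop g.length with hS₂
  obtain ⟨hs1, hs2, hs12⟩ := List.pairwise_append.1 hsort
  have hle : ∀ x ∈ S₁, a.abs ≤ x := by
    intro x hx
    by_contra hcon
    have h1 := hcount (fun v => decide (a.abs ≤ v))
    rw [List.countP_append] at h1
    have h2 : S₂.countP (fun v => decide (a.abs ≤ v)) = 0 := by
      rw [List.countP_eq_zero]
      intro v hv
      simpa using (hs12 x hx v hv).trans_lt (not_le.1 hcon)
    have h3 : S₁.countP (fun v => decide (a.abs ≤ v)) < S₁.length := by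
      refine lt_of_le_of_ne List.countP_le_length fun he => ?_
      exact hcon (by simpa using List.countP_eq_length.1 he x hx)
    have h4 : (g ++ r).countP (fun x => decide (x.block < a.block)) + (g ++ r).count a ≤
        (g ++ r).countP (fun x => decide (a.abs ≤ x.abs)) := by
      generalize g ++ r = w
      induction w with
      | nil => simp
      | cons c w ih =>
        simp only [List.countP_cons, List.count_cons, decide_eq_true_eq, beq_iff_eq]
        by_cases hc : c = a
        · subst hc
          simp
          omega
        · by_cases h' : c.block < a.block
          · simp [hc, h', Letter.abs_le_of_block_le h'.le]
            omega
          · simp only [hc, h', if_false]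
            omega
    have h5 := countP_ne_add_count a g
    have h6 : g.count a ≤ (g ++ r).count a := by simp
    have h7 := h.1
    omega
  have hge : ∀ x ∈ S₂, x ≤ a.abs := by
    intro x hx
    by_contra hcon
    have h1 := hcount (fun v => decide (a.abs < v))
    rw [List.countP_append] at h1
    have h2 : S₁.countP (fun v => decide (a.abs < v)) = S₁.length := by
      rw [List.countP_eq_length]
      intro v hv
      simpa using (not_le.1 hcon).trans_le (hs12 v hv x hx)
    have h3 : 0 < S₂.countP (fun v => decide (a.abs < v)) :=
      List.countP_pos_iff.2 ⟨x, hx, by simpa using hcon⟩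
    have h4 : (g ++ r).countP (fun x => decide (a.abs < x.abs)) ≤
        (g ++ r).countP (fun x => decide (x.block < a.block)) :=
      List.countP_mono_left fun x _ hx => by
        simp only [decide_eq_true_eq] at hx ⊢
        exact Letter.block_lt_of_abs_lt hx
    have h5 := countP_ne_add_count a g
    have h7 := h.1
    omega
  refine List.Perm.eq_of_pairwise' (r := (· ≥ ·)) (pairwise_rows _) ?_ ?_
  · rw [List.pairwise_append, List.pairwise_cons]
    refine ⟨hs1, ⟨hge, hs2⟩, fun x hx y hy => ?_⟩
    rcases List.mem_cons.1 hy with rfl | hy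
    · exact hle x hx
    · exact hs12 x hx y hy
  · refine List.Perm.trans ?_ List.perm_middle.symm
    rw [hS₁, hS₂, List.take_append_drop, ← Multiset.coe_eq_coe, ← Multiset.cons_coe, rows, rows,
      Multiset.sort_eq, Multiset.sort_eq, Multiset.coe_eq_coe.2 List.perm_middle,
      ← Multiset.cons_coe, Multiset.map_cons]

/-- The inserted letter is placed below a row equal to its absolute value, where it is always
allowed, and every other letter keeps its row. -/
theorem isInsertion_belowRows :
    IsInsertion (BelowRows N) (SortSplit Letter.block) Set.univ := by
  refine isInsertion_sortSplit Letter.block_injective fun a _ g r h => ?_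
  have hlen : ((rows (g ++ r)).take g.length).length = g.length := by
    simp [length_rows]
  unfold BelowRows Below
  simp only [Set.mem_ofPred_eq]
  rw [rows_insert h, forall₂_append_iff hlen, List.forall₂_cons]
  conv_rhs => rw [← List.take_append_drop g.length (rows (g ++ r)), forall₂_append_iff hlen]
  simp [compat_abs_self]

theorem cnt_belowRows (m : Multiset (Letter N)) :
    cnt (BelowRows N) m = cnt {w | IsWeakBanner w} m := by
  rw [← cnt_below_eq_cnt_isWeakBanner m ((m.map Letter.abs).sort (· ≥ ·)) (Multiset.sort_eq _ _)]
  exact cnt_congr fun w hw => by rw [BelowRows, Set.mem_ofPred_eq, rows, hw]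

/-- The words below their rows, none of whose letters is fixed by the sorting permutation, are
equinumerous with the banners without Lyndon factors of length one. -/
theorem cnt_free_belowRows (m : Multiset (Letter N)) :
    cnt (Free (BelowRows N) (SortSplit Letter.block) Set.univ) m =
      cnt (Free {w : List (Letter N) | IsBanner w} (RecordSplit id) (plainLetters N)) m := by
  have hun : barredLetters N ∪ plainLetters N = Set.univ := by
    ext a
    simp [mem_barredLetters, mem_plainLetters]
  have hdis : Disjoint (barredLetters N) (plainLetters N) := by
    rw [Set.disjoint_left]
    intro a ha hb
    simp [mem_barredLetters, mem_plainLetters] at ha hb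
    simp [ha] at hb
  -- Marks of barred letters are removed first, which turns weak banners into banners on the other
  -- side; then the marks of unbarred letters are removed, the mark on the banner side now being
  -- defined by `<_B` instead of the absolute value.
  rw [← hun, ← free_free]
  refine (isInsertion_belowRows.free (Set.subset_univ _) (Set.subset_univ _) hdis).cnt_free_eq
    isInsertion_isBanner (fun m => ?_) m
  rw [← free_isWeakBanner]
  exact (isInsertion_belowRows.mono (Set.subset_univ _)).cnt_free_eq isInsertion_isWeakBanner
    cnt_belowRows m

end BelowInsertion

end ColoredBanner

namespace ColoredBanner

/-! ### Words sorted without fixed points -/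

section SortedWords

variable {N n : ℕ} [NeZero N]

theorem countP_ofFn {A : Type*} (y : Fin n → A) (p : A → Prop) [DecidablePred p] :
    (List.ofFn y).countP (fun a => decide (p a)) = (Finset.univ.filter fun i => p (y i)).card := by
  rw [← Multiset.coe_countP, ← Fin.univ_val_map, Multiset.countP_map]
  rfl

theorem countP_take_ofFn {A : Type*} (y : Fin n → A) (p : A → Prop) [DecidablePred p] (v : Fin n) :
    ((List.ofFn y).take v).countP (fun a => decide (p a)) =
      (Finset.univ.filter fun i => i < v ∧ p (y i)).card := by
  rw [← Fin.ofFn_take_eq_take_ofFn v.2.le, countP_ofFn,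
    ← Finset.card_map (Fin.castLEEmb v.2.le)]
  congr 1
  ext i
  simp only [Finset.mem_map, Finset.mem_filter, Finset.mem_univ, true_and, Fin.castLEEmb_apply]
  constructor
  · rintro ⟨k, hk, rfl⟩
    exact ⟨by simp [Fin.lt_def], hk⟩
  · rintro ⟨h1, h2⟩
    exact ⟨⟨i, h1⟩, h2, rfl⟩

theorem Tuple.eq_sort_iff_strictMono {K : Type*} [LinearOrder K] {f : Fin n → K}
    {σ : Equiv.Perm (Fin n)} :
    σ = Tuple.sort f ↔ StrictMono fun i => toLex (f (σ i), σ i) := by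
  rw [Tuple.eq_sort_iff']
  rfl

theorem Tuple.sort_lt_sort_iff {K : Type*} [LinearOrder K] (f : Fin n → K) (i k : Fin n) :
    i < k ↔ f (Tuple.sort f i) < f (Tuple.sort f k) ∨
      f (Tuple.sort f i) = f (Tuple.sort f k) ∧ Tuple.sort f i < Tuple.sort f k := by
  have h : StrictMono fun i => toLex (f (Tuple.sort f i), Tuple.sort f i) :=
    Tuple.eq_sort_iff_strictMono.1 rfl
  rw [← h.lt_iff_lt, Prod.Lex.toLex_lt_toLex]

/-- Stable sorting moves the letter at `v` to the position given by the number of smaller keys plus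
the number of equal letters before `v`, while `v` itself is the number of all letters before it. The
equal letters cancel. -/
theorem sort_fixed_iff {A K : Type*} [DecidableEq A] [LinearOrder K] {κ : A → K} (hκ : Function.Injective κ)
    (y : Fin n → A) (v : Fin n) :
    Tuple.sort (κ ∘ y) v = v ↔
      (Finset.univ.filter fun i => i < v ∧ y i ≠ y v).card =
        (Finset.univ.filter fun i => κ (y i) < κ (y v)).card := by
  set σ := Tuple.sort (κ ∘ y) with hσ
  have h1 : (Finset.univ.filter fun i => i < v).card =
      (Finset.univ.filter fun i => i < v ∧ y i ≠ y v).card +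
        (Finset.univ.filter fun i => i < v ∧ y i = y v).card := by
    rw [← Finset.card_filter_add_card_filter_not (s := Finset.univ.filter fun i => i < v)
      (fun i => y i ≠ y v), Finset.filter_filter, Finset.filter_filter]
    simp only [not_not, ne_eq]
  have h2 : (Finset.univ.filter fun i => i < σ.symm v).card =
      (Finset.univ.filter fun i => κ (y i) < κ (y v)).card +
        (Finset.univ.filter fun i => i < v ∧ y i = y v).card := by
    rw [← Finset.card_union_of_disjoint, ← Finset.card_map σ.toEmbedding]
    · congr 1
      ext i
      simp only [Finset.mem_map, Finset.mem_filter, Finset.mem_univ, true_and, Finset.mem_union,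
        Equiv.coe_toEmbedding]
      constructor
      · rintro ⟨k, hk, rfl⟩
        rw [Tuple.sort_lt_sort_iff (κ ∘ y), ← hσ] at hk
        simp only [Function.comp_apply, Equiv.apply_symm_apply] at hk
        exact hk.imp_right fun h => ⟨h.2, hκ h.1⟩
      · intro h
        refine ⟨σ.symm i, ?_, by simp⟩
        rw [Tuple.sort_lt_sort_iff (κ ∘ y), ← hσ]
        simp only [Function.comp_apply, Equiv.apply_symm_apply]
        exact h.imp_right fun h => ⟨congrArg κ h.2, h.1⟩
    · rw [Finset.disjoint_left]
      intro i hi hi'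
      simp only [Finset.mem_filter, Finset.mem_univ, true_and] at hi hi'
      rw [hi'.2] at hi
      exact lt_irrefl _ hi
  have h3 : ∀ k : Fin n, (Finset.univ.filter fun i => i < k).card = k := fun k => by
    have : (Finset.univ.filter fun i => i < k) = Finset.Iio k := by ext; simp
    rw [this, Fin.card_Iio]
  rw [h3] at h1 h2
  rw [← Equiv.eq_symm_apply, Fin.ext_iff]
  omega

theorem exists_has_ofFn_iff {A K : Type*} [DecidableEq A] [LinearOrder K] {κ : A → K}
    (hκ : Function.Injective κ) (y : Fin n → A) :
    (∃ a, Has (SortSplit κ) a (List.ofFn y)) ↔ ∃ v, Tuple.sort (κ ∘ y) v = v := by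
  constructor
  · rintro ⟨a, h⟩
    obtain ⟨g, r, h1, h2⟩ := has_sortSplit_iff.1 h
    have hlen : g.length < n := by
      have := congrArg List.length h1
      simp at this
      omega
    have hg : g = (List.ofFn y).take g.length := by rw [h1]; simp
    have ha : a = y ⟨g.length, hlen⟩ := by
      have : (List.ofFn y)[g.length]'(by simpa using hlen) = a := by simp [h1]
      rw [← this]
      simp
    refine ⟨⟨g.length, hlen⟩, (sort_fixed_iff hκ y _).2 ?_⟩
    rw [hg, countP_take_ofFn y (fun x => x ≠ a) ⟨g.length, hlen⟩, countP_ofFn] at h2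
    rw [ha] at h2
    exact h2
  · rintro ⟨v, h⟩
    refine ⟨y v, has_sortSplit_iff.2 ⟨(List.ofFn y).take v, (List.ofFn y).drop (v + 1), ?_, ?_⟩⟩
    · have : y v = (List.ofFn y)[v.1]'(by simp) := by simp
      rw [this, ← List.drop_eq_getElem_cons, List.take_append_drop]
    · rw [countP_take_ofFn y (fun x => x ≠ y v) v, countP_ofFn]
      exact (sort_fixed_iff hκ y v).1 h

omit [NeZero N] in
theorem rows_ofFn (y : Fin n → Letter N) :
    rows (List.ofFn y) = List.ofFn (Letter.abs ∘ y ∘ Tuple.sort (Letter.block ∘ y)) := by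
  refine List.Perm.eq_of_pairwise' (r := (· ≥ ·)) (pairwise_rows _) ?_ ?_
  · rw [List.pairwise_ofFn]
    intro i k hik
    exact Letter.abs_le_of_block_le (Tuple.monotone_sort (Letter.block ∘ y) hik.le)
  · rw [← Function.comp_assoc]
    refine List.Perm.trans ?_ (Equiv.Perm.ofFn_comp_perm _ _).symm
    rw [← Multiset.coe_eq_coe, rows, Multiset.sort_eq, Multiset.map_coe, List.map_ofFn]

theorem ofFn_mem_belowRows_iff (y : Fin n → Letter N) :
    List.ofFn y ∈ BelowRows N ↔
      ∀ v, Compat (y (Tuple.sort (Letter.block ∘ y) v)).abs (y v) := by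
  rw [BelowRows, Set.mem_ofPred_eq, rows_ofFn, Below, Set.mem_ofPred_eq, List.forall₂_iff_get]
  constructor
  · intro h v
    simpa using h.2 v (by simp) (by simp)
  · intro h
    refine ⟨by simp, fun i h1 h2 => ?_⟩
    simpa using h ⟨i, by simpa using h2⟩

/-- The letters of the word are moved by the sorting permutation, to the left if they are barred
and to the right if they are unbarred of color `0`. -/
def IsSortDeranged (y : Fin n → Letter N) : Prop :=
  ∀ i, Tuple.sort (Letter.block ∘ y) i ≠ i ∧
    ((y (Tuple.sort (Letter.block ∘ y) i)).isBarred = true →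
      i < Tuple.sort (Letter.block ∘ y) i) ∧
    ((y (Tuple.sort (Letter.block ∘ y) i)).color = 0 ∧
      (y (Tuple.sort (Letter.block ∘ y) i)).isBarred = false →
      Tuple.sort (Letter.block ∘ y) i < i)

omit [NeZero N] in
theorem eq_of_block_le_of_isBarred {a b : Letter N} (h : a.block ≤ b.block) (hb : b.isBarred = true)
    (hab : a.abs = b.abs) : a = b := by
  cases b with
  | plain => simp [Letter.isBarred] at hb
  | bar u =>
    cases a with
    | bar v =>
      simp only [Letter.abs] at hab
      rw [hab]
    | plain v c =>
      simp only [Letter.abs] at hab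
      subst hab
      simp [Letter.block, Prod.Lex.toLex_le_toLex] at h

theorem eq_of_block_le_of_plain {a b : Letter N} (h : a.block ≤ b.block)
    (ha : a.color = 0 ∧ a.isBarred = false) (hab : a.abs = b.abs) : a = b := by
  cases a with
  | bar => simp [Letter.isBarred] at ha
  | plain u c =>
    simp only [Letter.color, Letter.isBarred, and_true] at ha
    subst ha
    cases b with
    | bar v =>
      simp only [Letter.abs] at hab
      subst hab
      simp [Letter.block, Prod.Lex.toLex_le_toLex] at h
    | plain v c =>
      simp only [Letter.abs] at hab
      subst hab
      simp [Letter.block, Prod.Lex.toLex_le_toLex] at h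
      have h' : c ≤ 0 := h
      rw [nonpos_iff_eq_zero.1 h']

/-- Translates row conditions into directions of movement. Letters moved in the right direction
satisfy their row condition because sorted rows decrease; the converse needs stability of the
sorting to handle equal rows. -/
theorem ofFn_mem_free_iff (y : Fin n → Letter N) :
    List.ofFn y ∈ Free (BelowRows N) (SortSplit Letter.block) Set.univ ↔ IsSortDeranged y := by
  have hfree : (∀ b ∈ Set.univ, ¬ Has (SortSplit Letter.block) b (List.ofFn y)) ↔
      ∀ v, Tuple.sort (Letter.block ∘ y) v ≠ v := by
    rw [← not_exists, ← exists_has_ofFn_iff Letter.block_injective]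
    simp
  rw [Free, Set.mem_ofPred_eq, hfree, ofFn_mem_belowRows_iff]
  have hlt := fun i k => Tuple.sort_lt_sort_iff (Letter.block ∘ y) i k
  set σ := Tuple.sort (Letter.block ∘ y) with hσ
  have hmono : ∀ i k, i ≤ k → (y (σ i)).block ≤ (y (σ k)).block := fun i k h =>
    Tuple.monotone_sort (Letter.block ∘ y) h
  constructor
  · rintro ⟨hc, hd⟩
    -- Infinite descent. If a barred letter is moved the wrong way, its row has the same absolute
    -- value; as barred letters come first in their block, the letter at `σ (σ i)` is the same one,
    -- and stability gives `σ (σ i) < σ i`.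
    have h1 : ∀ m : ℕ, ∀ i : Fin n, i.1 = m → (y (σ i)).isBarred = true → ¬ σ i < i := by
      intro m
      induction m using Nat.strong_induction_on with
      | _ m ih =>
        rintro i rfl hb hi
        have habs := (hc (σ i)).1 hb
        have h2 : y (σ (σ i)) = y (σ i) := eq_of_block_le_of_isBarred (hmono _ _ hi.le) hb
          (le_antisymm habs (Letter.abs_le_of_block_le (hmono _ _ hi.le)))
        refine ih (σ i) hi (σ i) rfl (h2 ▸ hb) ?_
        have := (hlt (σ i) i).1 hi
        simp only [Function.comp_apply, h2, lt_irrefl, false_or, true_and] at this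
        exact this
    -- The mirror argument: unbarred letters of color `0` come last in their block, and the
    -- positions `i < σ i < σ (σ i) < ⋯` would increase without end.
    have h2 : ∀ m : ℕ, ∀ i : Fin n, n - i.1 = m →
        (y (σ i)).color = 0 ∧ (y (σ i)).isBarred = false → ¬ i < σ i := by
      intro m
      induction m using Nat.strong_induction_on with
      | _ m ih =>
        rintro i rfl hb hi
        have habs := (hc (σ i)).2 hb
        have h2 : y (σ i) = y (σ (σ i)) := eq_of_block_le_of_plain (hmono _ _ hi.le) hb
          (le_antisymm habs (Letter.abs_le_of_block_le (hmono _ _ hi.le)))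
        refine ih (n - (σ i).1) (by have := (σ i).2; rw [Fin.lt_def] at hi; omega) (σ i) rfl
          (h2 ▸ hb) ?_
        have := (hlt i (σ i)).1 hi
        simp only [Function.comp_apply, ← h2, lt_irrefl, false_or, true_and] at this
        exact this
    exact fun i => ⟨hd i, fun hb => lt_of_le_of_ne (not_lt.1 (h1 _ i rfl hb)) (hd i).symm,
      fun hb => lt_of_le_of_ne (not_lt.1 (h2 _ i rfl hb)) (hd i)⟩
  · intro h
    refine ⟨fun v => ?_, fun v => (h v).1⟩
    obtain ⟨h1, h2, h3⟩ := h (σ.symm v)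
    rw [← hσ] at h1 h2 h3
    rw [Equiv.apply_symm_apply] at h1 h2 h3
    have h4 : y v = y (σ (σ.symm v)) := by simp
    refine ⟨fun hb => ?_, fun hb => ?_⟩
    · conv_rhs => rw [h4]
      exact Letter.abs_le_of_block_le (hmono _ _ (h2 hb).le)
    · conv_lhs => rw [h4]
      exact Letter.abs_le_of_block_le (hmono _ _ (h3 hb).le)

end SortedWords

end ColoredBanner

namespace ColoredBanner

/-! ### Colored permutations as sorted words -/

section ColoredPermWords

variable {N n : ℕ} [NeZero N]

namespace ColoredPerm

theorem mem_Exc {π : ColoredPerm N n} {i : Fin n} : i ∈ π.Exc ↔ π.col i = 0 ∧ i < π.perm i := by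
  have h0 : ∀ c : Fin N, ¬ OrderDual.toDual (0 : Fin N) < OrderDual.toDual c := fun c h =>
    absurd (OrderDual.toDual_lt_toDual.1 h) (by simp)
  simp only [Exc, letter, cletter, Finset.mem_filter, Finset.mem_univ, true_and,
    Prod.Lex.toLex_lt_toLex, h0, false_or, OrderDual.toDual_inj]
  rw [eq_comm]

/-- The letter at the position `i` that records the number `s i`, the color, and whether `i` is an
excedance. -/
def bannerLetter (π : ColoredPerm N n) (s : Fin n → ℕ+) (i : Fin n) : Letter N :=
  if i ∈ π.Exc then Letter.bar (s i) else Letter.plain (s i) (π.col i)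

theorem abs_bannerLetter (π : ColoredPerm N n) (s : Fin n → ℕ+) (i : Fin n) :
    (π.bannerLetter s i).abs = s i := by
  unfold bannerLetter
  split_ifs <;> rfl

theorem color_bannerLetter (π : ColoredPerm N n) (s : Fin n → ℕ+) (i : Fin n) :
    (π.bannerLetter s i).color = π.col i := by
  unfold bannerLetter
  split_ifs with h
  · exact (mem_Exc.1 h).1.symm
  · rfl

theorem isBarred_bannerLetter (π : ColoredPerm N n) (s : Fin n → ℕ+) (i : Fin n) :
    (π.bannerLetter s i).isBarred = true ↔ i ∈ π.Exc := by
  unfold bannerLetter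
  split_ifs with h <;> simp [Letter.isBarred, h]

/-- The order by `Letter.block` is chosen so that, within a row, comparing blocks and then values
agrees with the order of the letters with tildes. -/
theorem tilde_lt_tilde_iff (π : ColoredPerm N n) {s : Fin n → ℕ+} {i k : Fin n} (h : s i = s k) :
    π.tilde i < π.tilde k ↔ toLex ((π.bannerLetter s i).block, π.perm i) <
      toLex ((π.bannerLetter s k).block, π.perm k) := by
  unfold tilde bannerLetter
  by_cases hi : i ∈ π.Exc <;> by_cases hk : k ∈ π.Exc
  · simp [hi, hk, Letter.block, Prod.Lex.toLex_lt_toLex, h]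
  · simp [hi, hk, Letter.block, Prod.Lex.toLex_lt_toLex, h]
  · simp [hi, hk, Letter.block, Prod.Lex.toLex_lt_toLex, h]
  · simp [hi, hk, Letter.block, Prod.Lex.toLex_lt_toLex, h, letter, cletter]

theorem strictMono_of_lt_next {α : Type*} [Preorder α] {f : Fin n → α}
    (h : ∀ i : Fin n, ∀ hi : i.1 + 1 < n, f i < f ⟨i.1 + 1, hi⟩) : StrictMono f := by
  cases n with
  | zero => intro i; exact i.elim0
  | succ n => exact Fin.strictMono_iff_lt_succ.2 fun i => h i.castSucc (by simp)

/-- Admissible sequences for `DEX` are exactly those for which `π` is the stable sorting permutation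
of the associated word, as `Tuple.eq_sort_iff_strictMono` shows. At equal neighbors, the absence of
a descent is the strict increase of the pairs. -/
theorem antitone_and_lt_iff (π : ColoredPerm N n) (s : Fin n → ℕ+) :
    (Antitone s ∧ ∀ i ∈ π.DEX, ∀ h : i.1 + 1 < n, s ⟨i.1 + 1, h⟩ < s i) ↔
      StrictMono fun i => toLex ((π.bannerLetter s i).block, π.perm i) := by
  constructor
  · rintro ⟨h1, h2⟩
    refine strictMono_of_lt_next fun i hi => ?_
    have hle : s ⟨i.1 + 1, hi⟩ ≤ s i := h1 (by simp [Fin.le_def])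
    rcases hle.lt_or_eq with hlt | heq
    · rw [Prod.Lex.toLex_lt_toLex]
      exact Or.inl (Letter.block_lt_of_abs_lt (by simpa [abs_bannerLetter] using hlt))
    · have hn : ¬ π.tilde ⟨i.1 + 1, hi⟩ < π.tilde i := fun h =>
        absurd (h2 i ⟨hi, h⟩ hi) (by simp [heq])
      rw [tilde_lt_tilde_iff π heq] at hn
      refine lt_of_le_of_ne (not_lt.1 hn) fun h => ?_
      have := congrArg (fun x => (ofLex x).2) h
      simp [Fin.ext_iff] at this
  · intro h
    have h1 : Antitone s := fun i k hik => by
      have := Letter.abs_le_of_block_le (Prod.Lex.monotone_fst _ _ (h.monotone hik))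
      rwa [abs_bannerLetter, abs_bannerLetter] at this
    refine ⟨h1, fun i ⟨hi, hlt⟩ _ => ?_⟩
    have hle : s ⟨i.1 + 1, hi⟩ ≤ s i := h1 (by simp [Fin.le_def])
    refine lt_of_le_of_ne hle fun heq => ?_
    rw [tilde_lt_tilde_iff π heq] at hlt
    exact lt_asymm hlt (h (by simp [Fin.lt_def]))

omit [NeZero N] in
theorem fixVec_eq_zero_iff (π : ColoredPerm N n) : π.fixVec = 0 ↔ ∀ i, π.perm i ≠ i := by
  constructor
  · intro h i hi
    have := congrFun h (π.col i)
    simp only [fixVec, Pi.zero_apply, Finset.card_eq_zero, Finset.filter_eq_empty_iff] at this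
    exact this (Finset.mem_univ i) (by simp [letter, hi])
  · intro h
    funext k
    simp only [fixVec, Pi.zero_apply, Finset.card_eq_zero, Finset.filter_eq_empty_iff]
    intro i _ hi
    simp only [letter, cletter, EmbeddingLike.apply_eq_iff_eq, Prod.mk.injEq] at hi
    exact h i hi.2

/-- The word in which the letter of the position `i` stands at the place `π.perm i`. -/
def word (π : ColoredPerm N n) (s : Fin n → ℕ+) (v : Fin n) : Letter N :=
  π.bannerLetter s (π.perm.symm v)

theorem word_perm (π : ColoredPerm N n) (s : Fin n → ℕ+) (i : Fin n) :
    π.word s (π.perm i) = π.bannerLetter s i := by simp [word]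

theorem sort_word {π : ColoredPerm N n} {s : Fin n → ℕ+}
    (h : StrictMono fun i => toLex ((π.bannerLetter s i).block, π.perm i)) :
    Tuple.sort (Letter.block ∘ π.word s) = π.perm :=
  (Tuple.eq_sort_iff_strictMono.2 (by simpa [word_perm] using h)).symm

/-- The colored permutation that sorts a word. -/
def ofWord (y : Fin n → Letter N) : ColoredPerm N n where
  perm := Tuple.sort (Letter.block ∘ y)
  col i := (y (Tuple.sort (Letter.block ∘ y) i)).color

/-- The bars need not be stored separately: in a word deranged in the required directions, a
`0`-colored letter is barred iff its position is an excedance. -/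
theorem bannerLetter_ofWord {y : Fin n → Letter N} (h : IsSortDeranged y) (i : Fin n) :
    (ofWord y).bannerLetter (fun i => (y (Tuple.sort (Letter.block ∘ y) i)).abs) i =
      y (Tuple.sort (Letter.block ∘ y) i) := by
  unfold bannerLetter
  simp only [mem_Exc, ofWord]
  obtain ⟨-, h1, h2⟩ := h i
  generalize Tuple.sort (Letter.block ∘ y) i = v at *
  cases hv : y v with
  | plain u c =>
    rw [hv] at h2
    rw [if_neg]
    · rfl
    · rintro ⟨hc, hlt⟩
      exact lt_asymm hlt (h2 ⟨hc, rfl⟩)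
  | bar u =>
    rw [hv] at h1
    rw [if_pos ⟨rfl, h1 rfl⟩]
    rfl

end ColoredPerm

theorem card_filter_perm {A : Type*} (σ : Equiv.Perm (Fin n)) (f : Fin n → A) (p : A → Prop)
    [DecidablePred p] :
    (Finset.univ.filter fun i => p (f (σ i))).card = (Finset.univ.filter fun i => p (f i)).card :=
  Finset.card_equiv σ (by simp)

open ColoredPerm in
/-- Pairs of a deranged colored permutation and an admissible sequence correspond to words. -/
theorem card_coloredPerm_eq_card_words (j : ℕ) (β : ColorVector N) (d : ℕ+ →₀ ℕ) :
    Nat.card {p : ColoredPerm N n × (Fin n → ℕ+) //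
        (p.1.exc = j ∧ p.1.fixVec = 0 ∧ p.1.colVec = β) ∧ Antitone p.2 ∧
        (∀ i ∈ p.1.DEX, ∀ h : i.1 + 1 < n, p.2 ⟨i.1 + 1, h⟩ < p.2 i) ∧
        ∑ i, Finsupp.single (p.2 i) 1 = d} =
      Nat.card {y : Fin n → Letter N // IsSortDeranged y ∧
        (Finset.univ.filter fun i => (y i).isBarred = true).card = j ∧
        (∀ m : PosColor N, (Finset.univ.filter fun i => (y i).color = m.1).card = β m) ∧
        ∑ i, Finsupp.single (y i).abs 1 = d} := by
  have hexc : ∀ (π : ColoredPerm N n) (s : Fin n → ℕ+),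
      π.exc = (Finset.univ.filter fun i => (π.bannerLetter s i).isBarred = true).card := by
    intro π s
    simp only [isBarred_bannerLetter, Finset.filter_mem_eq_inter, Finset.univ_inter]
    rfl
  have hcol : ∀ (π : ColoredPerm N n) (s : Fin n → ℕ+), π.colVec = β ↔ ∀ m : PosColor N,
      (Finset.univ.filter fun i => (π.bannerLetter s i).color = m.1).card = β m := by
    intro π s
    simp only [color_bannerLetter, funext_iff]
    rfl
  refine Nat.card_congr ⟨fun p => ⟨p.1.1.word p.1.2, ?_⟩,
    fun y => ⟨(ofWord y.1, fun i => (y.1 (Tuple.sort (Letter.block ∘ y.1) i)).abs), ?_⟩, ?_, ?_⟩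
  · obtain ⟨⟨π, s⟩, ⟨h1, h2, h3⟩, h4, h5, h6⟩ := p
    have hs := (antitone_and_lt_iff π s).1 ⟨h4, h5⟩
    refine ⟨fun i => ?_, ?_, fun m => ?_, ?_⟩
    · simp only [sort_word hs, word_perm, color_bannerLetter, isBarred_bannerLetter]
      refine ⟨(fixVec_eq_zero_iff π).1 h2 i, fun h => (mem_Exc.1 h).2, fun ⟨h, h'⟩ => ?_⟩
      have h'' : i ∉ π.Exc := by
        rw [← isBarred_bannerLetter π s]
        simp [h']
      rw [mem_Exc, not_and] at h''
      exact lt_of_le_of_ne (not_lt.1 (h'' h)) ((fixVec_eq_zero_iff π).1 h2 i)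
    · refine Eq.trans ?_ ((hexc π s).symm.trans h1)
      rw [← card_filter_perm π.perm (π.word s) (fun a => a.isBarred = true)]
      simp only [word_perm]
    · refine Eq.trans ?_ ((hcol π s).1 h3 m)
      rw [← card_filter_perm π.perm (π.word s) (fun a => a.color = m.1)]
      simp only [word_perm]
    · refine Eq.trans ?_ h6
      rw [← Equiv.sum_comp π.perm]
      simp only [word_perm, abs_bannerLetter]
  · obtain ⟨y, h1, h2, h3, h4⟩ := y
    simp only
    have hl := bannerLetter_ofWord h1
    have hs : StrictMono fun i => toLex (((ofWord y).bannerLetter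
        (fun i => (y (Tuple.sort (Letter.block ∘ y) i)).abs) i).block, (ofWord y).perm i) := by
      simp only [hl]
      exact Tuple.eq_sort_iff_strictMono.1 (rfl : Tuple.sort (Letter.block ∘ y) = _)
    have hs' := (antitone_and_lt_iff _ _).2 hs
    refine ⟨⟨?_, ?_, ?_⟩, hs'.1, hs'.2, ?_⟩
    · rw [hexc _ (fun i => (y (Tuple.sort (Letter.block ∘ y) i)).abs)]
      simp only [hl]
      rw [card_filter_perm _ y (fun a => a.isBarred = true), h2]
    · exact (fixVec_eq_zero_iff _).2 fun i => (h1 i).1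
    · rw [hcol _ (fun i => (y (Tuple.sort (Letter.block ∘ y) i)).abs)]
      intro m
      simp only [hl]
      rw [card_filter_perm _ y (fun a => a.color = m.1), h3]
    · rw [← h4]
      exact Equiv.sum_comp (Tuple.sort (Letter.block ∘ y)) fun v => Finsupp.single (y v).abs 1
  · rintro ⟨⟨π, s⟩, ⟨h1, h2, h3⟩, h4, h5, h6⟩
    have hs := (antitone_and_lt_iff π s).1 ⟨h4, h5⟩
    refine Subtype.ext (Prod.ext (ColoredPerm.ext (sort_word hs) ?_) ?_)
    · funext i
      simp only [ofWord, sort_word hs, word_perm, color_bannerLetter]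
    · funext i
      simp only [sort_word hs, word_perm, abs_bannerLetter]
  · rintro ⟨y, h1, h2⟩
    refine Subtype.ext (funext fun v => ?_)
    simp only [word]
    rw [bannerLetter_ofWord h1]
    simp [ofWord]

/-- The content of a word, as a monomial in the absolute values of its letters. -/
noncomputable def absContent (w : List (Letter N)) : ℕ+ →₀ ℕ :=
  Multiset.toFinsupp ((w : Multiset (Letter N)).map Letter.abs)

/-- The generating function of a set with respect to a content. -/
noncomputable def genSeries {T : Type*} (S : Set T) (c : T → ℕ+ →₀ ℕ) : MvPowerSeries ℕ+ ℤ :=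
  fun d => (Nat.card {x // x ∈ S ∧ c x = d} : ℤ)

omit [NeZero N] in
theorem absContent_ofFn (y : Fin n → Letter N) :
    absContent (List.ofFn y) = ∑ i, Finsupp.single (y i).abs 1 := by
  rw [absContent, ← Fin.univ_val_map, Multiset.map_map]
  simp only [← Multiset.toFinsupp_singleton]
  rw [← map_sum]
  congr 1
  have := Multiset.sum_map_singleton (Finset.univ.val.map (Letter.abs ∘ y))
  rw [Multiset.map_map] at this
  exact this.symm

/-- Finiteness is needed because `Nat.card` is also `0` for infinite fibers. -/
theorem exists_equiv_of_card_fiber_eq {α β γ : Type*} {f : α → γ} {g : β → γ}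
    (hf : ∀ c, Finite {a // f a = c}) (hg : ∀ c, Finite {b // g b = c})
    (h : ∀ c, Nat.card {a // f a = c} = Nat.card {b // g b = c}) :
    ∃ e : α ≃ β, ∀ a, g (e a) = f a :=
  ⟨Equiv.ofFiberEquiv fun c => (@Finite.card_eq _ _ (hf c) (hg c)).1 (h c) |>.some,
    fun a => Equiv.ofFiberEquiv_map _ a⟩

end ColoredPermWords

end ColoredBanner

namespace ColoredBanner

/-! ### Colored Eulerian quasisymmetric functions as generating functions of banners -/

section EulerianBanner

variable {N n : ℕ} [NeZero N]

theorem exists_equiv_of_cnt_eq {L : Type*} {Ω Ω' : Set (List L)} (h : ∀ m, cnt Ω m = cnt Ω' m) :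
    ∃ e : Ω ≃ Ω', ∀ w, ((e w).1 : Multiset L) = (w.1 : Multiset L) := by
  have key : ∀ (Ω : Set (List L)) (m : Multiset L),
      Nonempty ({a : Ω // (a.1 : Multiset L) = m} ≃ {w // w ∈ Ω ∧ (w : Multiset L) = m}) :=
    fun Ω m => ⟨Equiv.subtypeSubtypeEquivSubtypeInter (· ∈ Ω) (fun w => (w : Multiset L) = m)⟩
  have hfin : ∀ (Ω : Set (List L)) (m : Multiset L), Finite {a : Ω // (a.1 : Multiset L) = m} :=
    fun Ω m => by
      have := finite_content Ω m
      exact Finite.of_equiv _ (key Ω m).some.symm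
  refine exists_equiv_of_card_fiber_eq (f := fun w : Ω => (w.1 : Multiset L))
    (g := fun w : Ω' => (w.1 : Multiset L)) (hfin Ω) (hfin Ω') fun m => ?_
  rw [Nat.card_congr (key Ω m).some, Nat.card_congr (key Ω' m).some]
  exact h m

/-- The words with given length, number of bars, color vector and content. -/
def HasStatistics (n j : ℕ) (β : ColorVector N) (d : ℕ+ →₀ ℕ) (w : List (Letter N)) : Prop :=
  w.length = n ∧ colorVector w = β ∧ bars w = j ∧ absContent w = d

theorem HasStatistics.congr {j : ℕ} {β : ColorVector N} {d : ℕ+ →₀ ℕ} {v w : List (Letter N)}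
    (h : (v : Multiset (Letter N)) = w) :
    HasStatistics n j β d v ↔ HasStatistics n j β d w := by
  have h' := Multiset.coe_eq_coe.1 h
  have h1 : colorVector v = colorVector w := by
    funext m
    exact h'.countP_eq _
  have h2 : bars v = bars w := h'.countP_eq _
  rw [HasStatistics, HasStatistics, h'.length_eq, h1, h2, absContent, absContent, h]

theorem mem_K₀_iff {j : ℕ} {β : ColorVector N} {d : ℕ+ →₀ ℕ} {w : List (Letter N)} :
    w ∈ K₀ n j β ∧ absContent w = d ↔
      w ∈ Free {w : List (Letter N) | IsBanner w} (RecordSplit id) (plainLetters N) ∧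
        HasStatistics n j β d w := by
  rw [mem_free_isBanner_iff, K₀, Set.mem_ofPred_eq, HasStatistics]
  tauto

theorem card_sorted_words (j : ℕ) (β : ColorVector N) (d : ℕ+ →₀ ℕ) :
    Nat.card {y : Fin n → Letter N // IsSortDeranged y ∧
        (Finset.univ.filter fun i => (y i).isBarred = true).card = j ∧
        (∀ m : PosColor N, (Finset.univ.filter fun i => (y i).color = m.1).card = β m) ∧
        ∑ i, Finsupp.single (y i).abs 1 = d} =
      Nat.card {w // w ∈ K₀ n j β ∧ absContent w = d} := by
  have h1 : ∀ y : Fin n → Letter N, (IsSortDeranged y ∧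
        (Finset.univ.filter fun i => (y i).isBarred = true).card = j ∧
        (∀ m : PosColor N, (Finset.univ.filter fun i => (y i).color = m.1).card = β m) ∧
        ∑ i, Finsupp.single (y i).abs 1 = d) ↔
      (List.ofFn y ∈ Free (BelowRows N) (SortSplit Letter.block) Set.univ ∧
        HasStatistics n j β d (List.ofFn y)) := by
    intro y
    rw [ofFn_mem_free_iff, HasStatistics, absContent_ofFn]
    have hc : colorVector (List.ofFn y) = β ↔
        ∀ m : PosColor N, (Finset.univ.filter fun i => (y i).color = m.1).card = β m := by
      rw [funext_iff]
      refine forall_congr' fun m => ?_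
      rw [← countP_ofFn y (fun a => a.color = m.1)]
      rfl
    have hb : bars (List.ofFn y) =
        (Finset.univ.filter fun i => (y i).isBarred = true).card := by
      rw [← countP_ofFn y (fun a => a.isBarred = true)]
      simp [bars]
    rw [hc, hb]
    simp only [List.length_ofFn, true_and]
    tauto
  obtain ⟨e, he⟩ := exists_equiv_of_cnt_eq (cnt_free_belowRows (N := N))
  have e2 : {w // w ∈ Free (BelowRows N) (SortSplit Letter.block) Set.univ ∧
      HasStatistics n j β d w} ≃ {w // w ∈ Free {w : List (Letter N) | IsBanner w}
        (RecordSplit id) (plainLetters N) ∧ HasStatistics n j β d w} :=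
    (Equiv.subtypeSubtypeEquivSubtypeInter _ _).symm.trans ((e.subtypeEquiv fun w =>
      (HasStatistics.congr (he w)).symm).trans (Equiv.subtypeSubtypeEquivSubtypeInter
        (· ∈ Free {w : List (Letter N) | IsBanner w} (RecordSplit id) (plainLetters N)) _))
  simp only [mem_K₀_iff]
  refine Eq.trans ?_ (Nat.card_congr e2)
  refine Nat.card_congr (Equiv.ofBijective
    (fun y => ⟨List.ofFn y.1, (h1 y.1).1 y.2⟩) ⟨fun y y' h => ?_, fun w => ?_⟩)
  · exact Subtype.ext (List.ofFn_injective (congrArg Subtype.val h))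
  · obtain ⟨w, hw⟩ := w
    obtain rfl : w.length = n := hw.2.1
    refine ⟨⟨w.get, (h1 _).2 ?_⟩, Subtype.ext (List.ofFn_get w)⟩
    rw [List.ofFn_get]
    exact hw

theorem finite_sequences (d : ℕ+ →₀ ℕ) (p : (Fin n → ℕ+) → Prop) :
    Finite {s : Fin n → ℕ+ // p s ∧ ∑ i, Finsupp.single (s i) 1 = d} := by
  refine Set.Finite.subset (Set.Finite.pi' fun _ : Fin n => d.support.finite_toSet) ?_
    |>.to_subtype
  rintro s ⟨-, rfl⟩ i
  rw [Finset.mem_coe, Finsupp.mem_support_iff, Finsupp.finsetSum_apply]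
  refine (Finset.sum_pos' (fun _ _ => Nat.zero_le _) ⟨i, Finset.mem_univ i, ?_⟩).ne'
  simp

/-- The colored Eulerian quasisymmetric function without fixed points is the generating function
of the banners without Lyndon factors of length one. -/
theorem Q_eq_genSeries (n j : ℕ) (β : ColorVector N) :
    Q n j 0 β = genSeries (K₀ n j β) absContent := by
  classical
  funext d
  have hfin : ∀ π : {π : ColoredPerm N n // π.exc = j ∧ π.fixVec = 0 ∧ π.colVec = β},
      Finite {s : Fin n → ℕ+ // Antitone s ∧
        (∀ i ∈ π.1.DEX, ∀ h : i.1 + 1 < n, s ⟨i.1 + 1, h⟩ < s i) ∧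
        ∑ i, Finsupp.single (s i) 1 = d} := fun π => by
    simp only [← and_assoc]
    exact finite_sequences d _
  have h1 : Q n j 0 β d =
      ∑ π : ColoredPerm N n with π.exc = j ∧ π.fixVec = 0 ∧ π.colVec = β,
        fundamentalQS π.DEX d := by
    unfold Q
    exact Finset.sum_apply _ _ _
  rw [h1, genSeries, ← card_sorted_words, ← card_coloredPerm_eq_card_words]
  simp only [fundamentalQS]
  rw [← Nat.cast_sum, Finset.sum_subtype (p := fun π : ColoredPerm N n =>
    π.exc = j ∧ π.fixVec = 0 ∧ π.colVec = β) _ (by simp), ← Nat.card_sigma]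
  congr 1
  refine Nat.card_congr ⟨fun x => ⟨(x.1.1, x.2.1), x.1.2, x.2.2⟩,
    fun p => ⟨⟨p.1.1, p.2.1⟩, p.1.2, p.2.2⟩, fun _ => rfl, fun _ => rfl⟩

end EulerianBanner

end ColoredBanner

namespace ColoredBanner

/-! ### Generating functions of words -/

section WordSeries

variable {L R : Type*} [CommRing R]

open PowerSeries

open Classical in
/-- The words of length `n` with letters in a finite alphabet. -/
noncomputable def words (A : Finset L) : ℕ → Finset (List L)
  | 0 => {[]}
  | n + 1 => (A ×ˢ words A n).image fun p => p.1 :: p.2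

theorem mem_words {A : Finset L} {n : ℕ} {w : List L} :
    w ∈ words A n ↔ w.length = n ∧ ∀ a ∈ w, a ∈ A := by
  induction n generalizing w with
  | zero => simp +contextual [words]
  | succ n ih =>
    cases w with
    | nil => simp [words]
    | cons a w =>
      simp [words, ih]
      tauto

theorem sum_words_succ (A : Finset L) (n : ℕ) (f : List L → R) :
    ∑ w ∈ words A (n + 1), f w = ∑ a ∈ A, ∑ w ∈ words A n, f (a :: w) := by
  classical
  rw [words, Finset.sum_image, Finset.sum_product]
  rintro ⟨a, w⟩ _ ⟨b, v⟩ _ h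
  simpa using h

open Classical in
/-- The generating function of the words over `A` with the property `p`, by length. -/
noncomputable def wordSeries (A : Finset L) (ω : L → R) (p : List L → Prop) : PowerSeries R :=
  PowerSeries.mk fun n => ∑ w ∈ words A n, if p w then (w.map ω).prod else 0

variable {A : Finset L} {ω : L → R}

theorem wordSeries_congr {p q : List L → Prop} (h : ∀ w, (∀ a ∈ w, a ∈ A) → (p w ↔ q w)) :
    wordSeries A ω p = wordSeries A ω q := by
  ext n
  simp only [wordSeries, coeff_mk]
  exact Finset.sum_congr rfl fun w hw => by rw [propext (h w (mem_words.1 hw).2)]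

theorem wordSeries_split (p q : List L → Prop) :
    wordSeries A ω p = wordSeries A ω (fun w => p w ∧ q w) +
      wordSeries A ω (fun w => p w ∧ ¬ q w) := by
  ext n
  simp only [wordSeries, map_add, coeff_mk]
  rw [← Finset.sum_add_distrib]
  refine Finset.sum_congr rfl fun w _ => ?_
  by_cases h1 : p w <;> by_cases h2 : q w <;> simp [h1, h2]

theorem wordSeries_false : wordSeries A ω (fun _ => False) = 0 := by
  ext n
  simp [wordSeries]

open Classical in
-- The first-letter decomposition, which provides the linear equations for the banner series.
theorem wordSeries_cons (p : List L → Prop) :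
    wordSeries A ω p = (if p [] then 1 else 0) +
      ∑ a ∈ A, C (ω a) * PowerSeries.X * wordSeries A ω (fun w => p (a :: w)) := by
  ext n
  rw [map_add, map_sum]
  cases n with
  | zero =>
    have h : ∀ a, coeff 0 (C (ω a) * PowerSeries.X * wordSeries A ω (fun w => p (a :: w))) = 0 := fun a => by
      rw [mul_assoc, coeff_C_mul, coeff_zero_X_mul, mul_zero]
    simp only [h, Finset.sum_const_zero, add_zero]
    by_cases hp : p [] <;> simp [wordSeries, words, hp]
  | succ n =>
    have h : ∀ a, coeff (n + 1) (C (ω a) * PowerSeries.X * wordSeries A ω (fun w => p (a :: w))) =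
        ω a * ∑ w ∈ words A n, if p (a :: w) then (w.map ω).prod else 0 := fun a => by
      rw [mul_assoc, coeff_C_mul, coeff_succ_X_mul]
      simp [wordSeries]
    have h0 : coeff (n + 1) (if p [] then (1 : PowerSeries R) else 0) = 0 := by
      split_ifs <;> simp [coeff_one]
    rw [h0, zero_add]
    rw [Finset.sum_congr rfl fun a _ => h a]
    simp only [wordSeries, coeff_mk, sum_words_succ, Finset.mul_sum]
    refine Finset.sum_congr rfl fun a _ => Finset.sum_congr rfl fun w _ => ?_
    split_ifs <;> simp

theorem wordSeries_of_equiv {p q : List L → Prop} {a : L} (ha : a ∈ A)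
    (e : {w // p w} ≃ {w // q w}) (he : ∀ w, ((e w).1 : Multiset L) = a ::ₘ (w.1 : Multiset L)) :
    wordSeries A ω q = C (ω a) * PowerSeries.X * wordSeries A ω p := by
  classical
  ext n
  rw [mul_assoc, coeff_C_mul]
  cases n with
  | zero =>
    have : ¬ q [] := fun hq => by
      obtain ⟨w, hw⟩ := e.surjective ⟨[], hq⟩
      have := he w
      rw [hw] at this
      exact Multiset.zero_ne_cons this
    rw [coeff_zero_X_mul, mul_zero]
    simp [wordSeries, words, this]
  | succ n =>
    rw [coeff_succ_X_mul]
    simp only [wordSeries, coeff_mk]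
    have hfil : ∀ (p : List L → Prop) (n : ℕ),
        (∑ w ∈ words A n, @ite R (p w) (Classical.propDecidable _) (w.map ω).prod 0) =
          ∑ w ∈ (words A n).filter p, (w.map ω).prod := fun p n => by
      rw [Finset.sum_filter]
    rw [hfil, hfil, Finset.mul_sum]
    symm
    refine Finset.sum_bij (fun w hw => (e ⟨w, (Finset.mem_filter.1 hw).2⟩).1) ?_ ?_ ?_ ?_
    · intro w hw
      have hp := Multiset.coe_eq_coe.1 (he ⟨w, (Finset.mem_filter.1 hw).2⟩)
      obtain ⟨hw1, hw2⟩ := mem_words.1 (Finset.mem_filter.1 hw).1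
      refine Finset.mem_filter.2 ⟨mem_words.2 ⟨?_, fun b hb => ?_⟩, (e _).2⟩
      · rw [hp.length_eq, List.length_cons, hw1]
      · rcases List.mem_cons.1 (hp.mem_iff.1 hb) with rfl | hb
        · exact ha
        · exact hw2 b hb
    · intro v hv w hw hvw
      simpa using e.injective (Subtype.ext hvw)
    · intro v hv
      obtain ⟨hv1, hv2⟩ := Finset.mem_filter.1 hv
      obtain ⟨w, hw⟩ := e.surjective ⟨v, hv2⟩
      have hp := Multiset.coe_eq_coe.1 (he w)
      rw [hw] at hp
      simp only at hp
      obtain ⟨hv3, hv4⟩ := mem_words.1 hv1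
      refine ⟨w.1, Finset.mem_filter.2 ⟨mem_words.2 ⟨?_, fun b hb => ?_⟩, w.2⟩, by rw [hw]⟩
      · have := hp.length_eq
        rw [List.length_cons] at this
        omega
      · exact hv4 b (hp.mem_iff.2 (List.mem_cons_of_mem _ hb))
    · intro w hw
      have hp := Multiset.coe_eq_coe.1 (he ⟨w, (Finset.mem_filter.1 hw).2⟩)
      rw [(hp.map ω).prod_eq, List.map_cons, List.prod_cons]

variable {Ω : Set (List L)} {Sp : L → List L → List L → Prop} {F : Set L}

/-- Words with a marked `a` arise bijectively by one insertion of `a`, so their series is `ω a * z`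
times the series before; the rest is subtraction. -/
theorem IsInsertion.wordSeries_insert (h : IsInsertion Ω Sp F) {F' : Set L} (hF : F' ⊆ F) {a : L}
    (ha : a ∈ F) (ha' : a ∉ F') (haA : a ∈ A) :
    wordSeries A ω (· ∈ Free Ω Sp (insert a F')) =
      (1 - C (ω a) * PowerSeries.X) * wordSeries A ω (· ∈ Free Ω Sp F') := by
  have h1 := wordSeries_split (A := A) (ω := ω) (· ∈ Free Ω Sp F') (Has Sp a)
  obtain ⟨e, he⟩ := h.exists_equiv hF ha ha'
  have h2 := wordSeries_of_equiv (ω := ω) haA e he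
  have h3 : wordSeries A ω (fun w => w ∈ Free Ω Sp F' ∧ ¬ Has Sp a w) =
      wordSeries A ω (· ∈ Free Ω Sp (insert a F')) :=
    wordSeries_congr fun w _ => mem_free_insert.symm
  rw [h2, h3] at h1
  linear_combination -h1

theorem IsInsertion.wordSeries_free (h : IsInsertion Ω Sp F) (B : Finset L)
    (hB : ∀ a, a ∈ B ↔ a ∈ A ∧ a ∈ F) :
    wordSeries A ω (· ∈ Free Ω Sp F) =
      (∏ a ∈ B, (1 - C (ω a) * PowerSeries.X)) * wordSeries A ω (· ∈ Ω) := by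
  classical
  have h1 : wordSeries A ω (· ∈ Free Ω Sp F) = wordSeries A ω (· ∈ Free Ω Sp B) :=
    wordSeries_congr fun w hw => and_congr_right fun _ =>
      ⟨fun h b hb => h b ((hB b).1 hb).2, fun h b hb hh =>
        h b ((hB b).2 ⟨hw b hh.mem, hb⟩) hh⟩
  rw [h1]
  have key : ∀ s ⊆ B, wordSeries A ω (· ∈ Free Ω Sp s) =
      (∏ a ∈ s, (1 - C (ω a) * PowerSeries.X)) * wordSeries A ω (· ∈ Ω) := by
    intro s
    induction s using Finset.induction_on with
    | empty => simp [free_empty]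
    | insert a s ha ih =>
      intro hs
      rw [Finset.insert_subset_iff] at hs
      have haB := (hB a).1 hs.1
      rw [Finset.coe_insert, h.wordSeries_insert (fun b hb => ((hB b).1 (hs.2 hb)).2) haB.2
        (by simpa using ha) haB.1, ih hs.2, Finset.prod_insert ha, mul_assoc]
  exact key B subset_rfl

end WordSeries

/-! ### Closed formula for the series of all banners -/

section BannerSeries

open PowerSeries

variable {N : ℕ} [NeZero N] {R : Type*} [CommRing R]

/-- The letters, indexed by their absolute values and their colors or bars. -/
def letterEmb (N : ℕ) : ℕ × Option (Fin N) ↪ Letter N where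
  toFun p := match p with
    | (k, none) => Letter.bar k.succPNat
    | (k, some c) => Letter.plain k.succPNat c
  inj' := by
    rintro ⟨k, _ | c⟩ ⟨l, _ | d⟩ h <;> simp_all

/-- The letters with absolute value at most `K`. -/
def letters (N K : ℕ) : Finset (Letter N) := (Finset.range K ×ˢ Finset.univ).map (letterEmb N)

omit [NeZero N] in
theorem sum_letters {M : Type*} [AddCommMonoid M] (K : ℕ) (f : Letter N → M) :
    ∑ a ∈ letters N K, f a = ∑ k ∈ Finset.range K,
      (f (Letter.bar k.succPNat) + ∑ c, f (Letter.plain k.succPNat c)) := by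
  rw [letters, Finset.sum_map, Finset.sum_product]
  refine Finset.sum_congr rfl fun k _ => ?_
  rw [Fintype.sum_option]
  rfl

omit [NeZero N] in
theorem mem_letters {K : ℕ} {a : Letter N} : a ∈ letters N K ↔ (a.abs : ℕ) ≤ K := by
  simp only [letters, Finset.mem_map, Finset.mem_product, Finset.mem_range, Finset.mem_univ,
    and_true, Prod.exists]
  constructor
  · rintro ⟨k, _ | c, hk, rfl⟩ <;> exact hk
  · intro h
    cases a with
    | plain u c =>
      refine ⟨u.natPred, some c, ?_, ?_⟩
      · have := u.pos
        simp only [Letter.abs] at h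
        rw [PNat.natPred]
        omega
      · change Letter.plain u.natPred.succPNat c = _
        rw [PNat.succPNat_natPred]
    | bar u =>
      refine ⟨u.natPred, none, ?_, ?_⟩
      · have := u.pos
        simp only [Letter.abs] at h
        rw [PNat.natPred]
        omega
      · change Letter.bar u.natPred.succPNat = _
        rw [PNat.succPNat_natPred]

/-- The weight of a letter: `x u` for the absolute value `u`, and `t` for a bar or `s c` for the
color `c`. -/
def letterWeight (x : ℕ+ → R) (t : R) (s : Fin N → R) : Letter N → R
  | Letter.plain u c => x u * s c
  | Letter.bar u => x u * t

variable (x : ℕ+ → R) (t : R) (s : Fin N → R) (K : ℕ)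

/-- The generating function of the banners that start with a letter larger than `k`, and of the
empty word. -/
noncomputable def tailSeries (k : ℕ) : PowerSeries R :=
  wordSeries (letters N K) (letterWeight x t s)
    (fun w => IsBanner w ∧ ∀ b ∈ w.head?, k < (b.abs : ℕ))

theorem tailSeries_top : tailSeries x t s K K = 1 := by
  classical
  have : tailSeries x t s K K = wordSeries (letters N K) (letterWeight x t s) (fun w => w = []) := by
    refine wordSeries_congr fun w hw => ⟨fun h => ?_, ?_⟩
    · cases w with
      | nil => rfl
      | cons a w =>
        exact absurd (h.2 a (by simp)) (not_lt.2 (mem_letters.1 (hw a (by simp))))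
    · rintro rfl
      simp [isBanner_nil]
  rw [this, wordSeries_cons]
  simp [wordSeries_false]

theorem tailSeries_zero : tailSeries x t s K 0 =
    wordSeries (letters N K) (letterWeight x t s) (fun w => IsBanner w) :=
  wordSeries_congr fun w _ => by simp

/-- The difference collects the banners whose first letter has absolute value `k + 1`. The rest of
the word is a banner that starts above `k` or is empty after the `0`-colored unbarred letter, is
nonempty and starts at most at `k + 1` after the barred letter, and is arbitrary after a letter of
positive color. -/
theorem tailSeries_sub (hs : s 0 = 1) {k : ℕ} (hk : k < K) :
    tailSeries x t s K k - tailSeries x t s K (k + 1) =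
      C (x k.succPNat) * PowerSeries.X * (tailSeries x t s K k +
        C t * (tailSeries x t s K 0 - tailSeries x t s K (k + 1)) +
        C (∑ m : PosColor N, s m.1) * tailSeries x t s K 0) := by
  classical
  set ω := letterWeight x t s with hω
  let S : Letter N → PowerSeries R := fun a =>
    wordSeries (letters N K) ω (fun w => IsBanner (a :: w))
  let Y : ℕ → PowerSeries R := fun l => C (ω (Letter.bar l.succPNat)) * PowerSeries.X * S (Letter.bar l.succPNat)
    + ∑ c, C (ω (Letter.plain l.succPNat c)) * PowerSeries.X * S (Letter.plain l.succPNat c)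
  have hT : ∀ i, tailSeries x t s K i = 1 + ∑ l ∈ Finset.range K, if i ≤ l then Y l else 0 := by
    intro i
    rw [tailSeries, wordSeries_cons, if_pos ⟨isBanner_nil, by simp⟩, sum_letters]
    congr 1
    refine Finset.sum_congr rfl fun l _ => ?_
    have hc : ∀ a : Letter N, (a.abs : ℕ) = l + 1 →
        wordSeries (letters N K) ω (fun w => IsBanner (a :: w) ∧
          ∀ b ∈ (a :: w).head?, i < (b.abs : ℕ)) = if i ≤ l then S a else 0 := by
      intro a ha
      split_ifs with hil
      · exact wordSeries_congr fun w _ => by simp [ha, Nat.lt_succ_of_le hil]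
      · rw [← wordSeries_false (A := letters N K) (ω := ω)]
        refine wordSeries_congr fun w _ => ?_
        simp [ha]
        omega
    rw [hc (Letter.bar l.succPNat) rfl,
      Finset.sum_congr rfl fun c _ => by rw [hc (Letter.plain l.succPNat c) rfl]]
    split_ifs
    · rfl
    · simp
  have hsub : tailSeries x t s K k - tailSeries x t s K (k + 1) = Y k := by
    rw [hT, hT, add_sub_add_left_eq_sub, ← Finset.sum_sub_distrib,
      Finset.sum_eq_single_of_mem k (Finset.mem_range.2 hk)]
    · simp
    · intro l _ hl
      by_cases h : k ≤ l
      · have : k + 1 ≤ l := by omega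
        simp [h, this]
      · have : ¬ k + 1 ≤ l := by omega
        simp [h, this]
  have hbar : S (Letter.bar k.succPNat) = tailSeries x t s K 0 - tailSeries x t s K (k + 1) := by
    rw [eq_sub_iff_add_eq, tailSeries_zero, wordSeries_split (fun w => IsBanner w)
      (fun w => ∃ b ∈ w.head?, (b.abs : ℕ) ≤ k + 1)]
    refine congrArg₂ (· + ·) ?_ ?_
    · refine wordSeries_congr fun w _ => ?_
      rw [isBanner_cons, MayPrecede]
      simp only [Letter.isBarred, Letter.abs, Bool.true_eq_false, and_false, false_implies,
        and_true, true_implies, ← PNat.coe_le_coe, Nat.succPNat_coe]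
      exact and_comm
    · exact wordSeries_congr fun w _ => by simp
  have hzero : S (Letter.plain k.succPNat 0) = tailSeries x t s K k := by
    refine wordSeries_congr fun w _ => ?_
    rw [isBanner_cons, MayPrecede]
    simp only [Letter.isBarred, Letter.abs, Letter.color, and_true, ← PNat.coe_le_coe,
      Nat.succPNat_coe]
    simp [and_comm]
  have hpos : ∀ m : PosColor N, S (Letter.plain k.succPNat m.1) = tailSeries x t s K 0 := by
    intro m
    rw [tailSeries_zero]
    refine wordSeries_congr fun w _ => ?_
    rw [isBanner_cons, MayPrecede]
    simp [Letter.isBarred, Letter.color, m.2]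
  have hsum : ∑ c, C (ω (Letter.plain k.succPNat c)) * PowerSeries.X * S (Letter.plain k.succPNat c) =
      C (x k.succPNat) * PowerSeries.X * (tailSeries x t s K k +
        C (∑ m : PosColor N, s m.1) * tailSeries x t s K 0) := by
    rw [← Finset.add_sum_erase _ _ (Finset.mem_univ (0 : Fin N)), hzero,
      Finset.sum_subtype (p := fun c : Fin N => c ≠ 0) _ (by simp)]
    simp only [hpos, hω, letterWeight, hs, mul_one]
    rw [map_sum, mul_add, Finset.sum_mul, Finset.mul_sum]
    congr 1
    refine Finset.sum_congr rfl fun m _ => ?_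
    rw [map_mul]
    ring
  rw [hsub]
  simp only [Y]
  rw [hsum, hbar]
  simp only [hω, letterWeight, map_mul]
  ring

/-- The closed formula for the generating function of the banners. -/
theorem bannerSeries_formula (hs : s 0 = 1) :
    C (1 + ∑ m : PosColor N, s m.1) * tailSeries x t s K 0 *
        ∏ k ∈ Finset.range K, (1 - C (x k.succPNat) * PowerSeries.X) =
      (∏ k ∈ Finset.range K, (1 - C (x k.succPNat * t) * PowerSeries.X)) *
        (1 - C t + C (t + ∑ m : PosColor N, s m.1) * tailSeries x t s K 0) := by
  -- With `U i = (1 - t) * T i + (t + σ) * T 0`, where `T i` is the tail series and `σ` the sum of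
  -- the color variables, the difference equation becomes `(1 - x * z) * U i = (1 - x * t * z) * U
  -- (i + 1)` for `x` the variable of `i + 1`. The product telescopes from `U 0 = (1 + σ) * T 0`.
  have key : ∀ i ≤ K, C (1 + ∑ m : PosColor N, s m.1) * tailSeries x t s K 0 *
        ∏ k ∈ Finset.range i, (1 - C (x k.succPNat) * PowerSeries.X) =
      (∏ k ∈ Finset.range i, (1 - C (x k.succPNat * t) * PowerSeries.X)) *
        ((1 - C t) * tailSeries x t s K i +
          C (t + ∑ m : PosColor N, s m.1) * tailSeries x t s K 0) := by
    intro i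
    induction i with
    | zero =>
      intro _
      simp only [Finset.range_zero, Finset.prod_empty, map_add, map_one]
      ring
    | succ i ih =>
      intro hi
      have h1 := ih (by omega)
      have h2 := tailSeries_sub x t s K hs (k := i) (by omega)
      rw [Finset.prod_range_succ, Finset.prod_range_succ, ← mul_assoc, h1]
      have h3 : (1 - C (x i.succPNat) * PowerSeries.X) * ((1 - C t) * tailSeries x t s K i +
          C (t + ∑ m : PosColor N, s m.1) * tailSeries x t s K 0) =
          (1 - C (x i.succPNat * t) * PowerSeries.X) * ((1 - C t) * tailSeries x t s K (i + 1) +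
          C (t + ∑ m : PosColor N, s m.1) * tailSeries x t s K 0) := by
        simp only [map_add, map_mul]
        linear_combination (1 - C t) * h2
      linear_combination (∏ k ∈ Finset.range i, (1 - C (x k.succPNat * t) * PowerSeries.X)) * h3
  rw [key K le_rfl, tailSeries_top, mul_one]

end BannerSeries

end ColoredBanner

namespace ColoredBanner

/-! ### The recurrence for banners without Lyndon factors of length one -/

section FreeSeries

open PowerSeries

variable {N : ℕ} [NeZero N] {R : Type*} [CommRing R]

omit [NeZero N] in
theorem prod_letters {M : Type*} [CommMonoid M] (K : ℕ) (f : Letter N → M) :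
    ∏ a ∈ letters N K, f a = ∏ k ∈ Finset.range K,
      (f (Letter.bar k.succPNat) * ∏ c, f (Letter.plain k.succPNat c)) := by
  rw [letters, Finset.prod_map, Finset.prod_product]
  refine Finset.prod_congr rfl fun k _ => ?_
  rw [Fintype.prod_option]
  rfl

variable (x : ℕ+ → R) (t : R) (s : Fin N → R) (K : ℕ)

/-- The generating function of the banners without Lyndon factors of length one. -/
noncomputable def freeSeries : PowerSeries R :=
  wordSeries (letters N K) (letterWeight x t s)
    (· ∈ Free {w : List (Letter N) | IsBanner w} (RecordSplit id) (plainLetters N))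

/-- The product of `1 - x u * c * z` over the first numbers `u`. -/
noncomputable def elemProd (c : R) : PowerSeries R :=
  ∏ k ∈ Finset.range K, (1 - C (x k.succPNat * c) * PowerSeries.X)

/-- One factor for each unbarred letter that may no longer be marked, grouped by color. -/
theorem freeSeries_eq (hs : s 0 = 1) : freeSeries x t s K =
    elemProd x K 1 * (∏ m : PosColor N, elemProd x K (s m.1)) * tailSeries x t s K 0 := by
  classical
  rw [freeSeries, isInsertion_isBanner.wordSeries_free
    ((letters N K).filter fun a => a.isBarred = false) (by simp [mem_plainLetters]),
    tailSeries_zero]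
  refine congrArg₂ (· * ·) ?_ rfl
  rw [Finset.prod_filter, prod_letters]
  simp only [Letter.isBarred, Bool.true_eq_false, if_false, if_true, one_mul, letterWeight]
  rw [Finset.prod_comm, ← Finset.mul_prod_erase _ _ (Finset.mem_univ (0 : Fin N)), hs,
    Finset.prod_subtype (p := fun c : Fin N => c ≠ 0) _ (by simp)]
  rfl

theorem rescale_elemProd (c : R) : rescale t (elemProd x K c) = elemProd x K (c * t) := by
  rw [elemProd, elemProd, map_prod]
  refine Finset.prod_congr rfl fun k _ => ?_
  ext n
  rw [coeff_rescale, map_sub, map_sub, mul_sub]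
  rcases n with _ | _ | n
  · simp
  · simp [coeff_one]
    ring
  · simp [coeff_one, coeff_succ_mul_X]

/-- The contribution of the marks of the marked sequences of length `r`. -/
noncomputable def markWeight (r : ℕ) : R :=
  ∑ b ∈ Finset.Ico 1 r, t ^ b + (∑ m : PosColor N, s m.1) * ∑ b ∈ Finset.range r, t ^ b

/-- Geometric sums. The case `r = 0` is excluded: there `markWeight` vanishes while the right side
is `t - 1`. -/
theorem one_sub_mul_markWeight {r : ℕ} (hr : r ≠ 0) :
    (1 - t) * markWeight t s r =
      t + (∑ m : PosColor N, s m.1) - (1 + ∑ m : PosColor N, s m.1) * t ^ r := by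
  have h1 := mul_neg_geom_sum t r
  have h2 : ∑ b ∈ Finset.range r, t ^ b = 1 + ∑ b ∈ Finset.Ico 1 r, t ^ b := by
    rw [Finset.range_eq_Ico, Finset.sum_eq_sum_Ico_succ_bot (Nat.pos_of_ne_zero hr), pow_zero]
  rw [markWeight]
  have h3 : (1 - t) * ∑ b ∈ Finset.Ico 1 r, t ^ b = t - t ^ r := by
    rw [h2] at h1
    linear_combination h1
  linear_combination h3 + (∑ m : PosColor N, s m.1) * h1

/-- Write `H` for the series of the `h r`, the inverse of the factors of color `0`. By the geometric
sums, `1 - t` times the second factor is `(1 + σ) * H(t * z) - (t + σ) * H(z)`, and the closed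
banner formula multiplies this by the free series to `1 - t` times the right side. The factor `1 -
t` is then cancelled, hence the domain and `t ≠ 1`. -/
theorem freeSeries_mul (hs : s 0 = 1) [IsDomain R] (ht : t ≠ 1) {h : ℕ → R}
    (hh : elemProd x K 1 * PowerSeries.mk h = 1) :
    freeSeries x t s K * (1 - PowerSeries.mk fun r => h r * markWeight t s r) =
      ∏ m : PosColor N, elemProd x K (s m.1) := by
  have h0 : h 0 = 1 := by
    have := congrArg (coeff 0) hh
    simpa [elemProd] using this
  have ht' : (1 - C t : PowerSeries R) ≠ 0 := by
    intro h
    have := congrArg (coeff 0) h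
    simp only [map_sub, coeff_zero_one, coeff_zero_C, map_zero] at this
    exact ht (sub_eq_zero.1 this).symm
  have hmark : (1 - C t) * (1 - PowerSeries.mk fun r => h r * markWeight t s r) =
      C (1 + ∑ m : PosColor N, s m.1) * rescale t (PowerSeries.mk h) -
        C (t + ∑ m : PosColor N, s m.1) * PowerSeries.mk h := by
    ext r
    have hC : (1 - C t : PowerSeries R) = C (1 - t) := by rw [map_sub, map_one]
    rw [hC, coeff_C_mul, map_sub, map_sub, coeff_C_mul, coeff_C_mul, coeff_rescale, coeff_mk,
      coeff_mk, coeff_one]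
    rcases eq_or_ne r 0 with rfl | hr
    · simp [h0, markWeight]
    · rw [if_neg hr]
      linear_combination -(h r) * one_sub_mul_markWeight t s hr
  have hresc : elemProd x K t * rescale t (PowerSeries.mk h) = 1 := by
    have := congrArg (rescale t) hh
    rwa [map_mul, rescale_elemProd, map_one, one_mul] at this
  have hform := bannerSeries_formula x t s K hs
  have hP1 : ∏ k ∈ Finset.range K, (1 - C (x k.succPNat) * PowerSeries.X) = elemProd x K 1 := by
    simp [elemProd]
  have hPt : ∏ k ∈ Finset.range K, (1 - C (x k.succPNat * t) * PowerSeries.X) =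
      elemProd x K t := rfl
  rw [hP1, hPt] at hform
  refine mul_left_cancel₀ ht' ?_
  rw [← mul_assoc, mul_comm (1 - C t), mul_assoc, hmark, freeSeries_eq x t s K hs]
  linear_combination (∏ m : PosColor N, elemProd x K (s m.1)) *
    (rescale t (PowerSeries.mk h) * hform +
      (1 - C t + C (t + ∑ m : PosColor N, s m.1) * tailSeries x t s K 0) * hresc -
      C (t + ∑ m : PosColor N, s m.1) * tailSeries x t s K 0 * hh)

theorem coeff_freeSeries (hs : s 0 = 1) [IsDomain R] (ht : t ≠ 1) {h : ℕ → R}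
    (hh : elemProd x K 1 * PowerSeries.mk h = 1) (n : ℕ) :
    coeff n (freeSeries x t s K) = coeff n (∏ m : PosColor N, elemProd x K (s m.1)) +
      ∑ p ∈ Finset.HasAntidiagonal.antidiagonal n,
        coeff p.1 (freeSeries x t s K) * (h p.2 * markWeight t s p.2) := by
  have := congrArg (coeff n) (freeSeries_mul x t s K hs ht hh)
  rw [mul_sub, mul_one, map_sub, coeff_mul] at this
  simp only [coeff_mk] at this
  linear_combination this

end FreeSeries

end ColoredBanner

namespace ColoredBanner

section Recurrence

open Finset.HasAntidiagonal (antidiagonal)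

/-! ### Complete homogeneous symmetric polynomials -/

/-- The sum of all monomials of degree `r` in the first `K` variables. -/
noncomputable def homogeneousTrunc (K r : ℕ) : MvPowerSeries ℕ+ ℤ :=
  open Classical in
  fun d => if d.degree = r ∧ ∀ u ∈ d.support, (u : ℕ) ≤ K then 1 else 0

open Classical in
theorem coeff_homogeneousTrunc (K r : ℕ) (d : ℕ+ →₀ ℕ) :
    MvPowerSeries.coeff d (homogeneousTrunc K r) =
      if d.degree = r ∧ ∀ u ∈ d.support, (u : ℕ) ≤ K then 1 else 0 := rfl

theorem coeff_homogeneous (r : ℕ) (d : ℕ+ →₀ ℕ) :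
    MvPowerSeries.coeff d (homogeneous r) = if d.degree = r then 1 else 0 := rfl

theorem coeff_genSeries {T : Type*} (S : Set T) (c : T → ℕ+ →₀ ℕ) (d : ℕ+ →₀ ℕ) :
    MvPowerSeries.coeff d (genSeries S c) = (Nat.card {x // x ∈ S ∧ c x = d} : ℤ) := rfl

theorem homogeneousTrunc_zero_right (K : ℕ) : homogeneousTrunc K 0 = 1 := by
  ext d
  rw [coeff_homogeneousTrunc, MvPowerSeries.coeff_one]
  refine if_congr ⟨fun h => (Finsupp.degree_eq_zero_iff d).1 h.1, ?_⟩ rfl rfl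
  rintro rfl
  simp

theorem homogeneousTrunc_zero_succ (r : ℕ) : homogeneousTrunc 0 (r + 1) = 0 := by
  ext d
  rw [coeff_homogeneousTrunc, if_neg, map_zero]
  rintro ⟨h1, h2⟩
  have : d = 0 := by
    rw [← Finsupp.support_eq_empty, Finset.eq_empty_iff_forall_notMem]
    intro u hu
    exact absurd (h2 u hu) (by simp)
  simp [this] at h1

theorem homogeneousTrunc_succ_succ (K r : ℕ) : homogeneousTrunc (K + 1) (r + 1) =
    homogeneousTrunc K (r + 1) +
      MvPowerSeries.X K.succPNat * homogeneousTrunc (K + 1) r := by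
  classical
  ext d
  rw [map_add, MvPowerSeries.X, MvPowerSeries.coeff_monomial_mul, coeff_homogeneousTrunc,
    coeff_homogeneousTrunc, coeff_homogeneousTrunc, one_mul]
  by_cases h : Finsupp.single K.succPNat 1 ≤ d
  · obtain ⟨d, rfl⟩ := exists_add_of_le h
    have hK : ¬ ((Finsupp.single K.succPNat 1 + d).degree = r + 1 ∧
        ∀ u ∈ (Finsupp.single K.succPNat 1 + d : ℕ+ →₀ ℕ).support, (u : ℕ) ≤ K) := by
      rintro ⟨-, h2⟩
      have := h2 K.succPNat (by simp)
      simp at this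
    rw [if_pos h, add_tsub_cancel_left, if_neg hK, zero_add]
    · refine if_congr (and_congr ?_ ?_) rfl rfl
      · rw [map_add, Finsupp.degree_single, add_comm 1, Nat.add_right_cancel_iff]
      · refine ⟨fun h u hu => h u ?_, fun h u hu => ?_⟩
        · simp only [Finsupp.mem_support_iff, Finsupp.add_apply] at hu ⊢
          omega
        · by_cases hu' : u = K.succPNat
          · simp [hu']
          · refine h u ?_
            simpa [Finsupp.single_apply, Ne.symm hu'] using hu
  · rw [if_neg h, add_zero]
    refine if_congr (and_congr_right fun _ => ⟨fun h' u hu => ?_, fun h' u hu => ?_⟩) rfl rfl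
    · have h1 := h' u hu
      have h2 : u ≠ K.succPNat := by
        rintro rfl
        refine h (Finsupp.single_le_iff.2 (Nat.one_le_iff_ne_zero.2 (Finsupp.mem_support_iff.1 hu)))
      have h3 : (u : ℕ) ≠ K + 1 := fun h => h2 (PNat.coe_injective (by simp [h]))
      omega
    · exact (h' u hu).trans (Nat.le_succ K)

/-- The recursion for `h` says that adjoining the variable `x K.succPNat` divides the series by `1 -
x K.succPNat * z`. -/
theorem elemProd_mul_mk {R : Type*} [CommRing R] {x : ℕ+ → R} {h : ℕ → ℕ → R}
    (h1 : ∀ K, h K 0 = 1) (h2 : ∀ r, h 0 (r + 1) = 0)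
    (h3 : ∀ K r, h (K + 1) (r + 1) = h K (r + 1) + x K.succPNat * h (K + 1) r) (K : ℕ) :
    elemProd x K 1 * PowerSeries.mk (h K) = 1 := by
  induction K with
  | zero =>
    ext r
    cases r <;> simp [elemProd, h1, h2, PowerSeries.coeff_one]
  | succ K ih =>
    rw [← ih, elemProd, Finset.prod_range_succ, mul_assoc]
    refine congrArg₂ (· * ·) rfl ?_
    ext r
    cases r with
    | zero => simp [h1]
    | succ r =>
      rw [sub_mul, one_mul, mul_assoc, map_sub, PowerSeries.coeff_C_mul,
        PowerSeries.coeff_succ_X_mul]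
      simp [h3]

variable {N : ℕ} [NeZero N]

/-! ### Statistics as exponents -/

/-- The exponent that records a number of bars and a color vector. -/
noncomputable def expo (j : ℕ) (β : ColorVector N) : Option (PosColor N) →₀ ℕ :=
  Finsupp.equivFunOnFinite.symm fun o => o.elim j β

@[simp] theorem expo_none (j : ℕ) (β : ColorVector N) : expo j β none = j := rfl

@[simp] theorem expo_some (j : ℕ) (β : ColorVector N) (m : PosColor N) :
    expo j β (some m) = β m := rfl

theorem expo_inj {j j' : ℕ} {β β' : ColorVector N} :
    expo j β = expo j' β' ↔ j = j' ∧ β = β' := by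
  refine ⟨fun h => ⟨DFunLike.congr_fun h none, funext fun m => DFunLike.congr_fun h (some m)⟩, ?_⟩
  rintro ⟨rfl, rfl⟩
  rfl

/-- The ring in which banners are counted. -/
abbrev StatRing (N : ℕ) [NeZero N] : Type :=
  MvPolynomial (Option (PosColor N)) (MvPowerSeries ℕ+ ℤ)

/-- The variable of a number. -/
noncomputable def numVar (N : ℕ) [NeZero N] (u : ℕ+) : StatRing N :=
  MvPolynomial.C (MvPowerSeries.X u)

/-- The variable of the bars. -/
noncomputable def barVar (N : ℕ) [NeZero N] : StatRing N := MvPolynomial.X none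

/-- The variable of a color. -/
noncomputable def colVar (c : Fin N) : StatRing N :=
  if h : c = 0 then 1 else MvPolynomial.X (some ⟨c, h⟩)

theorem colVar_zero : colVar (0 : Fin N) = 1 := by simp [colVar]

theorem colVar_pos (m : PosColor N) : colVar m.1 = MvPolynomial.X (some m) := by
  simp [colVar, m.2]

theorem letterWeight_eq (a : Letter N) : letterWeight (numVar N) (barVar N) colVar a =
    MvPolynomial.monomial (expo (bars [a]) (colorVector [a]))
      (MvPowerSeries.monomial (Finsupp.single a.abs 1) 1) := by
  have key : ∀ (e : Option (PosColor N) →₀ ℕ), expo (bars [a]) (colorVector [a]) = e →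
      MvPolynomial.monomial (expo (bars [a]) (colorVector [a]))
      (MvPowerSeries.monomial (Finsupp.single a.abs 1) (1 : ℤ)) =
        numVar N a.abs * MvPolynomial.monomial e 1 := by
    rintro e rfl
    rw [numVar, MvPolynomial.C_mul_monomial, mul_one]
    rfl
  cases a with
  | plain u c =>
    by_cases hc : c = 0
    · rw [key 0 ?_]
      · simp [letterWeight, hc, colVar_zero, Letter.abs]
      · ext o
        cases o with
        | none => simp [bars, Letter.isBarred]
        | some m => simp [colorVector, Letter.color, hc, m.2.symm]
    · rw [key (Finsupp.single (some ⟨c, hc⟩) 1) ?_]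
      · simp [letterWeight, hc, colVar, Letter.abs, MvPolynomial.X]
      · ext o
        cases o with
        | none => simp [bars, Letter.isBarred]
        | some m =>
          simp [colorVector, Letter.color, Finsupp.single_apply, List.countP_cons,
            Subtype.ext_iff]
          by_cases h : c = m.1 <;> simp [h]
  | bar u =>
    rw [key (Finsupp.single none 1) ?_]
    · simp [letterWeight, barVar, Letter.abs, MvPolynomial.X]
    · ext o
      cases o with
      | none => simp [bars, Letter.isBarred]
      | some m => simp [colorVector, Letter.color, m.2.symm]

theorem prod_letterWeight (w : List (Letter N)) :
    (w.map (letterWeight (numVar N) (barVar N) colVar)).prod =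
      MvPolynomial.monomial (expo (bars w) (colorVector w))
        (MvPowerSeries.monomial (absContent w) 1) := by
  induction w with
  | nil =>
    have h1 : expo (bars ([] : List (Letter N))) (colorVector ([] : List (Letter N))) = 0 := by
      ext o
      cases o <;> simp [bars, colorVector]
    have h2 : absContent ([] : List (Letter N)) = 0 := by simp [absContent]
    rw [h1, h2]
    simp
  | cons a w ih =>
    have h1 : expo (bars (a :: w)) (colorVector (a :: w)) =
        expo (bars [a]) (colorVector [a]) + expo (bars w) (colorVector w) := by
      ext o
      cases o <;> simp [bars, colorVector, List.countP_cons, add_comm]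
    have h2 : absContent (a :: w) = Finsupp.single a.abs 1 + absContent w := by
      rw [absContent, absContent, ← Multiset.cons_coe, Multiset.map_cons,
        ← Multiset.singleton_add, map_add, Multiset.toFinsupp_singleton]
    rw [List.map_cons, List.prod_cons, ih, letterWeight_eq, MvPolynomial.monomial_mul,
      MvPowerSeries.monomial_mul_monomial, h1, h2, one_mul]

/-- The banners counted by `K₀ n j β` with letters up to `K`. -/
noncomputable def truncSeries (K n j : ℕ) (β : ColorVector N) : MvPowerSeries ℕ+ ℤ :=
  MvPolynomial.coeff (expo j β)
    (PowerSeries.coeff n (freeSeries (numVar N) (barVar N) colVar K))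

/-- A word whose content is `d` uses only letters with absolute values in the support of `d`, so the
truncation at `K` loses nothing. This passes from finite alphabets to all letters one coefficient at
a time. -/
theorem coeff_truncSeries {K n j : ℕ} {β : ColorVector N} {d : ℕ+ →₀ ℕ}
    (hd : ∀ u ∈ d.support, (u : ℕ) ≤ K) :
    MvPowerSeries.coeff d (truncSeries K n j β) =
      MvPowerSeries.coeff d (genSeries (K₀ n j β) absContent) := by
  classical
  rw [coeff_genSeries, Nat.subtype_card ((words (letters N K) n).filter fun w =>
    w ∈ K₀ n j β ∧ absContent w = d) ?_]
  · rw [truncSeries, freeSeries, wordSeries, PowerSeries.coeff_mk, MvPolynomial.coeff_sum,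
      map_sum, Finset.card_filter, Nat.cast_sum]
    refine Finset.sum_congr rfl fun w hw => ?_
    have hl := (mem_words.1 hw).1
    simp only [mem_K₀_iff, HasStatistics]
    split_ifs with h1 h2 h2
    · rw [prod_letterWeight, MvPolynomial.coeff_monomial, if_pos, h2.2.2.2.2,
        MvPowerSeries.coeff_monomial_same, Nat.cast_one]
      rw [h2.2.2.2.1, h2.2.2.1]
    · rw [prod_letterWeight, MvPolynomial.coeff_monomial]
      split_ifs with h3
      · rw [expo_inj] at h3
        rw [MvPowerSeries.coeff_monomial_ne, Nat.cast_zero]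
        rintro rfl
        exact h2 ⟨h1, hl, h3.2, h3.1, rfl⟩
      · simp
    · exact absurd h2.1 h1
    · simp
  · intro w
    rw [Finset.mem_filter, mem_words]
    refine ⟨fun h => h.2, fun h => ⟨⟨h.1.2.1, fun a ha => mem_letters.2 (hd _ ?_)⟩, h⟩⟩
    rw [← h.2, absContent, Multiset.toFinsupp_support, Multiset.mem_toFinset]
    exact Multiset.mem_map_of_mem _ (Multiset.mem_coe.2 ha)

end Recurrence

end ColoredBanner

namespace ColoredBanner

section Recurrence

open Finset.HasAntidiagonal (antidiagonal)

variable {N : ℕ} [NeZero N]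

/-! ### The coefficients of the products -/

/-- The degree of an exponent in the colors. -/
noncomputable def colorDegree (e : Option (PosColor N) →₀ ℕ) : ℕ := ∑ m, e (some m)

/-- The coefficients of `z ^ n` have degree at least `n` in the colors. -/
def ColorBounded (f : PowerSeries (StatRing N)) : Prop :=
  ∀ n e, colorDegree e < n → MvPolynomial.coeff e (PowerSeries.coeff n f) = 0

theorem ColorBounded.one : ColorBounded (1 : PowerSeries (StatRing N)) := by
  intro n e h
  rw [PowerSeries.coeff_one, if_neg (Nat.pos_of_ne_zero (by omega)).ne', MvPolynomial.coeff_zero]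

theorem ColorBounded.mul {f g : PowerSeries (StatRing N)} (hf : ColorBounded f)
    (hg : ColorBounded g) : ColorBounded (f * g) := by
  intro n e h
  rw [PowerSeries.coeff_mul, MvPolynomial.coeff_sum]
  refine Finset.sum_eq_zero fun p hp => ?_
  rw [MvPolynomial.coeff_mul]
  refine Finset.sum_eq_zero fun q hq => ?_
  rw [Finset.HasAntidiagonal.mem_antidiagonal] at hp hq
  have hd : colorDegree e = colorDegree q.1 + colorDegree q.2 := by
    simp [← hq, colorDegree, Finset.sum_add_distrib]
  rcases lt_or_ge (colorDegree q.1) p.1 with h1 | h1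
  · rw [hf _ _ h1, zero_mul]
  · rw [hg _ _ (by omega), mul_zero]

theorem ColorBounded.prod {ι : Type*} (S : Finset ι) {f : ι → PowerSeries (StatRing N)}
    (hf : ∀ i ∈ S, ColorBounded (f i)) : ColorBounded (∏ i ∈ S, f i) :=
  Finset.prod_induction f ColorBounded (fun _ _ => ColorBounded.mul) ColorBounded.one hf

/-- In each factor `1 - x u * s m * z` every power of `z` comes with the variable of the color `m`.
-/
theorem colorBounded_elemProd (K : ℕ) (m : PosColor N) :
    ColorBounded (elemProd (numVar N) K (colVar m.1)) := by
  refine ColorBounded.prod _ fun k _ n e h => ?_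
  rcases n with _ | _ | n
  · omega
  · have : ¬ Finsupp.single (some m) 1 = e := by
      rintro rfl
      have h1 := Finset.single_le_sum (f := fun i : PosColor N =>
        (Finsupp.single (some m) 1 : Option (PosColor N) →₀ ℕ) (some i))
        (fun _ _ => Nat.zero_le _) (Finset.mem_univ m)
      simp only [Finsupp.single_eq_same] at h1
      rw [colorDegree] at h
      omega
    rw [map_sub, PowerSeries.coeff_C_mul, PowerSeries.coeff_one_X, colVar_pos, numVar, mul_one,
      PowerSeries.coeff_one, if_neg (Nat.succ_ne_zero 0), zero_sub, MvPolynomial.coeff_neg,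
      MvPolynomial.coeff_C_mul, MvPolynomial.coeff_X, if_neg this, mul_zero, neg_zero]
  · rw [map_sub, PowerSeries.coeff_C_mul, PowerSeries.coeff_X, if_neg (by omega),
      PowerSeries.coeff_one, if_neg (by omega), mul_zero, sub_zero, MvPolynomial.coeff_zero]

theorem coeff_mul_barVar_pow (G : StatRing N) (a : MvPowerSeries ℕ+ ℤ) (b j : ℕ)
    (β : ColorVector N) :
    MvPolynomial.coeff (expo j β) (G * (MvPolynomial.C a * barVar N ^ b)) =
      if b ≤ j then MvPolynomial.coeff (expo (j - b) β) G * a else 0 := by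
  have h : Finsupp.single none b ≤ expo j β ↔ b ≤ j := by simp
  rw [barVar, MvPolynomial.X_pow_eq_monomial, MvPolynomial.C_mul_monomial, mul_one,
    MvPolynomial.coeff_mul_monomial']
  refine if_congr h (congrArg (fun e => MvPolynomial.coeff e G * a) ?_) rfl
  ext o
  cases o <;> simp

/-- The color variable takes one letter of color `m` out of `β`; this is the source of `hat β m` and
of the condition `0 < β m`. -/
theorem coeff_mul_colVar_barVar_pow (G : StatRing N) (a : MvPowerSeries ℕ+ ℤ) (b j : ℕ)
    (β : ColorVector N) (m : PosColor N) :
    MvPolynomial.coeff (expo j β) (G * (MvPolynomial.C a * (colVar m.1 * barVar N ^ b))) =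
      if 0 < β m then
        if b ≤ j then MvPolynomial.coeff (expo (j - b) (hat β m)) G * a else 0
      else 0 := by
  have h : Finsupp.single (some m) 1 + Finsupp.single none b ≤ expo j β ↔ 0 < β m ∧ b ≤ j := by
    simp only [Finsupp.le_def, Option.forall, Finsupp.add_apply, expo_none, expo_some]
    constructor
    · rintro ⟨h1, h2⟩
      exact ⟨by simpa [Nat.one_le_iff_ne_zero, Nat.pos_iff_ne_zero] using h2 m, by simpa using h1⟩
    · rintro ⟨h1, h2⟩
      refine ⟨by simpa using h2, fun m' => ?_⟩
      by_cases hm : m' = m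
      · subst hm
        simpa [Nat.one_le_iff_ne_zero, Nat.pos_iff_ne_zero] using h1
      · simp [Ne.symm hm]
  rw [barVar, colVar_pos, MvPolynomial.X_pow_eq_monomial, MvPolynomial.X,
    MvPolynomial.monomial_mul, MvPolynomial.C_mul_monomial, mul_one, mul_one,
    MvPolynomial.coeff_mul_monomial', ← ite_and]
  refine if_congr h (congrArg (fun e => MvPolynomial.coeff e G * a) ?_) rfl
  ext o
  cases o with
  | none => simp
  | some m' =>
    by_cases hm : m' = m
    · subst hm
      simp [hat]
    · simp [hat, hm]

/-! ### Changing the summation indices -/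

/-- The substitution is `k = j - b` with `r = n - i`: the range `1 ≤ b < r` turns into `k < j` and
`j - n + i < k`, and forces `i ≤ n - 2`. -/
theorem sum_antidiagonal_index₀ {M : Type*} [AddCommMonoid M] (n j : ℕ) (F : ℕ → ℕ → ℕ → M) :
    ∑ p ∈ antidiagonal n, ∑ b ∈ Finset.Ico 1 p.2,
      (if b ≤ j then F p.1 (j - b) p.2 else 0) =
    ∑ p ∈ index₀ n j, F p.1 p.2 (n - p.1) := by
  simp only [← Finset.sum_filter]
  rw [Finset.sum_sigma']
  refine Finset.sum_bij' (fun q _ => (q.1.1, j - q.2)) (fun p _ => ⟨(p.1, n - p.1), j - p.2⟩)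
    ?_ ?_ ?_ ?_ ?_
  · rintro ⟨⟨i, r⟩, b⟩ h
    simp only [Finset.mem_sigma, Finset.HasAntidiagonal.mem_antidiagonal,
      Finset.mem_filter, Finset.mem_Ico] at h
    simp only [index₀, Finset.mem_filter, Finset.mem_product, Finset.mem_range]
    omega
  · rintro ⟨i, k⟩ h
    simp only [index₀, Finset.mem_filter, Finset.mem_product, Finset.mem_range] at h
    simp only [Finset.mem_sigma, Finset.HasAntidiagonal.mem_antidiagonal,
      Finset.mem_filter, Finset.mem_Ico]
    omega
  · rintro ⟨⟨i, r⟩, b⟩ h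
    simp only [Finset.mem_sigma, Finset.HasAntidiagonal.mem_antidiagonal,
      Finset.mem_filter, Finset.mem_Ico] at h
    obtain rfl : r = n - i := by omega
    obtain ⟨-, -, h⟩ := h
    simp only [Nat.sub_sub_self h]
  · rintro ⟨i, k⟩ h
    simp only [index₀, Finset.mem_filter, Finset.mem_product, Finset.mem_range] at h
    simp only [Prod.mk.injEq, true_and]
    omega
  · rintro ⟨⟨i, r⟩, b⟩ h
    simp only [Finset.mem_sigma, Finset.HasAntidiagonal.mem_antidiagonal] at h
    obtain rfl : r = n - i := by omega
    rfl

theorem sum_antidiagonal_indexPos {M : Type*} [AddCommMonoid M] (n j : ℕ) (F : ℕ → ℕ → ℕ → M) :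
    ∑ p ∈ antidiagonal n, ∑ b ∈ Finset.range p.2,
      (if b ≤ j then F p.1 (j - b) p.2 else 0) =
    ∑ p ∈ indexPos n j, F p.1 p.2 (n - p.1) := by
  simp only [← Finset.sum_filter]
  rw [Finset.sum_sigma']
  refine Finset.sum_bij' (fun q _ => (q.1.1, j - q.2)) (fun p _ => ⟨(p.1, n - p.1), j - p.2⟩)
    ?_ ?_ ?_ ?_ ?_
  · rintro ⟨⟨i, r⟩, b⟩ h
    simp only [Finset.mem_sigma, Finset.HasAntidiagonal.mem_antidiagonal,
      Finset.mem_filter, Finset.mem_range] at h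
    simp only [indexPos, Finset.mem_filter, Finset.mem_product, Finset.mem_range]
    omega
  · rintro ⟨i, k⟩ h
    simp only [indexPos, Finset.mem_filter, Finset.mem_product, Finset.mem_range] at h
    simp only [Finset.mem_sigma, Finset.HasAntidiagonal.mem_antidiagonal,
      Finset.mem_filter, Finset.mem_range]
    omega
  · rintro ⟨⟨i, r⟩, b⟩ h
    simp only [Finset.mem_sigma, Finset.HasAntidiagonal.mem_antidiagonal,
      Finset.mem_filter, Finset.mem_range] at h
    obtain rfl : r = n - i := by omega
    obtain ⟨-, -, h⟩ := h
    simp only [Nat.sub_sub_self h]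
  · rintro ⟨i, k⟩ h
    simp only [indexPos, Finset.mem_filter, Finset.mem_product, Finset.mem_range] at h
    simp only [Prod.mk.injEq, true_and]
    omega
  · rintro ⟨⟨i, r⟩, b⟩ h
    simp only [Finset.mem_sigma, Finset.HasAntidiagonal.mem_antidiagonal] at h
    obtain rfl : r = n - i := by omega
    rfl

/-! ### The recurrence -/

theorem coeff_mul_markWeight (G : StatRing N) (a : MvPowerSeries ℕ+ ℤ) (r j : ℕ)
    (β : ColorVector N) :
    MvPolynomial.coeff (expo j β)
        (G * (MvPolynomial.C a * markWeight (barVar N) colVar r)) =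
      (∑ b ∈ Finset.Ico 1 r,
        if b ≤ j then MvPolynomial.coeff (expo (j - b) β) G * a else 0) +
      ∑ m : PosColor N, if 0 < β m then
        ∑ b ∈ Finset.range r,
          (if b ≤ j then MvPolynomial.coeff (expo (j - b) (hat β m)) G * a else 0)
      else 0 := by
  rw [markWeight, mul_add, mul_add, MvPolynomial.coeff_add, Finset.mul_sum, Finset.mul_sum,
    Finset.sum_mul, Finset.mul_sum, Finset.mul_sum, MvPolynomial.coeff_sum,
    MvPolynomial.coeff_sum]
  simp only [coeff_mul_barVar_pow]
  refine congrArg₂ (· + ·) rfl (Finset.sum_congr rfl fun m _ => ?_)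
  rw [Finset.mul_sum, Finset.mul_sum, Finset.mul_sum, MvPolynomial.coeff_sum]
  simp only [coeff_mul_colVar_barVar_pow]
  split_ifs with h
  · rfl
  · simp

theorem truncSeries_eq (K : ℕ) {n j : ℕ} {β : ColorVector N} (hβ : size β < n) :
    truncSeries K n j β =
      (∑ p ∈ index₀ n j, truncSeries K p.1 p.2 β * homogeneousTrunc K (n - p.1)) +
      ∑ m : PosColor N, if 0 < β m then
        ∑ p ∈ indexPos n j,
          truncSeries K p.1 p.2 (hat β m) * homogeneousTrunc K (n - p.1)
      else 0 := by
  have : IsDomain (MvPowerSeries ℕ+ ℤ) := NoZeroDivisors.to_isDomain _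
  have hh : elemProd (numVar N) K 1 *
      PowerSeries.mk (fun r => MvPolynomial.C (homogeneousTrunc K r)) = 1 :=
    elemProd_mul_mk (h := fun K r => MvPolynomial.C (homogeneousTrunc K r))
      (fun K => by simp [homogeneousTrunc_zero_right])
      (fun r => by simp [homogeneousTrunc_zero_succ])
      (fun K r => by simp [homogeneousTrunc_succ_succ, numVar]) K
  have ht : barVar N ≠ 1 := by
    intro h
    have := congrArg (MvPolynomial.coeff 0) h
    simp [barVar] at this
  -- The only use of `|β| < n`: the inhomogeneous term has too large a degree in the colors to
  -- contribute at `β`.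
  have hvanish : MvPolynomial.coeff (expo j β)
      (PowerSeries.coeff n (∏ m : PosColor N, elemProd (numVar N) K (colVar m.1))) = 0 :=
    ColorBounded.prod _ (fun m _ => colorBounded_elemProd K m) n _ (by simpa [colorDegree, size] using hβ)
  conv_lhs => rw [truncSeries, coeff_freeSeries _ _ _ _ colVar_zero ht hh n,
    MvPolynomial.coeff_add, hvanish, zero_add, MvPolynomial.coeff_sum]
  simp only [coeff_mul_markWeight]
  rw [Finset.sum_add_distrib, Finset.sum_comm]
  refine congrArg₂ (· + ·) (sum_antidiagonal_index₀ n j fun i k r =>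
    truncSeries K i k β * homogeneousTrunc K r) (Finset.sum_congr rfl fun m _ => ?_)
  split_ifs with h
  · exact sum_antidiagonal_indexPos n j fun i k r =>
      truncSeries K i k (hat β m) * homogeneousTrunc K r
  · simp

theorem coeff_truncSeries_mul {K i k r : ℕ} {β : ColorVector N} {d : ℕ+ →₀ ℕ}
    (hd : ∀ u ∈ d.support, (u : ℕ) ≤ K) :
    MvPowerSeries.coeff d (truncSeries K i k β * homogeneousTrunc K r) =
      MvPowerSeries.coeff d (genSeries (K₀ i k β) absContent * homogeneous r) := by
  classical
  rw [MvPowerSeries.coeff_mul, MvPowerSeries.coeff_mul]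
  refine Finset.sum_congr rfl fun p hp => ?_
  rw [Finset.HasAntidiagonal.mem_antidiagonal] at hp
  have h1 : ∀ u ∈ p.1.support, (u : ℕ) ≤ K := fun u hu => hd u (by
    rw [Finsupp.mem_support_iff] at hu ⊢
    rw [← hp, Finsupp.add_apply]
    omega)
  have h2 : ∀ u ∈ p.2.support, (u : ℕ) ≤ K := fun u hu => hd u (by
    rw [Finsupp.mem_support_iff] at hu ⊢
    rw [← hp, Finsupp.add_apply]
    omega)
  rw [coeff_truncSeries h1, coeff_homogeneousTrunc, coeff_homogeneous]
  exact congrArg _ (if_congr (and_iff_left h2) rfl rfl)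

/-- The recurrence for the generating functions of banners without Lyndon factors of length
one. -/
theorem genSeries_K₀_eq {n j : ℕ} {β : ColorVector N} (hβ : size β < n) :
    genSeries (K₀ n j β) absContent =
      (∑ p ∈ index₀ n j, genSeries (K₀ p.1 p.2 β) absContent * homogeneous (n - p.1)) +
      ∑ m : PosColor N, if 0 < β m then
        ∑ p ∈ indexPos n j,
          genSeries (K₀ p.1 p.2 (hat β m)) absContent * homogeneous (n - p.1)
      else 0 := by
  ext d
  have hd : ∀ u ∈ d.support, (u : ℕ) ≤ d.support.sup fun u : ℕ+ => (u : ℕ) := fun u hu =>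
    Finset.le_sup (f := fun u : ℕ+ => (u : ℕ)) hu
  rw [← coeff_truncSeries hd, truncSeries_eq _ hβ, map_add, map_add, map_sum, map_sum, map_sum,
    map_sum]
  refine congrArg₂ (· + ·) (Finset.sum_congr rfl fun p _ => coeff_truncSeries_mul hd)
    (Finset.sum_congr rfl fun m _ => ?_)
  split_ifs with h
  · rw [map_sum, map_sum]
    exact Finset.sum_congr rfl fun p _ => coeff_truncSeries_mul hd
  · rfl

end Recurrence

end ColoredBanner

namespace ColoredBanner

/-! ### From equal generating functions to a weight-preserving bijection -/

section WeightPreserving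

variable {T T' : Type*}

/-- A set whose generating function is given, all its coefficients being honest numbers. -/
def HasGenSeries (S : Set T) (c : T → ℕ+ →₀ ℕ) (f : MvPowerSeries ℕ+ ℤ) : Prop :=
  (∀ d, Finite {x // x ∈ S ∧ c x = d}) ∧ genSeries S c = f

theorem HasGenSeries.prod {S : Set T} {S' : Set T'} {c : T → ℕ+ →₀ ℕ} {c' : T' → ℕ+ →₀ ℕ}
    {f f' : MvPowerSeries ℕ+ ℤ} (h : HasGenSeries S c f) (h' : HasGenSeries S' c' f') :
    HasGenSeries (S ×ˢ S') (fun x => c x.1 + c' x.2) (f * f') := by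
  classical
  obtain ⟨h1, rfl⟩ := h
  obtain ⟨h1', rfl⟩ := h'
  have e : ∀ d, {x // x ∈ S ×ˢ S' ∧ c x.1 + c' x.2 = d} ≃
      Σ p : {p // p ∈ Finset.HasAntidiagonal.antidiagonal d},
        {x // x ∈ S ∧ c x = p.1.1} × {x // x ∈ S' ∧ c' x = p.1.2} := fun d =>
    { toFun := fun x => ⟨⟨(c x.1.1, c' x.1.2),
          Finset.HasAntidiagonal.mem_antidiagonal.2 x.2.2⟩,
        ⟨x.1.1, x.2.1.1, rfl⟩, ⟨x.1.2, x.2.1.2, rfl⟩⟩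
      invFun := fun y => ⟨(y.2.1.1, y.2.2.1), ⟨y.2.1.2.1, y.2.2.2.1⟩, by
        have := Finset.HasAntidiagonal.mem_antidiagonal.1 y.1.2
        exact (congrArg₂ (· + ·) y.2.1.2.2 y.2.2.2.2).trans this⟩
      left_inv := fun _ => rfl
      right_inv := by
        rintro ⟨⟨⟨d1, d2⟩, hd⟩, ⟨x, hx, hx'⟩, ⟨y, hy, hy'⟩⟩
        obtain rfl : c x = d1 := hx'
        obtain rfl : c' y = d2 := hy'
        rfl }
  have hfin := fun p : (ℕ+ →₀ ℕ) × (ℕ+ →₀ ℕ) =>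
    (@Finite.instProd _ _ (h1 p.1) (h1' p.2))
  refine ⟨fun d => Finite.of_equiv _ (e d).symm, ?_⟩
  ext d
  rw [MvPowerSeries.coeff_mul, coeff_genSeries, Nat.card_congr (e d), Nat.card_sigma,
    Finset.sum_coe_sort (Finset.HasAntidiagonal.antidiagonal d) fun p =>
      Nat.card ({x // x ∈ S ∧ c x = p.1} × {x // x ∈ S' ∧ c' x = p.2}), Nat.cast_sum]
  simp only [Nat.card_prod, Nat.cast_mul, coeff_genSeries]

theorem HasGenSeries.biUnion {ι : Type*} {I : Finset ι} {S : ι → Set T} {c : T → ℕ+ →₀ ℕ}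
    {f : ι → MvPowerSeries ℕ+ ℤ} (hdisj : ∀ i ∈ I, ∀ k ∈ I, i ≠ k → Disjoint (S i) (S k))
    (h : ∀ i ∈ I, HasGenSeries (S i) c (f i)) :
    HasGenSeries (⋃ i ∈ I, S i) c (∑ i ∈ I, f i) := by
  have hfin : ∀ (d) (i : I), Finite {x // x ∈ S i ∧ c x = d} := fun d i => (h i.1 i.2).1 d
  let g : ∀ d, (Σ i : I, {x // x ∈ S i ∧ c x = d}) → {x // x ∈ (⋃ i ∈ I, S i) ∧ c x = d} :=
    fun d y => ⟨y.2.1, Set.mem_biUnion y.1.2 y.2.2.1, y.2.2.2⟩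
  have hg : ∀ d, Function.Bijective (g d) := by
    refine fun d => ⟨?_, ?_⟩
    · rintro ⟨⟨i, hi⟩, ⟨x, hx⟩⟩ ⟨⟨k, hk⟩, ⟨y, hy⟩⟩ hxy
      obtain rfl : x = y := congrArg Subtype.val hxy
      obtain rfl : i = k := by
        by_contra hik
        exact Set.disjoint_left.1 (hdisj i hi k hk hik) hx.1 hy.1
      rfl
    · rintro ⟨x, hx, hd⟩
      obtain ⟨i, hi, hx⟩ := Set.mem_iUnion₂.1 hx
      exact ⟨⟨⟨i, hi⟩, ⟨x, hx, hd⟩⟩, rfl⟩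
  refine ⟨fun d => Finite.of_surjective _ (hg d).2, ?_⟩
  ext d
  rw [coeff_genSeries, ← Nat.card_congr (Equiv.ofBijective _ (hg d)), Nat.card_sigma, map_sum,
    Nat.cast_sum, ← Finset.sum_coe_sort I]
  refine Finset.sum_congr rfl fun i _ => ?_
  rw [← (h i.1 i.2).2, coeff_genSeries]

variable {N : ℕ} [NeZero N]

theorem hasGenSeries_K₀ (n j : ℕ) (β : ColorVector N) :
    HasGenSeries (K₀ n j β) absContent (genSeries (K₀ n j β) absContent) := by
  refine ⟨fun d => ?_, rfl⟩
  refine ((words (letters N (d.support.sup fun u : ℕ+ => (u : ℕ))) n).finite_toSet.subset ?_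
    ).to_subtype
  intro w h
  refine mem_words.2 ⟨h.1.2.1, fun a ha => mem_letters.2 ?_⟩
  refine Finset.le_sup (f := fun u : ℕ+ => (u : ℕ)) (b := a.abs) ?_
  rw [← h.2, absContent, Multiset.toFinsupp_support, Multiset.mem_toFinset]
  exact Multiset.mem_map_of_mem _ (Multiset.mem_coe.2 ha)

/-- The content of a marked sequence. -/
noncomputable def MarkedSeq.content (s : MarkedSeq N) : ℕ+ →₀ ℕ :=
  Multiset.toFinsupp (s.seq : Multiset ℕ+)

/-- With mark and color fixed, a marked sequence is determined by its content, and each content of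
degree `r` occurs, by sorting. -/
theorem hasGenSeries_M {r b : ℕ} {m : Fin N} (hb : b < r) (hm : m = 0 → 1 ≤ b) :
    HasGenSeries (M r b m) MarkedSeq.content (homogeneous r) := by
  have hsub : ∀ d, Subsingleton {s // s ∈ M r b m ∧ s.content = d} := by
    refine fun d => ⟨?_⟩
    rintro ⟨s, ⟨h1, h2, h3⟩, h4⟩ ⟨s', ⟨h1', h2', h3'⟩, h4'⟩
    refine Subtype.ext (MarkedSeq.ext ?_ (h2.trans h2'.symm) (h3.trans h3'.symm))
    refine List.Perm.eq_of_pairwise (fun _ _ _ _ => le_antisymm) s.weaklyIncreasing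
      s'.weaklyIncreasing (Multiset.coe_eq_coe.1 ?_)
    exact Multiset.toFinsupp.injective (h4.trans h4'.symm)
  refine ⟨fun d => inferInstance, ?_⟩
  ext d
  rw [coeff_genSeries, coeff_homogeneous]
  have hcard : ∀ l : List ℕ+, (Multiset.toFinsupp (l : Multiset ℕ+)).degree = l.length := by
    intro l
    rw [← Multiset.coe_card, ← Multiset.toFinsupp_toMultiset (l : Multiset ℕ+),
      Finsupp.card_toMultiset, Multiset.toFinsupp_toMultiset]
    rfl
  split_ifs with hd
  · have hlen : ((Finsupp.toMultiset d).sort (· ≤ ·)).length = r := by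
      rw [Multiset.length_sort, Finsupp.card_toMultiset, ← hd]
      rfl
    have : Nonempty {s : MarkedSeq N // s ∈ M r b m ∧ s.content = d} :=
      ⟨⟨⟨(Finsupp.toMultiset d).sort (· ≤ ·), b, m, Multiset.pairwise_sort _ _,
        by rwa [hlen], hm⟩, ⟨hlen, rfl, rfl⟩, by
          rw [MarkedSeq.content, Multiset.sort_eq, Finsupp.toMultiset_toFinsupp]⟩⟩
    rw [Nat.card_eq_one_iff_unique.2 ⟨hsub d, this⟩, Nat.cast_one]
  · have : IsEmpty {s : MarkedSeq N // s ∈ M r b m ∧ s.content = d} := by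
      refine ⟨fun s => hd ?_⟩
      rw [← s.2.2, MarkedSeq.content, hcard, s.2.1.1]
    rw [Nat.card_of_isEmpty, Nat.cast_zero]

/-- The content of a pair of a banner and a marked sequence. -/
noncomputable def pairContent (x : List (Letter N) × MarkedSeq N) : ℕ+ →₀ ℕ :=
  absContent x.1 + x.2.content

theorem hasGenSeries_X_zero (n j : ℕ) (β : ColorVector N) :
    HasGenSeries (X n j β 0) pairContent
      (∑ p ∈ index₀ n j, genSeries (K₀ p.1 p.2 β) absContent * homogeneous (n - p.1)) := by
  rw [X, dif_pos rfl]
  refine HasGenSeries.biUnion (fun p _ q _ hpq => disjoint_pieces n j β 0 hpq) fun p hp => ?_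
  simp only [index₀, Finset.mem_filter, Finset.mem_product, Finset.mem_range] at hp
  exact (hasGenSeries_K₀ _ _ _).prod (hasGenSeries_M (by omega) fun _ => by omega)

theorem hasGenSeries_X_pos (n j : ℕ) (β : ColorVector N) (m : PosColor N) :
    HasGenSeries (X n j β m.1) pairContent
      (if 0 < β m then
        ∑ p ∈ indexPos n j,
          genSeries (K₀ p.1 p.2 (hat β m)) absContent * homogeneous (n - p.1)
      else 0) := by
  rw [X, dif_neg m.2]
  split_ifs with h
  · refine HasGenSeries.biUnion (fun p _ q _ hpq => disjoint_pieces n j (hat β m) m.1 hpq)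
      fun p hp => ?_
    simp only [indexPos, Finset.mem_filter, Finset.mem_product, Finset.mem_range] at hp
    exact (hasGenSeries_K₀ _ _ _).prod (hasGenSeries_M (by omega) fun h => absurd h m.2)
  · refine ⟨fun d => ?_, ?_⟩
    · have : IsEmpty {x : List (Letter N) × MarkedSeq N // x ∈ (∅ : Set _) ∧ pairContent x = d} :=
        ⟨fun x => x.2.1⟩
      infer_instance
    · ext d
      rw [coeff_genSeries, map_zero]
      simp

omit [NeZero N] in
theorem wt_eq (w : List (Letter N)) :
    wt w = ((Finsupp.toMultiset (absContent w)).map MvPolynomial.X).prod := by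
  rw [absContent, Multiset.toFinsupp_toMultiset, Multiset.map_map, Multiset.map_coe,
    Multiset.prod_coe]
  rfl

theorem wtSeq_eq (s : MarkedSeq N) :
    wtSeq s.seq = ((Finsupp.toMultiset s.content).map MvPolynomial.X).prod := by
  rw [MarkedSeq.content, Multiset.toFinsupp_toMultiset, Multiset.map_coe, Multiset.prod_coe]
  rfl

theorem wt_eq_of_content {w v : List (Letter N)} {s : MarkedSeq N}
    (h : pairContent (v, s) = absContent w) : wt w = wt v * wtSeq s.seq := by
  rw [wt_eq, wt_eq, wtSeq_eq, ← h, pairContent, map_add, Multiset.map_add, Multiset.prod_add]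

/-- The recurrence says that both sides have the same number of elements for each content; products
of generating functions correspond to the additive content of pairs. Any bijection between these
finite fibers preserves the weight. -/
theorem exists_equiv_sigma_X {n j : ℕ} {β : ColorVector N} (hβ : size β < n) :
    ∃ γ : K₀ n j β ≃ (Σ m : Fin N, X n j β m), ∀ B : K₀ n j β,
      wt B.1 = wt (γ B).2.1.1 * wtSeq (γ B).2.1.2.seq := by
  let F : Fin N → MvPowerSeries ℕ+ ℤ := fun m => genSeries (X n j β m) pairContent
  have hX : ∀ m, HasGenSeries (X n j β m) pairContent (F m) := fun m => by
    refine ⟨?_, rfl⟩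
    by_cases hm : m = 0
    · subst hm
      exact (hasGenSeries_X_zero n j β).1
    · exact (hasGenSeries_X_pos n j β ⟨m, hm⟩).1
  have hsum : genSeries (K₀ n j β) absContent = ∑ m, F m := by
    classical
    rw [genSeries_K₀_eq hβ, ← Finset.add_sum_erase _ _ (Finset.mem_univ (0 : Fin N)),
      Finset.sum_subtype (p := fun c : Fin N => c ≠ 0) _ (by simp)]
    refine congrArg₂ (· + ·) (hasGenSeries_X_zero n j β).2.symm
      (Finset.sum_congr rfl fun m _ => (hasGenSeries_X_pos n j β m).2.symm)
  let g : (Σ m : Fin N, X n j β m) → ℕ+ →₀ ℕ := fun x => pairContent x.2.1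
  have e1 : ∀ d, {a : K₀ n j β // absContent a.1 = d} ≃ {w // w ∈ K₀ n j β ∧ absContent w = d} :=
    fun d => Equiv.subtypeSubtypeEquivSubtypeInter (· ∈ K₀ n j β) fun w => absContent w = d
  have e2 : ∀ d, {y // g y = d} ≃ Σ m : Fin N, {x // x ∈ X n j β m ∧ pairContent x = d} :=
    fun d =>
    { toFun := fun y => ⟨y.1.1, y.1.2.1, y.1.2.2, y.2⟩
      invFun := fun z => ⟨⟨z.1, z.2.1, z.2.2.1⟩, z.2.2.2⟩
      left_inv := fun _ => rfl
      right_inv := fun _ => rfl }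
  have hf1 := (hasGenSeries_K₀ n j β).1
  have hf2 := fun d m => (hX m).1 d
  obtain ⟨γ, hγ⟩ := exists_equiv_of_card_fiber_eq (f := fun w : K₀ n j β => absContent w.1) (g := g)
    (fun d => Finite.of_equiv _ (e1 d).symm) (fun d => Finite.of_equiv _ (e2 d).symm) fun d => by
      have h := congrArg (MvPowerSeries.coeff d) hsum
      rw [map_sum, coeff_genSeries] at h
      rw [Nat.card_congr (e1 d), Nat.card_congr (e2 d), Nat.card_sigma]
      simp only [F, coeff_genSeries] at h
      exact_mod_cast h
  exact ⟨γ, fun B => wt_eq_of_content (hγ B)⟩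

end WeightPreserving

end ColoredBanner

theorem theorem4p6 (N : ℕ) [NeZero N] (n j : ℕ) (β : ColoredBanner.ColorVector N)
    (hβ : ColoredBanner.size β < n) :
    (∃ γ : ColoredBanner.K₀ n j β ≃ (Σ m : Fin N, ColoredBanner.X n j β m),
      ∀ B : ColoredBanner.K₀ n j β,
        ColoredBanner.wt B.1 =
          ColoredBanner.wt (γ B).2.1.1 * ColoredBanner.wtSeq (γ B).2.1.2.seq) ∧
    ColoredBanner.Q n j 0 β =
      (∑ p ∈ ColoredBanner.index₀ n j,
        ColoredBanner.Q p.1 p.2 0 β * ColoredBanner.homogeneous (n - p.1)) +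
      ∑ m : ColoredBanner.PosColor N,
        if 0 < β m then
          ∑ p ∈ ColoredBanner.indexPos n j,
            ColoredBanner.Q p.1 p.2 0 (ColoredBanner.hat β m) *
              ColoredBanner.homogeneous (n - p.1)
        else 0 := by
  refine ⟨ColoredBanner.exists_equiv_sigma_X hβ, ?_⟩
  simp only [ColoredBanner.Q_eq_genSeries]
  exact ColoredBanner.genSeries_K₀_eq hβ
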